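/- Let $n\ge 2$ and let $c_1,\dots,c_{2n}$ be the Jordan–Wigner operators on $n$ qubit lines: $c_{2k-1}=Z^{\otimes(k-1)}\otimes X\otimes I^{\otimes(n-k)}$ and $c_{2k}=Z^{\otimes(k-1)}\otimes Y\otimes I^{\otimes(n-k)}$. A quadratic Hamiltonian is a hermitian operator of the form $H=i\sum_{\mu\ne\nu}h_{\mu\nu}c_\mu c_\nu$. For $A,B\in U(2)$ with $\det A=\det B$, let $G(A,B)$ be the two-qubit gate that acts as $A$ on $\mathrm{span}\{|00\rangle,|11\rangle\}$ and as $B$ on $\mathrm{span}\{|01\rangle,|10\rangle\}$. There are a constant $C$, independent of $n$ and $H$, and an assignment to each $n\ge2$ and each quadratic Hamiltonian $H$ on $n$ lines of a circuit $U_1,\dots,U_N$ with $N\le Cn^3$ such that $$e^{iH}=U_NU_{N-1}\cdots U_1$$ exactly, where each $U_j$ is a $G(A,B)$ gate acting on two nearest-neighbour lines $k,k+1$ ($k=k_j$), and moreover $U_j=e^{iH_j}$, where $H_j=i\sum_{\mu,\nu}h^{(j)}_{\mu\nu}c_\mu c_\nu$ with $h^{(j)}$ real and antisymmetric, the sum involving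 only the four operators $c_{2k-1},c_{2k},c_{2k+1},c_{2k+2}$. The circuit is computable in polynomial time: there is one deterministic algorithm that, given $n$, a rational antisymmetric matrix $h$ (integer numerators over a common denominator) and $m\ge0$, outputs $N$, the positions $k_j$, and all coefficients $h^{(j)}_{\mu\nu}$ of the exact circuit assigned to $H=i\sum_{\mu,\nu} h_{\mu\nu}c_\mu c_\nu$ up to an error of at most $2^{-m}$, in a number of bit operations polynomial in $n$, $m$ and the bit length of $h$. -/

import Mathlib

noncomputable section

/-! ### Operators on `n` qubit lines -/

/-- Operators on `n` qubits, as matrices in the computational basis; a basis state is a bit string,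
and the lines are numbered `0, …, n - 1`. -/
abbrev QOp (n : ℕ) : Type := Matrix (Fin n → Fin 2) (Fin n → Fin 2) ℂ

/-- Pauli `X`. -/
def pauliX : Matrix (Fin 2) (Fin 2) ℂ := !![0, 1; 1, 0]

/-- Pauli `Y`. -/
def pauliY : Matrix (Fin 2) (Fin 2) ℂ := !![0, -Complex.I; Complex.I, 0]

/-- Pauli `Z`. -/
def pauliZ : Matrix (Fin 2) (Fin 2) ℂ := !![1, 0; 0, -1]

/-- The product operator `P 0 ⊗ P 1 ⊗ ⋯ ⊗ P (n - 1)`. -/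
def productOp {n : ℕ} (P : Fin n → Matrix (Fin 2) (Fin 2) ℂ) : QOp n :=
  Matrix.of fun x y => ∏ i, P i (x i) (y i)

/-- The Jordan–Wigner generators, numbered from `0`: for `μ = 2k` the operator `Z ⋯ Z X I ⋯ I`, and
for `μ = 2k + 1` the operator `Z ⋯ Z Y I ⋯ I`, with `X` or `Y` on line `k`. -/
def jw {n : ℕ} (μ : Fin (2 * n)) : QOp n :=
  productOp fun i =>
    if i.val < μ.val / 2 then pauliZ
    else if i.val = μ.val / 2 then (if μ.val % 2 = 0 then pauliX else pauliY)
    else 1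

/-- The quadratic element `i ∑_{μ ≠ ν} h μ ν c_μ c_ν` of the Clifford algebra. -/
def quadraticOp {n : ℕ} (h : Matrix (Fin (2 * n)) (Fin (2 * n)) ℂ) : QOp n :=
  Complex.I • ∑ μ, ∑ ν, if μ = ν then 0 else h μ ν • (jw μ * jw ν)

/-- A quadratic Hamiltonian: a hermitian operator that is quadratic in the generators. -/
def IsQuadraticHamiltonian {n : ℕ} (H : QOp n) : Prop :=
  H.IsHermitian ∧ ∃ h : Matrix (Fin (2 * n)) (Fin (2 * n)) ℂ, H = quadraticOp h

/-- The operation `e^{iH}` (matrix exponential). -/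
def expI {n : ℕ} (H : QOp n) : QOp n := NormedSpace.exp (Complex.I • H)

/-! ### Nearest-neighbour gates and circuits -/

/-- The two-qubit operator `G(A, B)`, rows and columns in the order `00, 01, 10, 11`. -/
def gMatrix (A B : Matrix (Fin 2) (Fin 2) ℂ) : Matrix (Fin 4) (Fin 4) ℂ :=
  !![A 0 0, 0, 0, A 0 1;
     0, B 0 0, B 0 1, 0;
     0, B 1 0, B 1 1, 0;
     A 1 0, 0, 0, A 1 1]

/-- `A` and `B` are unitary with the same determinant, so that `G(A, B)` is an allowed gate. -/
def Allowable (A B : Matrix (Fin 2) (Fin 2) ℂ) : Prop :=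
  A ∈ Matrix.unitaryGroup (Fin 2) ℂ ∧ B ∈ Matrix.unitaryGroup (Fin 2) ℂ ∧ A.det = B.det

/-- The two-qubit operator `M` acting on the lines `k` and `k + 1` out of `n`, and as the identity
on all the others. `finProdFinEquiv` sends a pair of bits `(a, b)` to `2 a + b`. -/
def onLines {n : ℕ} (k : ℕ) (hk : k + 1 < n) (M : Matrix (Fin 4) (Fin 4) ℂ) : QOp n :=
  Matrix.of fun x y =>
    if ∀ i : Fin n, i.val ≠ k → i.val ≠ k + 1 → x i = y i then
      M (finProdFinEquiv (x ⟨k, by omega⟩, x ⟨k + 1, hk⟩))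
        (finProdFinEquiv (y ⟨k, by omega⟩, y ⟨k + 1, hk⟩))
    else 0

/-- A nearest-neighbour Gaussian gate: the first of its two lines, and the real antisymmetric
coefficients of its Hamiltonian in the four generators of these two lines. -/
structure NNGate (n : ℕ) where
  line : ℕ
  line_lt : line + 1 < n
  coeff : Matrix (Fin 4) (Fin 4) ℝ
  coeff_antisymm : coeff.transpose = -coeff

/-- The four generators of the lines `k` and `k + 1` of a gate, in order. -/
def NNGate.gen {n : ℕ} (g : NNGate n) (a : Fin 4) : QOp n :=
  jw ⟨2 * g.line + a.val, by have := g.line_lt; have := a.isLt; omega⟩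

/-- The Hamiltonian `i ∑ coeff a b c_a c_b` of a gate, a sum over its four generators. -/
def NNGate.ham {n : ℕ} (g : NNGate n) : QOp n :=
  Complex.I • ∑ a, ∑ b, (g.coeff a b : ℂ) • (g.gen a * g.gen b)

/-- The operator `e^{iH}` of a gate with Hamiltonian `H`. -/
def NNGate.op {n : ℕ} (g : NNGate n) : QOp n := expI g.ham

/-- The gate is, as an operator, an allowed `G(A, B)` on its two lines. -/
def NNGate.IsG {n : ℕ} (g : NNGate n) : Prop :=
  ∃ A B : Matrix (Fin 2) (Fin 2) ℂ, Allowable A B ∧ g.op = onLines g.line g.line_lt (gMatrix A B)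

/-- The operator `U_N ⋯ U_2 U_1` of the circuit whose gates are `U_1, U_2, …, U_N` in order. -/
def circuitOp {n : ℕ} (gates : List (NNGate n)) : QOp n := (gates.map NNGate.op).reverse.prod

/-! ### Random access programs with logarithmic (bit) cost

The memory consists of arrays of integers; `s a i` is cell `i` of array `a`. Programs are built from
assignments, sequencing, branching and loops. Every elementary operation is charged in terms of the
bit lengths of the integers that take part in it. -/

/-- Contents of the memory. -/
abbrev Store : Type := ℕ → ℤ → ℤ

/-- Number of binary digits of the absolute value of an integer. -/
def bits (z : ℤ) : ℕ := z.natAbs.size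

/-- Integer expressions; `cell a e` is the content of the cell of array `a` with address `e`. -/
inductive Arith : Type where
  | lit (z : ℤ)
  | cell (a : ℕ) (e : Arith)
  | add (e f : Arith)
  | sub (e f : Arith)
  | mul (e f : Arith)
  | quo (e f : Arith)

/-- Value of an expression. -/
def Arith.eval (s : Store) : Arith → ℤ
  | lit z => z
  | cell a e => s a (e.eval s)
  | add e f => e.eval s + f.eval s
  | sub e f => e.eval s - f.eval s
  | mul e f => e.eval s * f.eval s
  | quo e f => e.eval s / f.eval s

/-- The charge for one arithmetic operation on the operands `x` and `y`. -/
def opCost (x y : ℤ) : ℕ := (1 + bits x) * (1 + bits y)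

/-- Cost of the evaluation of an expression. -/
def Arith.cost (s : Store) : Arith → ℕ
  | lit z => 1 + bits z
  | cell a e => e.cost s + 1 + bits (e.eval s) + bits (s a (e.eval s))
  | add e f => e.cost s + f.cost s + opCost (e.eval s) (f.eval s)
  | sub e f => e.cost s + f.cost s + opCost (e.eval s) (f.eval s)
  | mul e f => e.cost s + f.cost s + opCost (e.eval s) (f.eval s)
  | quo e f => e.cost s + f.cost s + opCost (e.eval s) (f.eval s)

/-- Programs. `assign a e f` writes the value of `f` into the cell of array `a` with address `e`;
`branch b p q` runs `p` if `b` is positive and `q` otherwise; `loop b p` repeats `p` as long as `b`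
is positive. -/
inductive Prog : Type where
  | skip
  | assign (a : ℕ) (e f : Arith)
  | seq (p q : Prog)
  | branch (b : Arith) (p q : Prog)
  | loop (b : Arith) (p : Prog)

/-- The memory after `z` has been written into cell `i` of array `a`. -/
def Store.write (s : Store) (a : ℕ) (i z : ℤ) : Store :=
  fun a' i' => if a' = a ∧ i' = i then z else s a' i'

/-- `Runs p s t s'`: started on the memory `s`, the program `p` halts after time `t` with the
memory `s'`. -/
inductive Runs : Prog → Store → ℕ → Store → Prop where
  | skip (s : Store) : Runs .skip s 1 s
  | assign (a : ℕ) (e f : Arith) (s : Store) :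
      Runs (.assign a e f) s (e.cost s + f.cost s + 1 + bits (e.eval s) + bits (f.eval s))
        (s.write a (e.eval s) (f.eval s))
  | seq {p q : Prog} {s s' s'' : Store} {t t' : ℕ} :
      Runs p s t s' → Runs q s' t' s'' → Runs (.seq p q) s (1 + t + t') s''
  | branch_pos {b : Arith} {p q : Prog} {s s' : Store} {t : ℕ} :
      0 < b.eval s → Runs p s t s' → Runs (.branch b p q) s (b.cost s + t) s'
  | branch_neg {b : Arith} {p q : Prog} {s s' : Store} {t : ℕ} :
      b.eval s ≤ 0 → Runs q s t s' → Runs (.branch b p q) s (b.cost s + t) s'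
  | loop_stop {b : Arith} {p : Prog} {s : Store} :
      b.eval s ≤ 0 → Runs (.loop b p) s (b.cost s) s
  | loop_step {b : Arith} {p : Prog} {s s' s'' : Store} {t t' : ℕ} :
      0 < b.eval s → Runs p s t s' → Runs (.loop b p) s' t' s'' →
        Runs (.loop b p) s (b.cost s + t + t') s''

/-! ### Polynomial-time computation of a circuit from the Hamiltonian -/

/-- The memory that holds the input: array `0` holds `n`, the number `m` of binary digits asked for,
and the common denominator `d`; array `1` holds the `2n × 2n` matrix of numerators, row by row. All
other cells are `0`. -/
def inputStore (n m d : ℕ) (a : Matrix (Fin (2 * n)) (Fin (2 * n)) ℤ) : Store :=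
  fun arr i =>
    if arr = 0 then (if i = 0 then n else if i = 1 then m else if i = 2 then d else 0)
    else if arr = 1 then
      ∑ μ : Fin (2 * n), ∑ ν : Fin (2 * n),
        if i = ((2 * n * μ.val + ν.val : ℕ) : ℤ) then a μ ν else 0
    else 0

/-- Size of the input: the number of lines, plus the number of digits asked for, plus the bit length
of the coefficients. -/
def inputSize (n m d : ℕ) (a : Matrix (Fin (2 * n)) (Fin (2 * n)) ℤ) : ℕ :=
  n + m + bits d + ∑ μ, ∑ ν, bits (a μ ν)

/-- The memory `s` holds a description of the circuit to `m` binary digits: cell `0` of array `2`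
holds the number of gates, array `3` holds their first lines, and array `4` holds, 16 numbers for
each gate, the coefficients of the Hamiltonians of the gates as multiples of `2 ^ (-m)`, each with
an error of at most `2 ^ (-m)`. -/
def Describes {n : ℕ} (s : Store) (m : ℕ) (gates : List (NNGate n)) : Prop :=
  s 2 0 = gates.length ∧
  ∀ (j : ℕ) (hj : j < gates.length),
    s 3 j = (gates[j]).line ∧
    ∀ a b : Fin 4,
      |(gates[j]).coeff a b - (s 4 ((16 * j + 4 * a.val + b.val : ℕ) : ℤ) : ℝ) / 2 ^ m|
        ≤ 1 / 2 ^ m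

/-- The quadratic operator with the rational coefficients `a μ ν / d`. -/
def rationalOp {n : ℕ} (d : ℕ) (a : Matrix (Fin (2 * n)) (Fin (2 * n)) ℤ) : QOp n :=
  quadraticOp (a.map fun z => (z : ℂ) / (d : ℂ))

/-- The circuits assigned to quadratic Hamiltonians are computable in polynomial time: one program
computes, from the number `n ≥ 2` of lines, a rational antisymmetric coefficient matrix and `m`, the
positions of the gates and the coefficients of their Hamiltonians to `m` binary digits, in time
polynomial in `n`, `m` and the bit length of the given coefficients. -/
def PolyTimeComputable (circuit : (n : ℕ) → QOp n → List (NNGate n)) : Prop :=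
  ∃ (P : Prog) (p : Polynomial ℕ),
    ∀ (n m d : ℕ) (a : Matrix (Fin (2 * n)) (Fin (2 * n)) ℤ),
      2 ≤ n → 0 < d → a.transpose = -a →
        ∃ (t : ℕ) (s : Store),
          Runs P (inputStore n m d a) t s ∧
          t ≤ p.eval (inputSize n m d a) ∧
          Describes s m (circuit n (rationalOp d a))

end

/-! The circuit. Write `H = i ∑ x μ ν c_μ c_ν` with `x` real and antisymmetric, so that `e^{iH} =
exp (-bivector x)`. Conjugation by the exponential of a bivector `y` acts on the span of the
generators as the rotation `exp (4 y)` (`isSpin_exp_bivector`). The exponential of a multiple of the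
product of two neighbouring generators rotates their plane (`isSpin_rotOp`) and is always a gate
`G(A, B)` on two neighbouring lines (`rotGate_isG`). Put `N = 2 n`. Reducing the rotation matrix
`exp (2 x)` to the identity by `N (N - 1)` rotations of neighbouring rows therefore gives a circuit
`U` that rotates the generators by `exp (-2 x)`, just as `exp (-bivector x / 2)` does. Two unitaries
with the same effect on the generators, both fixed by an antilinear conjugation that fixes the
generators, differ at most by a sign (`IsSpin.mul_self_eq`). Hence `U * U = e^{iH}` exactly, and the
circuit performs `U` twice.

Computability. The circuit is one exact object, yet its angles must be computable to every
precision, although an elimination contains discontinuous choices. All discrete choices are put into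
quarter turns, which bring an almost largest entry of a column to the top with a positive sign. They
are decided once, by a fixed point computation whose precision `basePrec x` depends only on `x`, and
the exact circuit is defined by means of these decisions (`turns x`). Every pivot is then at least
`1 / (2 N)` (`ElimInv.next`), and the remaining angles are arguments of vectors that stay away from
the branch cut of the argument, so that they depend stably on the matrix. A second pass at the
precision `basePrec x + 3 m` with the recorded turns follows the same exact elimination
(`tracks_approxElim`). The error grows at most by a factor `68 N` per step, which polynomially many
additional digits absorb.

Numerics. Numbers are multiples of `4 ^ (-k)`. Cosine, sine and `exp (2 x)` come from a first-order
Taylor approximation at `2 ^ (-k)` times the argument, squared `k` times. The exact powers have norm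
at most `1`, so a squaring at most triples the error, and the initial error of order `4 ^ (-k)`
becomes `(3 / 4) ^ k` (`squaring_error`). The angle `ψ` of the vector `(r sin ψ, r cos ψ)` is the
limit of the contraction `φ ↦ φ - r sin (φ - ψ)` (`abs_angIter_sub_le`).

Time. `wp B` demands that all written values have at most `B` bits and that each execution of a loop
makes at most `B` passes. The running time is then polynomial in `B` (`runs_of_wp`), and `B` is
polynomial in the size of the input (`sizeBound_spec`). -/

noncomputable section

/-! ### A weakest precondition calculus for programs -/

theorem bits_le_iff {z : ℤ} {b : ℕ} : bits z ≤ b ↔ |z| < 2 ^ b := by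
  rw [bits, Nat.size_le, Int.abs_eq_natAbs]
  exact_mod_cast Iff.rfl

theorem lt_two_pow_bits (z : ℤ) : |z| < 2 ^ bits z := bits_le_iff.1 le_rfl

theorem bits_add_le (x y : ℤ) : bits (x + y) ≤ bits x + bits y + 1 := by
  rw [bits_le_iff]
  have hx := lt_two_pow_bits x
  have hy := lt_two_pow_bits y
  have h1 : (1 : ℤ) ≤ 2 ^ bits x := one_le_pow₀ (by norm_num)
  have h2 : (1 : ℤ) ≤ 2 ^ bits y := one_le_pow₀ (by norm_num)
  have h3 := abs_add_le x y
  rw [pow_succ, pow_add]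
  nlinarith

theorem bits_neg (x : ℤ) : bits (-x) = bits x := by simp [bits]

theorem bits_sub_le (x y : ℤ) : bits (x - y) ≤ bits x + bits y + 1 := by
  simpa [sub_eq_add_neg, bits_neg] using bits_add_le x (-y)

theorem bits_mul_le (x y : ℤ) : bits (x * y) ≤ bits x + bits y := by
  rw [bits_le_iff, abs_mul, pow_add]
  exact mul_lt_mul'' (lt_two_pow_bits x) (lt_two_pow_bits y) (abs_nonneg _) (abs_nonneg _)

theorem bits_div_le (x y : ℤ) : bits (x / y) ≤ bits x := by
  rw [bits_le_iff]
  exact lt_of_le_of_lt (Int.abs_ediv_le_abs x y) (lt_two_pow_bits x)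

open Polynomial

/-- A bound for the bit length of the value of an expression, in terms of the bit length of the
contents of the memory. -/
def Arith.bitBound : Arith → ℕ[X]
  | lit z => C (bits z)
  | cell _ _ => X
  | add e f => e.bitBound + f.bitBound + 1
  | sub e f => e.bitBound + f.bitBound + 1
  | mul e f => e.bitBound + f.bitBound
  | quo e _ => e.bitBound

/-- A bound for the cost of the evaluation of an expression. -/
def Arith.costBound : Arith → ℕ[X]
  | lit z => C (1 + bits z)
  | cell _ e => e.costBound + 1 + e.bitBound + X
  | add e f => e.costBound + f.costBound + (1 + e.bitBound) * (1 + f.bitBound)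
  | sub e f => e.costBound + f.costBound + (1 + e.bitBound) * (1 + f.bitBound)
  | mul e f => e.costBound + f.costBound + (1 + e.bitBound) * (1 + f.bitBound)
  | quo e f => e.costBound + f.costBound + (1 + e.bitBound) * (1 + f.bitBound)

/-- All cells of the memory have at most `B` bits. -/
def Store.Bounded (B : ℕ) (s : Store) : Prop := ∀ a i, bits (s a i) ≤ B

theorem Arith.bits_eval_le {B : ℕ} {s : Store} (hs : s.Bounded B) (e : Arith) :
    bits (e.eval s) ≤ e.bitBound.eval B := by
  induction e with
  | lit z => simp [Arith.eval, Arith.bitBound]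
  | cell a e ih => simpa [Arith.eval, Arith.bitBound] using hs _ _
  | add e f ih1 ih2 =>
    simp only [Arith.eval, Arith.bitBound, eval_add, eval_one]
    exact (bits_add_le _ _).trans (by omega)
  | sub e f ih1 ih2 =>
    simp only [Arith.eval, Arith.bitBound, eval_add, eval_one]
    exact (bits_sub_le _ _).trans (by omega)
  | mul e f ih1 ih2 =>
    simp only [Arith.eval, Arith.bitBound, eval_add]
    exact (bits_mul_le _ _).trans (by omega)
  | quo e f ih1 ih2 =>
    simp only [Arith.eval, Arith.bitBound]
    exact (bits_div_le _ _).trans ih1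

theorem Arith.cost_le {B : ℕ} {s : Store} (hs : s.Bounded B) (e : Arith) :
    e.cost s ≤ e.costBound.eval B := by
  have op : ∀ e f : Arith, opCost (e.eval s) (f.eval s) ≤
      (1 + e.bitBound.eval B) * (1 + f.bitBound.eval B) := fun e f =>
    Nat.mul_le_mul (by have := e.bits_eval_le hs; omega) (by have := f.bits_eval_le hs; omega)
  induction e with
  | lit z => simp [Arith.cost, Arith.costBound]
  | cell a e ih =>
    simp only [Arith.cost, Arith.costBound, eval_add, eval_one, eval_X]
    have := e.bits_eval_le hs
    have := hs a (e.eval s)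
    omega
  | add e f ih1 ih2 | sub e f ih1 ih2 | mul e f ih1 ih2 | quo e f ih1 ih2 =>
    simp only [Arith.cost, Arith.costBound, eval_add, eval_mul, eval_one]
    have := op e f
    omega

/-- A bound for the running time of a program, in terms of a common bound for the bit length of the
contents of the memory and for the number of passes through each loop. -/
def Prog.timeBound : Prog → ℕ[X]
  | skip => 1
  | assign _ e f => e.costBound + f.costBound + 1 + e.bitBound + f.bitBound
  | seq p q => 1 + p.timeBound + q.timeBound
  | branch b p q => b.costBound + p.timeBound + q.timeBound
  | loop b p => (X + 1) * (b.costBound + p.timeBound)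

/-- `wp B p Q s`: started on the memory `s`, the program `p` halts in a memory that satisfies `Q`,
every value written has at most `B` bits, and each loop is passed through at most `B` times. -/
def wp (B : ℕ) : Prog → (Store → Prop) → Store → Prop
  | .skip, Q, s => Q s
  | .assign a e f, Q, s => |f.eval s| < 2 ^ B ∧ Q (s.write a (e.eval s) (f.eval s))
  | .seq p q, Q, s => wp B p (wp B q Q) s
  | .branch b p q, Q, s => (0 < b.eval s → wp B p Q s) ∧ (b.eval s ≤ 0 → wp B q Q s)
  -- The stores between the passes are given as an explicit sequence, which keeps `wp` a structural
  -- recursion on the program.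
  | .loop b p, Q, s => ∃ j ≤ B, ∃ f : ℕ → Store, f 0 = s ∧
      (∀ i < j, 0 < b.eval (f i) ∧ wp B p (fun s' => s' = f (i + 1)) (f i)) ∧
      b.eval (f j) ≤ 0 ∧ Q (f j)

theorem wp_mono {B : ℕ} {p : Prog} {Q Q' : Store → Prop} {s : Store} (h : ∀ s, Q s → Q' s)
    (hw : wp B p Q s) : wp B p Q' s := by
  induction p generalizing Q Q' s with
  | skip => exact h _ hw
  | assign a e f => exact ⟨hw.1, h _ hw.2⟩
  | seq p q ihp ihq => exact ihp (fun s' hs' => ihq h hs') hw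
  | branch b p q ihp ihq => exact ⟨fun hb => ihp h (hw.1 hb), fun hb => ihq h (hw.2 hb)⟩
  | loop b p ih =>
    obtain ⟨j, hj, f, h0, hstep, hhalt, hQ⟩ := hw
    exact ⟨j, hj, f, h0, hstep, hhalt, h _ hQ⟩

/-- A postcondition can be sharpened to a single final store. This supplies the sequence of stores
that the clause for loops in `wp` asks for. -/
theorem wp_exists {B : ℕ} {p : Prog} {Q : Store → Prop} {s : Store} (hw : wp B p Q s) :
    ∃ s', Q s' ∧ wp B p (fun t => t = s') s := by
  induction p generalizing Q s with
  | skip => exact ⟨s, hw, rfl⟩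
  | assign a e f => exact ⟨_, hw.2, hw.1, rfl⟩
  | seq p q ihp ihq =>
    obtain ⟨s1, h1, h1'⟩ := ihp hw
    obtain ⟨s2, h2, h2'⟩ := ihq h1
    exact ⟨s2, h2, wp_mono (p := p) (by rintro _ rfl; exact h2') h1'⟩
  | branch b p q ihp ihq =>
    by_cases hb : 0 < b.eval s
    · obtain ⟨s1, h1, h1'⟩ := ihp (hw.1 hb)
      exact ⟨s1, h1, fun _ => h1', fun h => absurd hb (not_lt.2 h)⟩
    · obtain ⟨s1, h1, h1'⟩ := ihq (hw.2 (not_lt.1 hb))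
      exact ⟨s1, h1, fun h => absurd h hb, fun _ => h1'⟩
  | loop b p ih =>
    obtain ⟨j, hj, f, h0, hstep, hhalt, hQ⟩ := hw
    exact ⟨f j, hQ, j, hj, f, h0, hstep, hhalt, rfl⟩

/-- The rule for loops: `I j` holds after `j` passes, and there are `c` of them. -/
theorem wp_loop {B : ℕ} {b : Arith} {p : Prog} {Q : Store → Prop} {s : Store}
    (c : ℕ) (I : ℕ → Store → Prop) (hc : c ≤ B) (h0 : I 0 s)
    (hstep : ∀ j < c, ∀ s, I j s → 0 < b.eval s ∧ wp B p (I (j + 1)) s)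
    (hend : ∀ s, I c s → b.eval s ≤ 0 ∧ Q s) : wp B (.loop b p) Q s := by
  have key : ∀ j : ℕ, ∀ s, I j s → ∃ s', j < c → I (j + 1) s' ∧ wp B p (fun t => t = s') s := by
    intro j s hs
    by_cases hj : j < c
    · obtain ⟨s', h⟩ := wp_exists (hstep j hj s hs).2
      exact ⟨s', fun _ => h⟩
    · exact ⟨s, fun h => absurd h hj⟩
  choose! g hg using key
  let f : ℕ → Store := fun j => Nat.rec s (fun j s => g j s) j
  have hI : ∀ j, j ≤ c → I j (f j) := by
    intro j
    induction j with
    | zero => exact fun _ => h0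
    | succ j ih => exact fun hj => (hg j _ (ih (by omega)) (by omega)).1
  refine ⟨c, hc, f, rfl, fun i hi => ⟨(hstep i hi _ (hI i hi.le)).1, (hg i _ (hI i hi.le) hi).2⟩,
    (hend _ (hI c le_rfl)).1, (hend _ (hI c le_rfl)).2⟩

/-- All stores along the run stay within `B` bits, so every expression costs at most its `costBound`
at `B`, and a loop makes at most `B` passes and `B + 1` tests. After this, running times need no
further attention: only the sizes of written values and the numbers of passes are to be bounded. -/
theorem runs_of_wp {B : ℕ} {p : Prog} {Q : Store → Prop} {s : Store} (hs : s.Bounded B)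
    (hw : wp B p Q s) :
    ∃ t s', Runs p s t s' ∧ t ≤ p.timeBound.eval B ∧ Q s' ∧ s'.Bounded B := by
  induction p generalizing Q s with
  | skip => exact ⟨1, s, .skip s, by simp [Prog.timeBound], hw, hs⟩
  | assign a e f =>
    refine ⟨_, _, .assign a e f s, ?_, hw.2, fun a' i => ?_⟩
    · simp only [Prog.timeBound, eval_add, eval_one]
      have h1 := e.cost_le hs
      have h2 := f.cost_le hs
      have h3 := e.bits_eval_le hs
      have h4 := f.bits_eval_le hs
      omega
    · unfold Store.write
      split_ifs
      · exact bits_le_iff.2 hw.1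
      · exact hs _ _
  | seq p q ihp ihq =>
    obtain ⟨t1, s1, r1, ht1, hq1, hs1⟩ := ihp hs hw
    obtain ⟨t2, s2, r2, ht2, hq2, hs2⟩ := ihq hs1 hq1
    refine ⟨_, s2, .seq r1 r2, ?_, hq2, hs2⟩
    simp only [Prog.timeBound, eval_add, eval_one]
    omega
  | branch b p q ihp ihq =>
    have hb' := b.cost_le hs
    by_cases hb : 0 < b.eval s
    · obtain ⟨t1, s1, r1, ht1, hq1, hs1⟩ := ihp hs (hw.1 hb)
      refine ⟨_, s1, .branch_pos hb r1, ?_, hq1, hs1⟩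
      simp only [Prog.timeBound, eval_add]
      omega
    · obtain ⟨t1, s1, r1, ht1, hq1, hs1⟩ := ihq hs (hw.2 (not_lt.1 hb))
      refine ⟨_, s1, .branch_neg (not_lt.1 hb) r1, ?_, hq1, hs1⟩
      simp only [Prog.timeBound, eval_add]
      omega
  | loop b p ih =>
    obtain ⟨j, hj, f, h0, hstep, hhalt, hQ⟩ := hw
    subst h0
    have hbd : ∀ i, i ≤ j → (f i).Bounded B := by
      intro i
      induction i with
      | zero => exact fun _ => hs
      | succ i ih' =>
        intro hi
        obtain ⟨_, s1, _, _, hq1, hs1⟩ := ih (ih' (by omega)) (hstep i (by omega)).2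
        exact hq1 ▸ hs1
    -- The run is built from the end of the loop backwards, because `Runs.loop_step` puts one pass
    -- in front of a run of the rest.
    have run : ∀ i, i ≤ j → ∃ t, Runs (.loop b p) (f (j - i)) t (f j) ∧
        t ≤ i * (b.costBound.eval B + p.timeBound.eval B) + b.costBound.eval B := by
      intro i
      induction i with
      | zero =>
        intro _
        have r : Runs (.loop b p) (f j) (b.cost (f j)) (f j) := by
          constructor
          exact hhalt
        exact ⟨_, r, by simpa using b.cost_le (hbd j le_rfl)⟩
      | succ i ih' =>
        intro hi
        obtain ⟨t, r, ht⟩ := ih' (by omega)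
        have hb := hbd (j - (i + 1)) (by omega)
        obtain ⟨h1, h2⟩ := hstep (j - (i + 1)) (by omega)
        obtain ⟨t1, s1, r1, ht1, hq1, hs1⟩ := ih hb h2
        have e : j - (i + 1) + 1 = j - i := by omega
        rw [hq1, e] at r1
        refine ⟨_, .loop_step h1 r1 r, ?_⟩
        have := b.cost_le hb
        rw [Nat.succ_mul]
        omega
    obtain ⟨t, r, ht⟩ := run j le_rfl
    refine ⟨t, f j, by simpa using r, ht.trans ?_, hQ, hbd j le_rfl⟩
    simp only [Prog.timeBound, eval_mul, eval_add, eval_X, eval_one]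
    have := Nat.mul_le_mul_right (b.costBound.eval B + p.timeBound.eval B) hj
    rw [add_mul, one_mul]
    omega

end

noncomputable section

/-! ### Fixed point arithmetic: repeated squaring -/

theorem abs_intCast_ediv_sub_le (a b : ℤ) (hb : 0 < b) : |((a / b : ℤ) : ℝ) - a / b| ≤ 1 := by
  have hb' : (0 : ℝ) < b := by exact_mod_cast hb
  have h1 : ((b * (a / b) + a % b : ℤ) : ℝ) = a := by rw [Int.mul_ediv_add_emod]
  have h2 : (0 : ℝ) ≤ ((a % b : ℤ) : ℝ) := by exact_mod_cast Int.emod_nonneg a hb.ne'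
  have h3 : ((a % b : ℤ) : ℝ) < b := by exact_mod_cast Int.emod_lt_of_pos a hb
  push_cast at h1
  have : (a : ℝ) / b = ((a / b : ℤ) : ℝ) + ((a % b : ℤ) : ℝ) / b := by
    rw [← h1]; field_simp
  rw [this, abs_le]
  have h4 : ((a % b : ℤ) : ℝ) / b ≤ 1 := (div_le_one hb').2 h3.le
  have h5 : 0 ≤ ((a % b : ℤ) : ℝ) / b := by positivity
  constructor <;> linarith

/-- Rounding down to a multiple of `4 ^ (-k)`. -/
theorem abs_ediv_four_pow_sub_le (a : ℤ) (k : ℕ) :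
    |((a / 4 ^ k : ℤ) : ℝ) / 4 ^ k - a / 4 ^ k / 4 ^ k| ≤ 1 / 4 ^ k := by
  have h := abs_intCast_ediv_sub_le a (4 ^ k) (by positivity)
  push_cast at h
  rw [← sub_div, abs_div, abs_of_pos (by positivity : (0 : ℝ) < 4 ^ k)]
  gcongr

/-- An error `δ ≤ 1` becomes at most `2 δ + δ ^ 2 + ρ ≤ 3 δ + ρ`, because the exact powers have norm
at most `1`. The bound `3 ^ j * (e + ρ) - ρ / 2` satisfies `δ' = 3 δ + ρ` exactly, and `hs` keeps it
below `1`. It serves both complex numbers and matrices. -/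
theorem squaring_error {R : Type*} [NormedRing R] {B : R} {k : ℕ} {Y : ℕ → R} {ρ e : ℝ}
    (hρ : 0 ≤ ρ) (hB : ∀ j, ‖B ^ 2 ^ j‖ ≤ 1) (h0 : ‖Y 0 - B‖ ≤ e)
    (hY : ∀ j < k, ‖Y (j + 1) - Y j * Y j‖ ≤ ρ) (hs : 3 ^ k * (e + ρ) ≤ 1) :
    ∀ j ≤ k, ‖Y j - B ^ 2 ^ j‖ ≤ 3 ^ j * (e + ρ) - ρ / 2 := by
  have he : 0 ≤ e := (norm_nonneg _).trans h0
  intro j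
  induction j with
  | zero => intro _; simp; linarith
  | succ j ih =>
    intro hj
    have ih := ih (by omega)
    set D := Y j - B ^ 2 ^ j with hD
    have hD1 : ‖D‖ ≤ 1 := by
      have : (3 : ℝ) ^ j * (e + ρ) ≤ 3 ^ k * (e + ρ) := by gcongr <;> first | omega | norm_num
      linarith
    have e1 : Y (j + 1) - B ^ 2 ^ (j + 1) =
        (Y (j + 1) - Y j * Y j) + (B ^ 2 ^ j * D + D * B ^ 2 ^ j + D * D) := by
      have : B ^ 2 ^ (j + 1) = B ^ 2 ^ j * B ^ 2 ^ j := by rw [← pow_add]; congr 1; ring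
      rw [this, hD]; noncomm_ring
    have n1 : ‖B ^ 2 ^ j * D‖ ≤ ‖D‖ := (norm_mul_le _ _).trans
      (mul_le_of_le_one_left (norm_nonneg _) (hB j))
    have n2 : ‖D * B ^ 2 ^ j‖ ≤ ‖D‖ := (norm_mul_le _ _).trans
      (mul_le_of_le_one_right (norm_nonneg _) (hB j))
    have n3 : ‖D * D‖ ≤ ‖D‖ := (norm_mul_le _ _).trans
      (mul_le_of_le_one_right (norm_nonneg _) hD1)
    rw [e1]
    have := norm_add_le (Y (j + 1) - Y j * Y j) (B ^ 2 ^ j * D + D * B ^ 2 ^ j + D * D)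
    have := norm_add₃_le (a := B ^ 2 ^ j * D) (b := D * B ^ 2 ^ j) (c := D * D)
    have := hY j (by omega)
    rw [pow_succ]
    linarith

/-- From the quadratic term on, the series is dominated termwise by that of the real exponential at
`‖x‖`. Only positive powers occur there, so `‖1‖ = 1` is not needed. -/
theorem norm_exp_sub_one_sub_self_le {R : Type*} [NormedRing R] [NormedAlgebra ℝ R]
    [CompleteSpace R] {x : R} (hx : ‖x‖ ≤ 1) :
    ‖NormedSpace.exp x - 1 - x‖ ≤ ‖x‖ ^ 2 := by
  have h1 := NormedSpace.exp_series_hasSum_exp' (𝕂 := ℝ) x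
  have h2 := NormedSpace.exp_series_hasSum_exp' (𝕂 := ℝ) ‖x‖
  have h1' := (hasSum_nat_add_iff' 2).2 h1
  have h2' := (hasSum_nat_add_iff' 2).2 h2
  have hb : ∀ n : ℕ, ‖(((n + 2).factorial : ℝ)⁻¹ • x ^ (n + 2))‖ ≤
      ((n + 2).factorial : ℝ)⁻¹ • ‖x‖ ^ (n + 2) := by
    intro n
    rw [norm_smul, Real.norm_of_nonneg (by positivity), smul_eq_mul]
    gcongr
    exact norm_pow_le' x (by omega)
  have h3 := h1'.norm_le_of_bounded h2' hb
  simp only [Finset.sum_range_succ, Finset.sum_range_zero] at h3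
  simp only [Nat.factorial_zero, Nat.cast_one, inv_one, pow_zero, one_smul, zero_add,
    Nat.factorial_one, pow_one, ← Real.exp_eq_exp_ℝ, ← sub_sub] at h3
  have h4 := Real.norm_exp_sub_one_sub_id_le (x := ‖x‖) (by simpa using hx)
  rw [norm_norm] at h4
  exact h3.trans ((le_abs_self _).trans h4)

/-! ### Fixed point arithmetic: cosine and sine -/

/-- The fixed point square of a complex number, with `2 k` binary digits. -/
def cisStep (k : ℕ) (z : ℤ × ℤ) : ℤ × ℤ :=
  ((z.1 * z.1 - z.2 * z.2) / 4 ^ k, (2 * z.1 * z.2) / 4 ^ k)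

/-- The `j`-th square in the computation of `cos` and `sin`. -/
def cisIter (k : ℕ) (ψ : ℤ) (j : ℕ) : ℤ × ℤ := (cisStep k)^[j] (4 ^ k, ψ / 2 ^ k)

/-- Fixed point cosine and sine. -/
def cis (k : ℕ) (ψ : ℤ) : ℤ × ℤ := cisIter k ψ k

/-- The complex number represented by a pair of fixed point numbers. -/
def fixComplex (k : ℕ) (z : ℤ × ℤ) : ℂ := ⟨z.1 / 4 ^ k, z.2 / 4 ^ k⟩

theorem norm_fixComplex_cisStep_sub_le (k : ℕ) (z : ℤ × ℤ) :
    ‖fixComplex k (cisStep k z) - fixComplex k z * fixComplex k z‖ ≤ 2 / 4 ^ k := by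
  refine (Complex.norm_le_abs_re_add_abs_im _).trans ?_
  have h1 := abs_ediv_four_pow_sub_le (z.1 * z.1 - z.2 * z.2) k
  have h2 := abs_ediv_four_pow_sub_le (2 * z.1 * z.2) k
  push_cast at h1 h2
  have e1 : (fixComplex k (cisStep k z) - fixComplex k z * fixComplex k z).re =
      (((z.1 * z.1 - z.2 * z.2) / 4 ^ k : ℤ) : ℝ) / 4 ^ k -
        ((z.1 : ℝ) * z.1 - z.2 * z.2) / 4 ^ k / 4 ^ k := by
    simp [fixComplex, cisStep, Complex.sub_re, Complex.mul_re]; ring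
  have e2 : (fixComplex k (cisStep k z) - fixComplex k z * fixComplex k z).im =
      (((2 * z.1 * z.2) / 4 ^ k : ℤ) : ℝ) / 4 ^ k -
        (2 * (z.1 : ℝ) * z.2) / 4 ^ k / 4 ^ k := by
    simp [fixComplex, cisStep, Complex.sub_im, Complex.mul_im]; ring
  rw [e1, e2]
  have : (2 : ℝ) / 4 ^ k = 1 / 4 ^ k + 1 / 4 ^ k := by ring
  linarith

/-- The accuracy of the fixed point cosine and sine. -/
def cisErr (k : ℕ) : ℝ := 67 * (3 / 4) ^ k

theorem cisErr_pos (k : ℕ) : 0 < cisErr k := by unfold cisErr; positivity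

theorem one_div_four_pow_le_cisErr (k : ℕ) : 1 / 4 ^ k ≤ cisErr k := by
  have h : (1 : ℝ) / 4 ^ k ≤ (3 / 4) ^ k := by
    rw [div_pow]; gcongr; exact one_le_pow₀ (by norm_num)
  have : (0 : ℝ) < (3 / 4) ^ k := by positivity
  unfold cisErr
  linarith

/-- The start `1 + i α` with `|α| ≤ 8 / 2 ^ k` has a Taylor error of at most `64 / 4 ^ k` and a
rounding error of at most `1 / 4 ^ k`, and each squaring rounds by at most `2 / 4 ^ k`. Since `65 +
2 = 67`, the final error is at most `3 ^ k * 67 / 4 ^ k = cisErr k`. The bound for all `j` also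
keeps the intermediate numbers short. -/
theorem norm_cisIter_sub_le {k : ℕ} (hk : 3 ≤ k) (he : cisErr k ≤ 1) {ψ : ℤ}
    (hψ : |(ψ : ℝ) / 4 ^ k| ≤ 8) {j : ℕ} (hj : j ≤ k) :
    ‖fixComplex k (cisIter k ψ j) -
      Complex.exp (Complex.I * ((ψ / 4 ^ k / 2 ^ k : ℝ) : ℂ)) ^ 2 ^ j‖ ≤ cisErr k := by
  set α : ℝ := ψ / 4 ^ k / 2 ^ k with hα
  have h2k : (8 : ℝ) ≤ 2 ^ k := by
    calc (8 : ℝ) = 2 ^ 3 := by norm_num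
      _ ≤ 2 ^ k := by gcongr; norm_num
  have hα1 : |α| ≤ 8 / 2 ^ k := by
    rw [hα, abs_div, abs_of_pos (by positivity : (0 : ℝ) < 2 ^ k)]; gcongr
  have hα2 : |α| ≤ 1 := hα1.trans ((div_le_one (by positivity)).2 h2k)
  have hnorm : ‖Complex.I * (α : ℂ)‖ = |α| := by simp
  have h4 : (4 : ℝ) ^ k = 2 ^ k * 2 ^ k := by rw [← mul_pow]; norm_num
  have h0 : ‖fixComplex k (cisIter k ψ 0) - Complex.exp (Complex.I * (α : ℂ))‖ ≤ 65 / 4 ^ k := by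
    have a1 := Complex.norm_exp_sub_one_sub_id_le (x := Complex.I * (α : ℂ)) (by rwa [hnorm])
    rw [hnorm] at a1
    have a2 : ‖fixComplex k (cisIter k ψ 0) - (1 + Complex.I * (α : ℂ))‖ ≤ 1 / 4 ^ k := by
      refine (Complex.norm_le_abs_re_add_abs_im _).trans ?_
      have h := abs_intCast_ediv_sub_le ψ (2 ^ k) (by positivity)
      push_cast at h
      have h' : |(((ψ / 2 ^ k : ℤ) : ℝ) - ψ / 2 ^ k) / 4 ^ k| ≤ 1 / 4 ^ k := by
        rw [abs_div, abs_of_pos (by positivity : (0 : ℝ) < 4 ^ k)]; gcongr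
      have e1 : (fixComplex k (cisIter k ψ 0) - (1 + Complex.I * (α : ℂ))).re = 0 := by
        simp [fixComplex, cisIter]
      have e2 : (fixComplex k (cisIter k ψ 0) - (1 + Complex.I * (α : ℂ))).im =
          (((ψ / 2 ^ k : ℤ) : ℝ) - ψ / 2 ^ k) / 4 ^ k := by
        simp only [Complex.sub_im, Complex.add_im, Complex.one_im, Complex.mul_im, Complex.I_re,
          Complex.I_im, Complex.ofReal_re, Complex.ofReal_im, fixComplex, cisIter,
          Function.iterate_zero, id_eq]
        rw [hα]; ring
      rw [e1, e2]; simpa using h'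
    have a3 : |α| ^ 2 ≤ 64 / 4 ^ k := by
      calc |α| ^ 2 ≤ (8 / 2 ^ k) ^ 2 := by gcongr
        _ = 64 / 4 ^ k := by rw [h4]; ring
    have : fixComplex k (cisIter k ψ 0) - Complex.exp (Complex.I * (α : ℂ)) =
        (fixComplex k (cisIter k ψ 0) - (1 + Complex.I * (α : ℂ))) -
          (Complex.exp (Complex.I * (α : ℂ)) - 1 - Complex.I * (α : ℂ)) := by ring
    rw [this]
    have t := norm_sub_le (fixComplex k (cisIter k ψ 0) - (1 + Complex.I * (α : ℂ)))
      (Complex.exp (Complex.I * (α : ℂ)) - 1 - Complex.I * (α : ℂ))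
    have : (65 : ℝ) / 4 ^ k = 1 / 4 ^ k + 64 / 4 ^ k := by ring
    linarith
  have hs : (3 : ℝ) ^ k * (65 / 4 ^ k + 2 / 4 ^ k) = cisErr k := by
    unfold cisErr; rw [div_pow]; ring
  have hB : ∀ j, ‖Complex.exp (Complex.I * (α : ℂ)) ^ 2 ^ j‖ ≤ 1 := fun j => by
    rw [norm_pow, mul_comm, Complex.norm_exp_ofReal_mul_I, one_pow]
  have := squaring_error (Y := fun j => fixComplex k (cisIter k ψ j)) (k := k)
    (by positivity : (0 : ℝ) ≤ 2 / 4 ^ k) hB h0 (fun j _ => by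
      have := norm_fixComplex_cisStep_sub_le k (cisIter k ψ j)
      simpa only [cisIter, Function.iterate_succ_apply'] using this) (hs.trans_le he) j hj
  refine this.trans ?_
  rw [← hs]
  have h3 : (3 : ℝ) ^ j * (65 / 4 ^ k + 2 / 4 ^ k) ≤ 3 ^ k * (65 / 4 ^ k + 2 / 4 ^ k) := by
    gcongr; norm_num
  have : (0 : ℝ) ≤ 2 / 4 ^ k / 2 := by positivity
  linarith

theorem abs_cis_sub_le {k : ℕ} (hk : 3 ≤ k) (he : cisErr k ≤ 1) {ψ : ℤ}
    (hψ : |(ψ : ℝ) / 4 ^ k| ≤ 8) :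
    |((cis k ψ).1 : ℝ) / 4 ^ k - Real.cos (ψ / 4 ^ k)| ≤ cisErr k ∧
    |((cis k ψ).2 : ℝ) / 4 ^ k - Real.sin (ψ / 4 ^ k)| ≤ cisErr k := by
  have h := norm_cisIter_sub_le hk he hψ le_rfl
  have e : Complex.exp (Complex.I * ((ψ / 4 ^ k / 2 ^ k : ℝ) : ℂ)) ^ 2 ^ k =
      Complex.exp ((ψ / 4 ^ k : ℝ) * Complex.I) := by
    rw [← Complex.exp_nat_mul]; congr 1; push_cast; field_simp
  rw [e] at h
  have h1 := (Complex.abs_re_le_norm _).trans h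
  have h2 := (Complex.abs_im_le_norm _).trans h
  rw [Complex.sub_re, Complex.exp_ofReal_mul_I_re] at h1
  rw [Complex.sub_im, Complex.exp_ofReal_mul_I_im] at h2
  exact ⟨h1, h2⟩

theorem abs_cisIter_le {k : ℕ} (hk : 3 ≤ k) (he : cisErr k ≤ 1) {ψ : ℤ}
    (hψ : |(ψ : ℝ) / 4 ^ k| ≤ 8) {j : ℕ} (hj : j ≤ k) :
    |(cisIter k ψ j).1| ≤ 2 * 4 ^ k ∧ |(cisIter k ψ j).2| ≤ 2 * 4 ^ k := by
  have h := norm_cisIter_sub_le hk he hψ hj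
  have hn : ‖Complex.exp (Complex.I * ((ψ / 4 ^ k / 2 ^ k : ℝ) : ℂ)) ^ 2 ^ j‖ = 1 := by
    rw [norm_pow, mul_comm, Complex.norm_exp_ofReal_mul_I, one_pow]
  have h2 : ‖fixComplex k (cisIter k ψ j)‖ ≤ 2 := by
    have := norm_le_norm_sub_add (fixComplex k (cisIter k ψ j))
      (Complex.exp (Complex.I * ((ψ / 4 ^ k / 2 ^ k : ℝ) : ℂ)) ^ 2 ^ j)
    linarith
  have h3 := (Complex.abs_re_le_norm _).trans h2
  have h4 := (Complex.abs_im_le_norm _).trans h2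
  have key : ∀ z : ℤ, |(z : ℝ) / 4 ^ k| ≤ 2 → |z| ≤ 2 * 4 ^ k := by
    intro z hz
    rw [abs_div, abs_of_pos (by positivity : (0 : ℝ) < 4 ^ k), div_le_iff₀ (by positivity)] at hz
    exact_mod_cast hz
  exact ⟨key _ h3, key _ h4⟩

end

noncomputable section

/-! ### Fixed point arithmetic: the angle of a vector -/

/-- One step of the iteration for the angle `ψ` with `cos ψ * x = sin ψ * y`. -/
def angStep (k : ℕ) (x y : ℤ) (p : ℤ × ℤ × ℤ) : ℤ × ℤ × ℤ :=
  (p.1 + (p.2.1 * x - p.2.2 * y) / 4 ^ k, cis k (p.1 + (p.2.1 * x - p.2.2 * y) / 4 ^ k))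

/-- The approximations of the angle, together with its cosine and sine. -/
def angIter (k : ℕ) (x y : ℤ) (j : ℕ) : ℤ × ℤ × ℤ :=
  (angStep k x y)^[j] (3 * 4 ^ k / 2, cis k (3 * 4 ^ k / 2))

theorem angIter_succ (k : ℕ) (x y : ℤ) (j : ℕ) :
    angIter k x y (j + 1) = angStep k x y (angIter k x y j) :=
  Function.iterate_succ_apply' _ _ _

theorem angIter_snd (k : ℕ) (x y : ℤ) (j : ℕ) :
    (angIter k x y j).2 = cis k (angIter k x y j).1 := by
  cases j with
  | zero => rfl
  | succ j => rw [angIter_succ]; rfl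

/-- Jordan's inequality covers `[0, π / 2]`. Between `π / 2` and `1.7` it is applied to `π - e`. -/
theorem half_le_sin {e : ℝ} (h0 : 0 ≤ e) (h1 : e ≤ 1.7) : e / 2 ≤ Real.sin e := by
  have hp := Real.pi_gt_d2
  have hp' := Real.pi_lt_d2
  have a : ∀ t : ℝ, 0 ≤ t → t ≤ Real.pi / 2 → 0.63 * t ≤ Real.sin t := fun t h0 h1 => by
    refine le_trans ?_ (Real.mul_le_sin h0 h1)
    gcongr
    rw [le_div_iff₀ (by positivity)]
    nlinarith
  rcases le_total e (Real.pi / 2) with h | h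
  · exact le_trans (by linarith) (a e h0 h)
  · rw [← Real.sin_pi_sub]
    exact le_trans (by linarith) (a (Real.pi - e) (by linarith) (by linarith))

/-- This is the contraction behind `angIter`: the exact step takes the error `e = φ - ψ` to `e - r
sin e`, and for `0 ≤ e ≤ 1.7` the sine lies between `e / 2` and `e`. -/
theorem abs_sub_mul_sin_le {e r χ : ℝ} (hχ : 0 ≤ χ) (hr : χ ≤ r) (hr1 : r ≤ 1) (he : |e| ≤ 1.7) :
    |e - r * Real.sin e| ≤ (1 - χ / 2) * |e| := by
  have pos : ∀ e : ℝ, 0 ≤ e → e ≤ 1.7 → |e - r * Real.sin e| ≤ (1 - χ / 2) * e := by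
    intro e h0 h1
    have h2 := half_le_sin h0 h1
    have h3 := Real.sin_le h0
    rw [abs_le]
    constructor <;> nlinarith
  rcases abs_cases e with ⟨h, h'⟩ | ⟨h, h'⟩
  · rw [h] at he ⊢; exact pos e h' he
  · have := pos (-e) (by linarith) (h ▸ he)
    rw [Real.sin_neg] at this
    rw [h, ← abs_neg]
    convert this using 2
    ring

theorem abs_mul_le_mul {a b c d : ℝ} (h : |a| ≤ c) (h' : |b| ≤ d) : |a * b| ≤ c * d := by
  rw [abs_mul]
  exact mul_le_mul h h' (abs_nonneg _) ((abs_nonneg _).trans h)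

theorem abs_add_sub_sub_le (a b c d e f : ℝ) :
    |a + b + (c - d) + (e - f)| ≤ |a| + |b| + |c| + |d| + |e| + |f| := by
  have h1 := abs_add_le (a + b + (c - d)) (e - f)
  have h2 := abs_add_le (a + b) (c - d)
  have h3 := abs_add_le a b
  have h4 := abs_sub c d
  have h5 := abs_sub e f
  linarith only [h1, h2, h3, h4, h5]

/-- For the exact vector the correction `cos φ * x - sin φ * y` equals `-r sin (φ - ψ)`, so the step
contracts by `1 - χ / 2`. All perturbations together add at most `6 u` per step, and `12 u / χ` is
the fixed point of `w ↦ (1 - χ / 2) w + 6 u`. The start `1.5` is within `1.65` of every angle in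
`[0, π]`, and `1.65 + 0.05 = 1.7` keeps the error where `abs_sub_mul_sin_le` applies. -/
theorem abs_angIter_sub_le {k : ℕ} (hk : 3 ≤ k) {x y : ℤ} {r ψ χ ε u : ℝ} (hχ : 0 < χ) (hr : χ ≤ r)
    (hr1 : r ≤ 1) (hψ0 : 0 ≤ ψ) (hψ1 : ψ ≤ Real.pi)
    (hx : |(x : ℝ) / 4 ^ k - r * Real.sin ψ| ≤ ε) (hy : |(y : ℝ) / 4 ^ k - r * Real.cos ψ| ≤ ε)
    (hε : ε ≤ u) (hu : cisErr k ≤ u) (hu1 : 240 * u ≤ χ) (j : ℕ) :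
    |((angIter k x y j).1 : ℝ) / 4 ^ k - ψ| ≤ (1 - χ / 2) ^ j * 1.65 + 12 * u / χ := by
  have hp := Real.pi_gt_d2
  have hp' := Real.pi_lt_d2
  have hu0 : 0 < u := (cisErr_pos k).trans_le hu
  have hη := one_div_four_pow_le_cisErr k
  have hw : 12 * u / χ ≤ 0.05 := by rw [div_le_iff₀ hχ]; linarith
  have hw0 : 0 ≤ 12 * u / χ := by positivity
  induction j with
  | zero =>
    have : (((3 * 4 ^ k / 2 : ℤ) : ℤ) : ℝ) / 4 ^ k = 1.5 := by
      obtain ⟨l, rfl⟩ : ∃ l, k = l + 1 := ⟨k - 1, by omega⟩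
      have : (3 * 4 ^ (l + 1) / 2 : ℤ) = 6 * 4 ^ l := by
        rw [pow_succ]; omega
      rw [this, pow_succ]; push_cast; field_simp; norm_num
    simp only [angIter, Function.iterate_zero, id_eq, this, pow_zero]
    rw [abs_le]; constructor <;> linarith
  | succ j ih =>
    set p := angIter k x y j with hp
    have hsnd : p.2 = cis k p.1 := angIter_snd k x y j
    set φ : ℝ := (p.1 : ℝ) / 4 ^ k with hφ
    have hpw : (1 - χ / 2) ^ j ≤ 1 := pow_le_one₀ (by linarith) (by linarith)
    have he : |φ - ψ| ≤ 1.7 := by linarith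
    have hφ8 : |φ| ≤ 8 := by
      have := abs_le.1 he
      rw [abs_le]; constructor <;> linarith
    obtain ⟨hc, hs⟩ := abs_cis_sub_le hk (by linarith) hφ8
    rw [← hsnd] at hc hs
    have hfl := abs_ediv_four_pow_sub_le (p.2.1 * x - p.2.2 * y) k
    set f : ℝ := (((p.2.1 * x - p.2.2 * y) / 4 ^ k : ℤ) : ℝ) / 4 ^ k with hf
    have e1 : ((angIter k x y (j + 1)).1 : ℝ) / 4 ^ k = φ + f := by
      rw [angIter_succ, ← hp, hφ, hf]; simp only [angStep]; push_cast; ring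
    have e2 : ((p.2.1 * x - p.2.2 * y : ℤ) : ℝ) / 4 ^ k / 4 ^ k =
        ((p.2.1 : ℝ) / 4 ^ k) * ((x : ℝ) / 4 ^ k) - ((p.2.2 : ℝ) / 4 ^ k) * ((y : ℝ) / 4 ^ k) := by
      push_cast; ring
    rw [e2] at hfl
    set c := (p.2.1 : ℝ) / 4 ^ k
    set s := (p.2.2 : ℝ) / 4 ^ k
    set X := (x : ℝ) / 4 ^ k
    set Y := (y : ℝ) / 4 ^ k
    have hsin : Real.cos φ * (r * Real.sin ψ) - Real.sin φ * (r * Real.cos ψ) =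
        - (r * Real.sin (φ - ψ)) := by rw [Real.sin_sub]; ring
    have hX : |X| ≤ 1.01 := by
      have h1 : |r * Real.sin ψ| ≤ 1 := by
        rw [abs_mul, abs_of_nonneg (by linarith)]
        exact mul_le_one₀ hr1 (abs_nonneg _) (Real.abs_sin_le_one _)
      have := abs_le.1 h1; have := abs_le.1 hx
      rw [abs_le]; constructor <;> linarith
    have hY : |Y| ≤ 1.01 := by
      have h1 : |r * Real.cos ψ| ≤ 1 := by
        rw [abs_mul, abs_of_nonneg (by linarith)]
        exact mul_le_one₀ hr1 (abs_nonneg _) (Real.abs_cos_le_one _)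
      have := abs_le.1 h1; have := abs_le.1 hy
      rw [abs_le]; constructor <;> linarith
    have b1 : |(c - Real.cos φ) * X| ≤ u * 1.01 := abs_mul_le_mul (hc.trans hu) hX
    have b2 : |(s - Real.sin φ) * Y| ≤ u * 1.01 := abs_mul_le_mul (hs.trans hu) hY
    have b3 : |Real.cos φ * (X - r * Real.sin ψ)| ≤ 1 * u :=
      abs_mul_le_mul (Real.abs_cos_le_one φ) (hx.trans hε)
    have b4 : |Real.sin φ * (Y - r * Real.cos ψ)| ≤ 1 * u :=
      abs_mul_le_mul (Real.abs_sin_le_one φ) (hy.trans hε)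
    have hcon := abs_sub_mul_sin_le hχ.le hr hr1 he
    have hfin : |φ + f - ψ| ≤ (1 - χ / 2) * |φ - ψ| + 6 * u := by
      have e3 : φ + f - ψ = ((φ - ψ) - r * Real.sin (φ - ψ)) + (f - (c * X - s * Y))
          + ((c - Real.cos φ) * X - (s - Real.sin φ) * Y)
          + (Real.cos φ * (X - r * Real.sin ψ) - Real.sin φ * (Y - r * Real.cos ψ)) := by
        linear_combination hsin
      rw [e3]
      refine (abs_add_sub_sub_le _ _ _ _ _ _).trans ?_
      have := hη.trans hu
      generalize (1 - χ / 2) * |φ - ψ| = M at hcon ⊢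
      linarith only [hcon, hfl, b1, b2, b3, b4, this, hu0]
    rw [e1]
    have h5 : (1 - χ / 2) * |φ - ψ| ≤ (1 - χ / 2) * ((1 - χ / 2) ^ j * 1.65 + 12 * u / χ) :=
      mul_le_mul_of_nonneg_left ih (by linarith)
    have h6 : (1 - χ / 2) * ((1 - χ / 2) ^ j * 1.65 + 12 * u / χ) + 6 * u =
        (1 - χ / 2) ^ (j + 1) * 1.65 + 12 * u / χ := by
      field_simp; ring
    linarith

/-- The final accuracy of the angle, its cosine and its sine. -/
theorem angIter_spec {k : ℕ} (hk : 3 ≤ k) {x y : ℤ} {r ψ χ ε u : ℝ} (hχ : 0 < χ) (hr : χ ≤ r)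
    (hr1 : r ≤ 1) (hψ0 : 0 ≤ ψ) (hψ1 : ψ ≤ Real.pi)
    (hx : |(x : ℝ) / 4 ^ k - r * Real.sin ψ| ≤ ε) (hy : |(y : ℝ) / 4 ^ k - r * Real.cos ψ| ≤ ε)
    (hε : ε ≤ u) (hu : cisErr k ≤ u) (hu1 : 240 * u ≤ χ) {K : ℕ} (hK : (1 - χ / 2) ^ K ≤ u) :
    |((angIter k x y K).1 : ℝ) / 4 ^ k - ψ| ≤ 14 * u / χ ∧
    |((angIter k x y K).2.1 : ℝ) / 4 ^ k - Real.cos ψ| ≤ 15 * u / χ ∧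
    |((angIter k x y K).2.2 : ℝ) / 4 ^ k - Real.sin ψ| ≤ 15 * u / χ := by
  have h := abs_angIter_sub_le hk hχ hr hr1 hψ0 hψ1 hx hy hε hu hu1 K
  have hu0 : 0 < u := (cisErr_pos k).trans_le hu
  have hχ1 : χ ≤ 1 := hr.trans hr1
  have hd : u ≤ u / χ := by rw [le_div_iff₀ hχ]; nlinarith
  have h1 : |((angIter k x y K).1 : ℝ) / 4 ^ k - ψ| ≤ 14 * u / χ := by
    have e1 : 14 * u / χ = 12 * u / χ + 2 * (u / χ) := by ring
    linarith
  refine ⟨h1, ?_⟩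
  have hp' := Real.pi_lt_d2
  have h2 : 14 * u / χ ≤ 0.1 := by rw [div_le_iff₀ hχ]; linarith
  have h8 : |((angIter k x y K).1 : ℝ) / 4 ^ k| ≤ 8 := by
    have := abs_le.1 h1
    rw [abs_le]; constructor <;> linarith
  obtain ⟨hc, hs⟩ := abs_cis_sub_le hk (by linarith) h8
  rw [← angIter_snd k x y K] at hc hs
  have e2 : 15 * u / χ = 14 * u / χ + u / χ := by ring
  have hc' := Real.abs_cos_sub_cos_le ((angIter k x y K).1 / 4 ^ k) ψ
  have hs' := Real.abs_sin_sub_sin_le ((angIter k x y K).1 / 4 ^ k) ψ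
  constructor
  · have := abs_sub_le (((angIter k x y K).2.1 : ℝ) / 4 ^ k)
      (Real.cos ((angIter k x y K).1 / 4 ^ k)) (Real.cos ψ)
    linarith
  · have := abs_sub_le (((angIter k x y K).2.2 : ℝ) / 4 ^ k)
      (Real.sin ((angIter k x y K).1 / 4 ^ k)) (Real.sin ψ)
    linarith

theorem abs_angIter_le {k : ℕ} (hk : 3 ≤ k) {x y : ℤ} {r ψ χ ε u : ℝ} (hχ : 0 < χ) (hr : χ ≤ r)
    (hr1 : r ≤ 1) (hψ0 : 0 ≤ ψ) (hψ1 : ψ ≤ Real.pi)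
    (hx : |(x : ℝ) / 4 ^ k - r * Real.sin ψ| ≤ ε) (hy : |(y : ℝ) / 4 ^ k - r * Real.cos ψ| ≤ ε)
    (hε : ε ≤ u) (hu : cisErr k ≤ u) (hu1 : 240 * u ≤ χ) (j : ℕ) :
    |((angIter k x y j).1 : ℝ) / 4 ^ k| ≤ 8 := by
  have h := abs_angIter_sub_le hk hχ hr hr1 hψ0 hψ1 hx hy hε hu hu1 j
  have hpw : (1 - χ / 2) ^ j ≤ 1 := pow_le_one₀ (by linarith) (by linarith)
  have hw : 12 * u / χ ≤ 0.05 := by rw [div_le_iff₀ hχ]; linarith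
  have hp' := Real.pi_lt_d2
  have := abs_le.1 h
  rw [abs_le]; constructor <;> linarith

/-! ### Fixed point arithmetic: the exponential of a matrix -/

open scoped Matrix.Norms.L2Operator

theorem Matrix.abs_apply_le_l2_opNorm {N : ℕ} (A : Matrix (Fin N) (Fin N) ℝ) (i j : Fin N) :
    |A i j| ≤ ‖A‖ := by
  have h := Matrix.l2_opNorm_mulVec A (EuclideanSpace.single j (1 : ℝ))
  rw [PiLp.norm_single, norm_one, mul_one] at h
  refine le_trans ?_ h
  have h2 := PiLp.norm_apply_le (p := 2)
    (WithLp.toLp 2 (A.mulVec (EuclideanSpace.single j (1 : ℝ)).ofLp) : EuclideanSpace ℝ (Fin N)) i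
  refine le_trans (le_of_eq ?_) h2
  simp [Real.norm_eq_abs]

theorem Matrix.l2_opNorm_sq_le_sum {N : ℕ} (A : Matrix (Fin N) (Fin N) ℝ) :
    ‖A‖ ^ 2 ≤ ∑ i, ∑ j, A i j ^ 2 := by
  have h0 : 0 ≤ ∑ i, ∑ j, A i j ^ 2 :=
    Finset.sum_nonneg fun i _ => Finset.sum_nonneg fun j _ => sq_nonneg _
  have : ‖A‖ ≤ √(∑ i, ∑ j, A i j ^ 2) := by
    rw [Matrix.l2_opNorm_def]
    refine ContinuousLinearMap.opNorm_le_bound _ (Real.sqrt_nonneg _) fun v => ?_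
    rw [← sq_le_sq₀ (norm_nonneg _) (by positivity), mul_pow, Real.sq_sqrt h0,
      EuclideanSpace.real_norm_sq_eq, EuclideanSpace.real_norm_sq_eq, Finset.sum_mul]
    refine Finset.sum_le_sum fun i _ => ?_
    have := Finset.sum_mul_sq_le_sq_mul_sq Finset.univ (fun j => A i j) (fun j => v j)
    simpa [Matrix.mulVec, dotProduct] using this
  calc ‖A‖ ^ 2 ≤ √(∑ i, ∑ j, A i j ^ 2) ^ 2 := by gcongr
    _ = _ := Real.sq_sqrt h0

theorem Matrix.l2_opNorm_le_card_mul {N : ℕ} (A : Matrix (Fin N) (Fin N) ℝ) {c : ℝ} (hc : 0 ≤ c)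
    (h : ∀ i j, |A i j| ≤ c) : ‖A‖ ≤ N * c := by
  rw [← sq_le_sq₀ (norm_nonneg _) (by positivity)]
  refine (Matrix.l2_opNorm_sq_le_sum A).trans ?_
  calc ∑ i, ∑ j, A i j ^ 2 ≤ ∑ _i : Fin N, ∑ _j : Fin N, c ^ 2 := by
        refine Finset.sum_le_sum fun i _ => Finset.sum_le_sum fun j _ => ?_
        rw [← sq_abs]; gcongr; exact h i j
    _ = (N * c) ^ 2 := by simp; ring

theorem Matrix.l2_opNorm_le_one_of_orthogonal {N : ℕ} {A : Matrix (Fin N) (Fin N) ℝ}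
    (h : A.transpose * A = 1) : ‖A‖ ≤ 1 := by
  have h1 := Matrix.l2_opNorm_conjTranspose_mul_self A
  have e : A.conjTranspose = A.transpose := by ext; simp
  rw [e, h] at h1
  have h2 : ‖(1 : Matrix (Fin N) (Fin N) ℝ)‖ ≤ 1 := by
    rw [← Matrix.diagonal_one, Matrix.l2_opNorm_diagonal]
    exact (pi_norm_le_iff_of_nonneg zero_le_one).2 fun i => by simp
  nlinarith [norm_nonneg A]

/-- The matrices in the fixed point computation of `exp (2 h)` by repeated squaring. -/
def expIter {N : ℕ} (k : ℕ) (h : Matrix (Fin N) (Fin N) ℝ) (j : ℕ) : Matrix (Fin N) (Fin N) ℤ :=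
  (fun E => (E * E).map (· / 4 ^ k))^[j]
    (Matrix.of fun r c => ⌊2 * h r c * 2 ^ k⌋ + if r = c then 4 ^ k else 0)

theorem expIter_succ {N : ℕ} (k : ℕ) (h : Matrix (Fin N) (Fin N) ℝ) (j : ℕ) :
    expIter k h (j + 1) = (expIter k h j * expIter k h j).map (· / 4 ^ k) :=
  Function.iterate_succ_apply' _ _ _

/-- The accuracy of the fixed point computation of `exp (2 h)`. -/
def expErr (k N : ℕ) (S : ℝ) : ℝ := (3 / 4) ^ k * (4 * S + 2 * N)

theorem exp_two_smul_orthogonal {N : ℕ} {h : Matrix (Fin N) (Fin N) ℝ} (hh : h.transpose = -h)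
    (c : ℝ) : (NormedSpace.exp (c • h)).transpose * NormedSpace.exp (c • h) = 1 := by
  rw [← Matrix.exp_transpose, Matrix.transpose_smul, hh, smul_neg, Matrix.exp_neg]
  exact Matrix.nonsing_inv_mul _ ((Matrix.isUnit_iff_isUnit_det _).1 (Matrix.isUnit_exp _))

/-- This is the scheme used for `cis`, in the operator norm. As `h` is antisymmetric, the exact
powers are orthogonal matrices and have norm at most `1`. Rounding every entry by `1 / 4 ^ k` costs
at most `N / 4 ^ k` in norm, and the Frobenius bound `S` controls the Taylor error. -/
theorem norm_expIter_sub_le {N k : ℕ} {h : Matrix (Fin N) (Fin N) ℝ} {S : ℝ}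
    (hh : h.transpose = -h) (hS : ∑ i, ∑ j, h i j ^ 2 ≤ S) (he : expErr k N S ≤ 1)
    {j : ℕ} (hj : j ≤ k) :
    ‖(expIter k h j).map (fun z => (z : ℝ) / 4 ^ k) -
      NormedSpace.exp ((2 / 2 ^ k : ℝ) • h) ^ 2 ^ j‖ ≤ expErr k N S := by
  set A : Matrix (Fin N) (Fin N) ℝ := (2 / 2 ^ k : ℝ) • h with hA
  have hS0 : 0 ≤ S := le_trans
    (Finset.sum_nonneg fun i _ => Finset.sum_nonneg fun j _ => sq_nonneg _) hS
  have h4 : (4 : ℝ) ^ k = 2 ^ k * 2 ^ k := by rw [← mul_pow]; norm_num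
  have hA2 : ‖A‖ ^ 2 ≤ 4 * S / 4 ^ k := by
    rw [hA, norm_smul, mul_pow, Real.norm_of_nonneg (by positivity), div_pow, h4]
    calc (2 : ℝ) ^ 2 / (2 ^ k) ^ 2 * ‖h‖ ^ 2 ≤ 2 ^ 2 / (2 ^ k) ^ 2 * S := by
          gcongr; exact (Matrix.l2_opNorm_sq_le_sum h).trans hS
      _ = _ := by ring
  have herr : (3 : ℝ) ^ k * ((4 * S / 4 ^ k + N * (1 / 4 ^ k)) + N * (1 / 4 ^ k)) =
      expErr k N S := by
    unfold expErr; rw [div_pow]; ring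
  -- A final error bound of at most `1` already forces `k` to be large enough for the Taylor
  -- estimate, so no separate condition on `k` is needed.
  have hA1 : ‖A‖ ≤ 1 := by
    have h1 : 4 * S / 4 ^ k ≤ expErr k N S := by
      rw [← herr]
      have : (1 : ℝ) ≤ 3 ^ k := one_le_pow₀ (by norm_num)
      have h2 : (0 : ℝ) ≤ N * (1 / 4 ^ k) := by positivity
      have h3 : 0 ≤ 4 * S / 4 ^ k := by positivity
      nlinarith
    nlinarith [norm_nonneg A]
  have hB : ∀ j, ‖NormedSpace.exp A ^ 2 ^ j‖ ≤ 1 := by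
    intro j
    rw [← Matrix.exp_nsmul, hA, ← Nat.cast_smul_eq_nsmul ℝ, smul_smul]
    exact Matrix.l2_opNorm_le_one_of_orthogonal (exp_two_smul_orthogonal hh _)
  have h0 : ‖(expIter k h 0).map (fun z => (z : ℝ) / 4 ^ k) - NormedSpace.exp A‖ ≤
      4 * S / 4 ^ k + N * (1 / 4 ^ k) := by
    have a1 := norm_exp_sub_one_sub_self_le hA1
    have a2 : ‖(expIter k h 0).map (fun z => (z : ℝ) / 4 ^ k) - (1 + A)‖ ≤ N * (1 / 4 ^ k) := by
      refine Matrix.l2_opNorm_le_card_mul _ (by positivity) fun i j => ?_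
      have e1 : ((expIter k h 0).map (fun z => (z : ℝ) / 4 ^ k) - (1 + A)) i j =
          ((⌊2 * h i j * 2 ^ k⌋ : ℝ) - 2 * h i j * 2 ^ k) / 4 ^ k := by
        simp only [expIter, Function.iterate_zero, id_eq, Matrix.sub_apply, Matrix.map_apply,
          Matrix.of_apply, Matrix.add_apply, Matrix.one_apply, hA, Matrix.smul_apply, smul_eq_mul]
        rw [h4]
        split_ifs <;> (push_cast; field_simp; ring_nf)
        rw [show (4 : ℝ) ^ k = 2 ^ k * 2 ^ k by rw [← mul_pow]; norm_num]; ring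
      rw [e1, abs_div, abs_of_pos (by positivity : (0 : ℝ) < 4 ^ k)]
      gcongr
      have := Int.floor_le (2 * h i j * 2 ^ k)
      have := Int.lt_floor_add_one (2 * h i j * 2 ^ k)
      rw [abs_le]; constructor <;> linarith
    have : (expIter k h 0).map (fun z => (z : ℝ) / 4 ^ k) - NormedSpace.exp A =
        ((expIter k h 0).map (fun z => (z : ℝ) / 4 ^ k) - (1 + A)) -
          (NormedSpace.exp A - 1 - A) := by abel
    rw [this]
    have t := norm_sub_le ((expIter k h 0).map (fun z => (z : ℝ) / 4 ^ k) - (1 + A))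
      (NormedSpace.exp A - 1 - A)
    linarith
  have hstep : ∀ j < k, ‖(expIter k h (j + 1)).map (fun z => (z : ℝ) / 4 ^ k) -
      (expIter k h j).map (fun z => (z : ℝ) / 4 ^ k) *
        (expIter k h j).map (fun z => (z : ℝ) / 4 ^ k)‖ ≤ N * (1 / 4 ^ k) := by
    intro j _
    refine Matrix.l2_opNorm_le_card_mul _ (by positivity) fun i l => ?_
    rw [expIter_succ]
    convert abs_ediv_four_pow_sub_le ((expIter k h j * expIter k h j) i l) k using 2
    simp only [Matrix.sub_apply, Matrix.map_apply, Matrix.mul_apply]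
    push_cast
    rw [Finset.sum_div, Finset.sum_div]
    congr 1
    exact Finset.sum_congr rfl fun _ _ => by ring
  have := squaring_error (Y := fun j => (expIter k h j).map (fun z => (z : ℝ) / 4 ^ k))
    (by positivity : (0 : ℝ) ≤ N * (1 / 4 ^ k)) hB h0 hstep (herr.trans_le he) j hj
  refine this.trans ?_
  rw [← herr]
  have h3 : (3 : ℝ) ^ j * ((4 * S / 4 ^ k + N * (1 / 4 ^ k)) + N * (1 / 4 ^ k)) ≤
      3 ^ k * ((4 * S / 4 ^ k + N * (1 / 4 ^ k)) + N * (1 / 4 ^ k)) := by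
    gcongr; norm_num
  have : (0 : ℝ) ≤ N * (1 / 4 ^ k) / 2 := by positivity
  linarith

theorem abs_expIter_sub_le {N k : ℕ} {h : Matrix (Fin N) (Fin N) ℝ} {S : ℝ}
    (hh : h.transpose = -h) (hS : ∑ i, ∑ j, h i j ^ 2 ≤ S) (he : expErr k N S ≤ 1) (r c : Fin N) :
    |(expIter k h k r c : ℝ) / 4 ^ k - NormedSpace.exp ((2 : ℝ) • h) r c| ≤ expErr k N S := by
  have h1 := norm_expIter_sub_le hh hS he le_rfl
  rw [← Matrix.exp_nsmul, ← Nat.cast_smul_eq_nsmul ℝ, smul_smul] at h1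
  have e : (((2 ^ k : ℕ) : ℝ) * (2 / 2 ^ k)) = 2 := by push_cast; field_simp
  rw [e] at h1
  exact (Matrix.abs_apply_le_l2_opNorm _ r c).trans h1

theorem abs_expIter_le {N k : ℕ} {h : Matrix (Fin N) (Fin N) ℝ} {S : ℝ}
    (hh : h.transpose = -h) (hS : ∑ i, ∑ j, h i j ^ 2 ≤ S) (he : expErr k N S ≤ 1)
    {j : ℕ} (hj : j ≤ k) (r c : Fin N) : |expIter k h j r c| ≤ 2 * 4 ^ k := by
  have h1 := (Matrix.abs_apply_le_l2_opNorm _ r c).trans (norm_expIter_sub_le hh hS he hj)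
  have h2 : ‖NormedSpace.exp ((2 / 2 ^ k : ℝ) • h) ^ 2 ^ j‖ ≤ 1 := by
    rw [← Matrix.exp_nsmul, ← Nat.cast_smul_eq_nsmul ℝ, smul_smul]
    exact Matrix.l2_opNorm_le_one_of_orthogonal (exp_two_smul_orthogonal hh _)
  have h3 := (Matrix.abs_apply_le_l2_opNorm _ r c).trans h2
  have h4 : |(expIter k h j r c : ℝ) / 4 ^ k| ≤ 2 := by
    simp only [Matrix.sub_apply, Matrix.map_apply] at h1
    have := abs_le.1 h1; have := abs_le.1 h3
    rw [abs_le]; constructor <;> linarith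
  rw [abs_div, abs_of_pos (by positivity : (0 : ℝ) < 4 ^ k), div_le_iff₀ (by positivity)] at h4
  exact_mod_cast h4

end

noncomputable section

/-! ### Elimination by rotations of neighbouring rows -/

/-- A position in the elimination: the column being treated, whether its entries are being
eliminated (or only turned so that the largest one comes to the top), and the lower one of the two
rows being rotated. -/
structure ElimPos where
  col : ℕ
  smooth : Bool
  row : ℕ

/-- The next position. -/
def ElimPos.next (σ : ElimPos) : ElimPos :=
  -- Turning goes upwards through the rows `col, …, 1`, eliminating goes downwards through `1, …,
  -- col`. Column `1` is followed by the idle position with column and row `0`.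
  if σ.smooth = true then
    if σ.row < σ.col then ⟨σ.col, true, σ.row + 1⟩ else ⟨σ.col - 1, false, σ.col - 1⟩
  else if 1 < σ.row then ⟨σ.col, false, σ.row - 1⟩ else ⟨σ.col, true, 1⟩

/-- The positions in the elimination of an `N × N` matrix, in order. -/
def elimPos (N t : ℕ) : ElimPos := ElimPos.next^[t] ⟨N - 1, false, N - 1⟩

theorem elimPos_succ (N t : ℕ) : elimPos N (t + 1) = (elimPos N t).next :=
  Function.iterate_succ_apply' _ _ _

/-- The number of steps that remain. -/
def ElimPos.remaining (σ : ElimPos) : ℕ :=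
  -- A column `c` takes `c` turns and `c` eliminating rotations, so that the columns to the left of
  -- `col` take `col * (col - 1)` steps together.
  σ.col * (σ.col - 1) + if σ.smooth = true then σ.col + 1 - σ.row else σ.row + σ.col

theorem ElimPos.remaining_next {σ : ElimPos} (h1 : 1 ≤ σ.row) (h2 : σ.row ≤ σ.col) :
    σ.next.remaining + 1 = σ.remaining := by
  obtain ⟨c, b, r⟩ := σ
  obtain ⟨c, rfl⟩ : ∃ c', c = c' + 1 := ⟨c - 1, by simp at h1 h2; omega⟩
  simp only at h1 h2
  have e : (c + 1) * (c + 1 - 1) = c * (c - 1) + 2 * c := by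
    cases c with
    | zero => simp
    | succ c => simp only [Nat.add_sub_cancel]; ring
  cases b
  · by_cases h3 : 1 < r
    · simp only [next, remaining, h3, Bool.false_eq_true, if_false, if_true]
      omega
    · simp only [next, remaining, h3, Bool.false_eq_true, if_false, if_true]
      omega
  · by_cases h3 : r < c + 1
    · simp only [next, remaining, h3, if_true]
      omega
    · simp only [next, remaining, h3, Bool.false_eq_true, if_false, if_true, e]
      simp only [Nat.add_sub_cancel]
      omega

theorem elimPos_valid {N t : ℕ} (hN : 2 ≤ N) (ht : t ≤ N * (N - 1)) :
    (elimPos N t).remaining + t = N * (N - 1) ∧ (elimPos N t).row ≤ (elimPos N t).col ∧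
      (elimPos N t).col < N ∧ (t < N * (N - 1) → 1 ≤ (elimPos N t).row) := by
  induction t with
  | zero =>
    obtain ⟨N, rfl⟩ : ∃ M, N = M + 2 := ⟨N - 2, by omega⟩
    refine ⟨?_, le_rfl, ?_, fun _ => ?_⟩
    · simp [elimPos, ElimPos.remaining]; ring
    · simp [elimPos]
    · simp [elimPos]
  | succ t ih =>
    obtain ⟨h1, h2, h3, h4⟩ := ih (by omega)
    have h4 := h4 (by omega)
    have h5 := ElimPos.remaining_next h4 h2
    rw [elimPos_succ]
    set σ := elimPos N t
    have h6 : σ.next.remaining + (t + 1) = N * (N - 1) := by omega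
    have hr : σ.next.row ≤ σ.next.col ∧ σ.next.col < N ∧
        (σ.next.col = 0 ∨ 1 ≤ σ.next.row) := by
      simp only [ElimPos.next]
      split_ifs <;> simp <;> omega
    refine ⟨h6, hr.1, hr.2.1, fun ht' => hr.2.2.resolve_left fun h0 => ?_⟩
    -- Row `0` in column `0` occurs only at the idle position, where nothing remains to be done.
    have hz : σ.next.row = 0 := by omega
    have hs : σ.next.smooth = false := by
      have : σ.next.smooth = true → 1 ≤ σ.next.row := by
        simp only [ElimPos.next]
        split_ifs <;> simp
      by_contra hc
      have := this (by simpa using hc)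
      omega
    have : σ.next.remaining = 0 := by
      simp [ElimPos.remaining, h0, hz, hs]
    omega

theorem elimPos_last_col {N : ℕ} (hN : 2 ≤ N) : (elimPos N (N * (N - 1))).col = 0 := by
  obtain ⟨h1, h2, h3, -⟩ := elimPos_valid hN (le_refl (N * (N - 1)))
  have : (elimPos N (N * (N - 1))).remaining = 0 := by omega
  unfold ElimPos.remaining at this
  split_ifs at this <;> omega

/-! ### Rotations of neighbouring rows and orthogonal matrices -/

/-- Rotation of the rows `p` and `p + 1`. -/
def rotRows (p : ℕ) (c s : ℝ) (X : ℕ → ℕ → ℝ) (r l : ℕ) : ℝ :=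
  if r = p then c * X p l - s * X (p + 1) l
  else if r = p + 1 then s * X p l + c * X (p + 1) l else X r l

/-- Rotation of the rows `p` and `p + 1` in fixed point arithmetic. -/
def fixRotRows (k p : ℕ) (c s : ℤ) (X : ℕ → ℕ → ℤ) (r l : ℕ) : ℤ :=
  if r = p then (c * X p l - s * X (p + 1) l) / 4 ^ k
  else if r = p + 1 then (s * X p l + c * X (p + 1) l) / 4 ^ k else X r l

/-- The quarter turn that brings the larger one of `x` and `y` to the first place, with a positive
sign: its cosine, its sine, and the number of right angles. -/
def quarterTurn (x y : ℤ) : ℤ × ℤ × ℤ :=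
  if 0 < y * y - x * x then if 0 < y then (0, -1, -1) else (0, 1, 1)
  else if 0 < -x then (-1, 0, 2) else (1, 0, 0)

/-- The triples that describe quarter turns. -/
def IsQuarterTurn (q : ℤ × ℤ × ℤ) : Prop :=
  q = (0, -1, -1) ∨ q = (0, 1, 1) ∨ q = (-1, 0, 2) ∨ q = (1, 0, 0)

theorem isQuarterTurn_quarterTurn (x y : ℤ) : IsQuarterTurn (quarterTurn x y) := by
  unfold quarterTurn IsQuarterTurn
  split_ifs <;> simp

/-- The angle, cosine and sine of a rotation in the elimination, in fixed point arithmetic. -/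
def fixAngle (k N : ℕ) (D : ℕ → ℤ × ℤ × ℤ) (t : ℕ) (X : ℕ → ℕ → ℤ) : ℤ × ℤ × ℤ :=
  if (elimPos N t).smooth = true then
    angIter k (X ((elimPos N t).row - 1) (elimPos N t).col)
      (X (elimPos N t).row (elimPos N t).col) (4 * N * k)
  else ((D t).2.2 * (angIter k (4 ^ k) 0 (4 * N * k)).1, (D t).1 * 4 ^ k, (D t).2.1 * 4 ^ k)

/-- The matrices in the elimination in fixed point arithmetic. -/
def fixElim (k N : ℕ) (D : ℕ → ℤ × ℤ × ℤ) (X : ℕ → ℕ → ℤ) : ℕ → ℕ → ℕ → ℤ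
  | 0 => X
  | t + 1 =>
    let Y := fixElim k N D X t
    fixRotRows k ((elimPos N t).row - 1) (fixAngle k N D t Y).2.1 (fixAngle k N D t Y).2.2 Y

/-- The exact angle of a rotation in the elimination. -/
def realAngle (N : ℕ) (D : ℕ → ℤ × ℤ × ℤ) (t : ℕ) (X : ℕ → ℕ → ℝ) : ℝ :=
  if (elimPos N t).smooth = true then
    Complex.arg ⟨X (elimPos N t).row (elimPos N t).col,
      X ((elimPos N t).row - 1) (elimPos N t).col⟩
  else (D t).2.2 * (Real.pi / 2)

/-- The matrices in the exact elimination. -/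
def realElim (N : ℕ) (D : ℕ → ℤ × ℤ × ℤ) (X : ℕ → ℕ → ℝ) : ℕ → ℕ → ℕ → ℝ
  | 0 => X
  | t + 1 =>
    let Y := realElim N D X t
    rotRows ((elimPos N t).row - 1) (Real.cos (realAngle N D t Y)) (Real.sin (realAngle N D t Y)) Y

/-- The matrix with given entries. -/
def toMat (N : ℕ) (X : ℕ → ℕ → ℝ) : Matrix (Fin N) (Fin N) ℝ := Matrix.of fun i j => X i j

/-- The matrix of the rotation by the angle `ψ` in the plane of the coordinates `p` and `p + 1`. -/
def givens (N p : ℕ) (ψ : ℝ) : Matrix (Fin N) (Fin N) ℝ :=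
  toMat N (rotRows p (Real.cos ψ) (Real.sin ψ) fun i j => if i = j then 1 else 0)

theorem toMat_rotRows {N p : ℕ} (hp : p + 1 < N) (ψ : ℝ) (X : ℕ → ℕ → ℝ) :
    toMat N (rotRows p (Real.cos ψ) (Real.sin ψ) X) = givens N p ψ * toMat N X := by
  have key : ∀ a : ℕ, a < N → ∀ l : Fin N,
      ∑ j : Fin N, (if a = (j : ℕ) then (1 : ℝ) else 0) * X j l = X a l := by
    intro a ha l
    rw [Finset.sum_eq_single ⟨a, ha⟩] <;> simp
    intro b hb hab
    exact absurd (Fin.ext hab.symm) hb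
  ext r l
  simp only [givens, toMat, rotRows, Matrix.mul_apply, Matrix.of_apply]
  split_ifs with h1 h2
  · simp only [sub_mul, mul_assoc, Finset.sum_sub_distrib, ← Finset.mul_sum]
    rw [key p (by omega), key (p + 1) hp]
  · simp only [add_mul, mul_assoc, Finset.sum_add_distrib, ← Finset.mul_sum]
    rw [key p (by omega), key (p + 1) hp]
  · rw [key r r.2]

theorem givens_mul_givens {N p : ℕ} (hp : p + 1 < N) (ψ φ : ℝ) :
    givens N p ψ * givens N p φ = givens N p (ψ + φ) := by
  rw [givens.eq_1 N p φ, ← toMat_rotRows hp, givens]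
  congr 1
  funext r l
  simp only [rotRows, Real.cos_add, Real.sin_add, if_true, left_eq_add, one_ne_zero, if_false,
    add_eq_left]
  split_ifs <;> ring

theorem givens_zero {N p : ℕ} : givens N p 0 = 1 := by
  ext r l
  simp only [givens, toMat, rotRows, Matrix.of_apply, Real.cos_zero, Real.sin_zero,
    Matrix.one_apply, Fin.ext_iff]
  split_ifs <;> first | omega | simp

theorem givens_transpose {N p : ℕ} (ψ : ℝ) : (givens N p ψ).transpose = givens N p (-ψ) := by
  ext r l
  simp only [givens, toMat, rotRows, Matrix.of_apply, Matrix.transpose_apply, Real.cos_neg,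
    Real.sin_neg]
  split_ifs <;> first | omega | simp

theorem givens_transpose_mul_self {N p : ℕ} (hp : p + 1 < N) (ψ : ℝ) :
    (givens N p ψ).transpose * givens N p ψ = 1 := by
  rw [givens_transpose, givens_mul_givens hp, neg_add_cancel, givens_zero]

/-- A rotation is the square of the rotation by half the angle, so its determinant is a square. -/
theorem det_givens_pos {N p : ℕ} (hp : p + 1 < N) (ψ : ℝ) : 0 < (givens N p ψ).det := by
  have h : givens N p ψ = givens N p (ψ / 2) * givens N p (ψ / 2) := by
    rw [givens_mul_givens hp]; congr 1; ring
  have h2 := congrArg Matrix.det (givens_transpose_mul_self hp (ψ / 2))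
  rw [Matrix.det_mul, Matrix.det_transpose, Matrix.det_one] at h2
  rw [h, Matrix.det_mul, h2]
  exact one_pos

theorem orthogonal_mul {N : ℕ} {A B : Matrix (Fin N) (Fin N) ℝ} (hA : A.transpose * A = 1)
    (hB : B.transpose * B = 1) : (A * B).transpose * (A * B) = 1 := by
  rw [Matrix.transpose_mul, Matrix.mul_assoc, ← Matrix.mul_assoc A.transpose, hA, Matrix.one_mul,
    hB]

section Orthogonal

variable {N : ℕ} {M : Matrix (Fin N) (Fin N) ℝ}

theorem sum_sq_col (h : M.transpose * M = 1) (l : Fin N) : ∑ r, M r l ^ 2 = 1 := by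
  have := congrFun (congrFun h l) l
  simpa [Matrix.mul_apply, sq] using this

theorem sum_sq_row (h : M.transpose * M = 1) (r : Fin N) : ∑ l, M r l ^ 2 = 1 := by
  have h' : M * M.transpose = 1 := mul_eq_one_comm.1 h
  have := congrFun (congrFun h' r) r
  simpa [Matrix.mul_apply, sq] using this

theorem sq_add_sq_le_one (h : M.transpose * M = 1) {p q : Fin N} (hpq : p ≠ q) (l : Fin N) :
    M p l ^ 2 + M q l ^ 2 ≤ 1 := by
  rw [← sum_sq_col h l, ← Finset.sum_pair (f := fun r => M r l ^ 2) hpq]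
  exact Finset.sum_le_sum_of_subset_of_nonneg (Finset.subset_univ _) fun _ _ _ => sq_nonneg _

theorem abs_entry_le_one (h : M.transpose * M = 1) (r l : Fin N) : |M r l| ≤ 1 := by
  rw [abs_le_one_iff_mul_self_le_one, ← sq, ← sum_sq_col h l]
  exact Finset.single_le_sum (f := fun r => M r l ^ 2) (fun _ _ => sq_nonneg _)
    (Finset.mem_univ r)

theorem col_eq_zero (h : M.transpose * M = 1) {a b : Fin N} (ha : M a a ^ 2 = 1) (hb : b ≠ a) :
    M b a = 0 := by
  have h1 := sum_sq_col h a
  rw [← Finset.add_sum_erase _ _ (Finset.mem_univ a), ha, add_eq_left,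
    Finset.sum_eq_zero_iff_of_nonneg fun _ _ => sq_nonneg _] at h1
  simpa using h1 b (by simp [hb])

theorem row_eq_zero (h : M.transpose * M = 1) {a b : Fin N} (ha : M a a ^ 2 = 1) (hb : b ≠ a) :
    M a b = 0 := by
  have h1 := sum_sq_row h a
  rw [← Finset.add_sum_erase _ _ (Finset.mem_univ a), ha, add_eq_left,
    Finset.sum_eq_zero_iff_of_nonneg fun _ _ => sq_nonneg _] at h1
  simpa using h1 b (by simp [hb])

end Orthogonal

/-! ### The invariant of the exact elimination -/

/-- What holds of the matrix when the elimination has come to the position `σ`. -/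
structure ElimInv (N : ℕ) (σ : ElimPos) (X : ℕ → ℕ → ℝ) : Prop where
  orth : (toMat N X).transpose * toMat N X = 1
  det_pos : 0 < (toMat N X).det
  -- Diagonal entries suffice: by orthogonality the rest of such a row and column vanishes.
  done : ∀ l, σ.col < l → l < N → X l l = 1
  -- A turn may miss the larger entry by `1 / (2 N ^ 2)`, and `col - row` turns have been made in
  -- this column so far.
  turn : σ.smooth = false → ∀ l, σ.row ≤ l → l ≤ σ.col →
    |X l σ.col| ≤ |X σ.row σ.col| + ((σ.col : ℝ) - σ.row) * (1 / (2 * N ^ 2))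
  -- This entry is the imaginary part of the number whose argument is taken next; being positive, it
  -- keeps that number away from the branch cut.
  pivot : σ.smooth = true → 1 / (2 * N) ≤ X (σ.row - 1) σ.col
  zero : σ.smooth = true → ∀ l, l < σ.row - 1 → X l σ.col = 0

/-- The condition on a quarter turn that makes the elimination stable. -/
def GoodTurn (N : ℕ) (X : ℕ → ℕ → ℝ) (σ : ElimPos) (q : ℤ × ℤ × ℤ) : Prop :=
  IsQuarterTurn q ∧
  |X (σ.row - 1) σ.col| ≤ q.1 * X (σ.row - 1) σ.col - q.2.1 * X σ.row σ.col + 1 / (2 * N ^ 2) ∧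
  |X σ.row σ.col| ≤ q.1 * X (σ.row - 1) σ.col - q.2.1 * X σ.row σ.col + 1 / (2 * N ^ 2)

theorem IsQuarterTurn.cos_sin {q : ℤ × ℤ × ℤ} (h : IsQuarterTurn q) :
    Real.cos (q.2.2 * (Real.pi / 2)) = q.1 ∧ Real.sin (q.2.2 * (Real.pi / 2)) = q.2.1 := by
  have h2 : (2 : ℝ) * (Real.pi / 2) = Real.pi := by ring
  rcases h with rfl | rfl | rfl | rfl <;> simp [h2]

/-- The vector that is turned to the second axis in the elimination of an entry. -/
theorem arg_cos_sin {x y : ℝ} (hx : 0 < x) :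
    ∃ r, 0 < r ∧ r ^ 2 = x ^ 2 + y ^ 2 ∧ x = r * Real.sin (Complex.arg ⟨y, x⟩) ∧
      y = r * Real.cos (Complex.arg ⟨y, x⟩) := by
  have hz : (⟨y, x⟩ : ℂ) ≠ 0 := fun h => by
    have := congrArg Complex.im h
    simp at this
    exact hx.ne' this
  refine ⟨‖(⟨y, x⟩ : ℂ)‖, norm_pos_iff.2 hz, ?_, ?_, ?_⟩
  · rw [Complex.sq_norm, Complex.normSq_mk]; ring
  · rw [Complex.norm_mul_sin_arg]
  · rw [Complex.norm_mul_cos_arg]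

/-- While turning, the losses in a column add up to at most `N / (2 N ^ 2) = 1 / (2 N)`. If the top
entry then were smaller than `1 / (2 N)`, all entries of the column would be smaller than `1 / N` in
absolute value, and the squares of a unit vector would sum to less than `1`. While eliminating, the
rotation by the argument moves the whole length of a two-dimensional vector into its lower
coordinate, so the pivot never shrinks. At the end of the column a single nonzero entry is left; it
is positive, hence `1`. -/
theorem ElimInv.next {N : ℕ} {σ : ElimPos} {X : ℕ → ℕ → ℝ} {ψ : ℝ} (h : ElimInv N σ X)
    (h1 : 1 ≤ σ.row) (h2 : σ.row ≤ σ.col) (h3 : σ.col < N)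
    (hturn : σ.smooth = false → ∃ q, GoodTurn N X σ q ∧ Real.cos ψ = q.1 ∧ Real.sin ψ = q.2.1)
    (hang : σ.smooth = true → ψ = Complex.arg ⟨X σ.row σ.col, X (σ.row - 1) σ.col⟩) :
    ElimInv N σ.next (rotRows (σ.row - 1) (Real.cos ψ) (Real.sin ψ) X) := by
  have hN : (0 : ℝ) < N := by exact_mod_cast (by omega : 0 < N)
  have hp : σ.row - 1 + 1 < N := by omega
  have hp1 : σ.row - 1 + 1 = σ.row := by omega
  set X' := rotRows (σ.row - 1) (Real.cos ψ) (Real.sin ψ) X with hX'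
  have horth : (toMat N X').transpose * toMat N X' = 1 := by
    rw [hX', toMat_rotRows hp]
    exact orthogonal_mul (givens_transpose_mul_self hp ψ) h.orth
  have hdet : 0 < (toMat N X').det := by
    rw [hX', toMat_rotRows hp, Matrix.det_mul]
    exact mul_pos (det_givens_pos hp ψ) h.det_pos
  have hoth : ∀ r l, r ≠ σ.row - 1 → r ≠ σ.row → X' r l = X r l := by
    intro r l ha hb
    simp only [hX', rotRows]
    rw [if_neg ha, if_neg (by omega)]
  have hup : ∀ l, X' (σ.row - 1) l = Real.cos ψ * X (σ.row - 1) l - Real.sin ψ * X σ.row l := by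
    intro l; simp only [hX', rotRows, if_true, hp1]
  have hlow : ∀ l, X' σ.row l = Real.sin ψ * X (σ.row - 1) l + Real.cos ψ * X σ.row l := by
    intro l
    simp only [hX', rotRows, hp1]
    rw [if_neg (by omega), if_true]
  have hdone : ∀ l, σ.col < l → l < N → X' l l = 1 := by
    intro l hl hlN
    rw [hoth l l (by omega) (by omega)]
    exact h.done l hl hlN
  cases hs : σ.smooth with
  | false =>
    obtain ⟨q, ⟨hq, hq1, hq2⟩, hc, hsn⟩ := hturn hs
    rw [← hc, ← hsn, ← hup] at hq1 hq2
    -- After a quarter turn the lower entry is, up to sign, one of the two old entries.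
    have hlast : |X' σ.row σ.col| ≤ X' (σ.row - 1) σ.col + 1 / (2 * N ^ 2) := by
      rw [hlow, hc, hsn]
      rcases hq with rfl | rfl | rfl | rfl <;> first | simpa using hq1 | simpa using hq2
    have hcr : (σ.row : ℝ) ≤ σ.col := by exact_mod_cast h2
    have hδ : (0 : ℝ) ≤ 1 / (2 * N ^ 2) := by positivity
    have hall : ∀ l, σ.row - 1 ≤ l → l ≤ σ.col → |X' l σ.col| ≤ |X' (σ.row - 1) σ.col| +
        ((σ.col : ℝ) - (σ.row - 1)) * (1 / (2 * N ^ 2)) := by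
      intro l hl1 hl2
      have hle := le_abs_self (X' (σ.row - 1) σ.col)
      have hnn : 0 ≤ ((σ.col : ℝ) - σ.row) * (1 / (2 * N ^ 2)) :=
        mul_nonneg (by linarith) hδ
      have hsplit : ((σ.col : ℝ) - (σ.row - 1)) * (1 / (2 * N ^ 2)) =
        ((σ.col : ℝ) - σ.row) * (1 / (2 * N ^ 2)) + 1 / (2 * N ^ 2) := by ring
      rw [hsplit]
      rcases (by omega : l = σ.row - 1 ∨ l = σ.row ∨ σ.row < l) with rfl | rfl | hl
      · linarith
      · linarith
      · rw [hoth l _ (by omega) (by omega)]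
        have := h.turn hs l hl.le hl2
        linarith
    by_cases hr : 1 < σ.row
    · have hn : σ.next = ⟨σ.col, false, σ.row - 1⟩ := by simp [ElimPos.next, hs, hr]
      rw [hn]
      refine ⟨horth, hdet, hdone, fun _ => ?_, by simp, by simp⟩
      simpa [Nat.cast_sub h1] using hall
    · have hn : σ.next = ⟨σ.col, true, 1⟩ := by simp [ElimPos.next, hs, hr]
      rw [hn]
      have hr1 : σ.row = 1 := by omega
      refine ⟨horth, hdet, hdone, by simp, fun _ => ?_, by simp⟩
      simp only [le_refl, tsub_eq_zero_of_le]
      rw [hr1] at hall hlast hq1 hq2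
      simp only [le_refl, tsub_eq_zero_of_le, zero_le, forall_const, Nat.cast_one, sub_self,
        sub_zero] at hall hlast hq1 hq2
      by_contra hcon
      push Not at hcon
      have hpos : -(1 / (2 * (N : ℝ) ^ 2)) ≤ X' 0 σ.col := by
        have := abs_nonneg (X 0 σ.col)
        linarith
      have hcN : ((σ.col : ℝ) + 1) ≤ N := by exact_mod_cast h3
      have hsum := sum_sq_col horth ⟨σ.col, h3⟩
      have hlt : ∀ r : Fin N, (toMat N X' r ⟨σ.col, h3⟩) ^ 2 < 1 / N := by
        intro r
        simp only [toMat, Matrix.of_apply]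
        by_cases hrc : (r : ℕ) ≤ σ.col
        · have h6 := hall r hrc
          have h5 : |X' 0 σ.col| < 1 / (2 * N) := by
            rw [abs_lt]
            refine ⟨lt_of_lt_of_le ?_ hpos, hcon⟩
            have : (1 : ℝ) / (2 * N ^ 2) < 1 / (2 * N) := by
              have hN2 : (2 : ℝ) ≤ N := by
                have : 1 ≤ σ.col := by omega
                have : (1 : ℝ) ≤ σ.col := by exact_mod_cast this
                linarith
              gcongr
              nlinarith
            linarith
          have h7 : (σ.col : ℝ) * (1 / (2 * N ^ 2)) ≤ 1 / (2 * N) := by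
            calc (σ.col : ℝ) * (1 / (2 * N ^ 2)) ≤ (N : ℝ) * (1 / (2 * N ^ 2)) := by gcongr
              _ = 1 / (2 * (N : ℝ)) := by field_simp
          have h8 : |X' r σ.col| < 1 / N := by
            have : (1 : ℝ) / N = 1 / (2 * N) + 1 / (2 * N) := by field_simp; norm_num
            linarith
          rw [← sq_abs]
          calc |X' r σ.col| ^ 2 < (1 / (N : ℝ)) ^ 2 := by gcongr
            _ ≤ 1 / (N : ℝ) := by
              rw [sq]
              refine mul_le_of_le_one_right (by positivity) ?_
              rw [div_le_one hN]
              have : (0 : ℝ) ≤ σ.col := by positivity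
              linarith
        -- The rows below `col` contribute nothing to the column, because their diagonal entries are
        -- already `1`.
        · push Not at hrc
          have hd : toMat N X' r r ^ 2 = 1 := by
            simp [toMat, hdone r hrc r.2]
          have hz := row_eq_zero horth hd
            (fun he => by rw [← he] at hrc; simp at hrc : (⟨σ.col, h3⟩ : Fin N) ≠ r)
          simp only [toMat, Matrix.of_apply] at hz
          rw [hz, zero_pow two_ne_zero]
          positivity
      have : Nonempty (Fin N) := ⟨⟨σ.col, h3⟩⟩
      have := Finset.sum_lt_sum_of_nonempty Finset.univ_nonempty fun r _ => hlt r
      rw [hsum] at this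
      simp at this
      rw [mul_inv_cancel₀ hN.ne'] at this
      exact lt_irrefl _ this
  | true =>
    have hx : 1 / (2 * N) ≤ X (σ.row - 1) σ.col := h.pivot hs
    have hx0 : 0 < X (σ.row - 1) σ.col := lt_of_lt_of_le (by positivity) hx
    obtain ⟨r, hr0, hr2, hrx, hry⟩ := arg_cos_sin (y := X σ.row σ.col) hx0
    rw [← hang hs] at hrx hry
    have hsc := Real.sin_sq_add_cos_sq ψ
    have hup0 : X' (σ.row - 1) σ.col = 0 := by
      rw [hup, hrx, hry]; ring
    have hlowr : X' σ.row σ.col = r := by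
      rw [hlow, hrx, hry]; linear_combination r * hsc
    have hrge : X (σ.row - 1) σ.col ≤ r := by nlinarith [sq_nonneg (X σ.row σ.col)]
    have hz : ∀ l, l < σ.row → X' l σ.col = 0 := by
      intro l hl
      rcases (by omega : l = σ.row - 1 ∨ l < σ.row - 1) with rfl | hl'
      · exact hup0
      · rw [hoth l _ (by omega) (by omega)]
        exact h.zero hs l hl'
    by_cases hrc : σ.row < σ.col
    · have hn : σ.next = ⟨σ.col, true, σ.row + 1⟩ := by simp [ElimPos.next, hs, hrc]
      rw [hn]
      refine ⟨horth, hdet, hdone, by simp, fun _ => ?_, fun _ => ?_⟩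
      · simp only [Nat.add_sub_cancel]
        rw [hlowr]; linarith
      · simpa using hz
    · have hn : σ.next = ⟨σ.col - 1, false, σ.col - 1⟩ := by simp [ElimPos.next, hs, hrc]
      rw [hn]
      refine ⟨horth, hdet, fun l hl hlN => ?_, fun _ l hl1 hl2 => ?_, by simp, by simp⟩
      · simp only at hl
        rcases (by omega : σ.col < l ∨ l = σ.row) with hl' | rfl
        · exact hdone l hl' hlN
        · have hcr : σ.col = σ.row := by omega
          rw [hcr] at hlowr hz hdone
          rw [hlowr]
          have hsum := sum_sq_col horth ⟨σ.row, hlN⟩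
          rw [Finset.sum_eq_single ⟨σ.row, hlN⟩] at hsum
          · simp only [toMat, Matrix.of_apply, hlowr] at hsum
            nlinarith
          · intro b _ hb
            have hb' : (b : ℕ) ≠ σ.row := fun he => hb (Fin.ext he)
            simp only [toMat, Matrix.of_apply]
            rcases lt_or_gt_of_ne hb' with hlt | hgt
            · rw [hz b hlt]; ring
            · have hd : toMat N X' b b ^ 2 = 1 := by
                simp [toMat, hdone b hgt b.2]
              have := row_eq_zero horth hd (Ne.symm hb)
              simp only [toMat, Matrix.of_apply] at this
              rw [this]; ring
          · simp
      · simp only at hl1 hl2 ⊢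
        have : l = σ.col - 1 := by omega
        rw [this]; simp

/-- Orthogonality leaves only the diagonal, whose first entry is still `1` or `-1`. The positive
determinant excludes `-1`. -/
theorem ElimInv.eq_one {N : ℕ} {σ : ElimPos} {X : ℕ → ℕ → ℝ} (h : ElimInv N σ X) (hc : σ.col = 0)
    (hN : 0 < N) : toMat N X = 1 := by
  have hd : ∀ a : Fin N, a ≠ ⟨0, hN⟩ → toMat N X a a = 1 := by
    intro a ha
    have : (a : ℕ) ≠ 0 := fun he => ha (Fin.ext he)
    exact h.done a (by omega) a.2
  have h0 : ∀ a b : Fin N, a ≠ b → toMat N X a b = 0 := by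
    intro a b hab
    by_cases ha : a = ⟨0, hN⟩
    · have hb : b ≠ ⟨0, hN⟩ := fun hb => hab (ha.trans hb.symm)
      exact col_eq_zero h.orth (by rw [hd b hb]; norm_num) hab
    · exact row_eq_zero h.orth (by rw [hd a ha]; norm_num) (Ne.symm hab)
  have hdiag : toMat N X = Matrix.diagonal fun a => toMat N X a a := by
    ext a b
    by_cases hab : a = b
    · subst hab; simp
    · rw [h0 a b hab, Matrix.diagonal_apply_ne _ hab]
  have hdet := h.det_pos
  rw [hdiag, Matrix.det_diagonal, ← Finset.mul_prod_erase _ _ (Finset.mem_univ ⟨0, hN⟩),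
    Finset.prod_eq_one (fun a ha => hd a (Finset.ne_of_mem_erase ha)), mul_one] at hdet
  have hsq := sum_sq_col h.orth ⟨0, hN⟩
  rw [Finset.sum_eq_single ⟨0, hN⟩ (fun b _ hb => by rw [h0 b _ hb]; ring) (by simp)] at hsq
  have h00 : toMat N X ⟨0, hN⟩ ⟨0, hN⟩ = 1 := by nlinarith
  rw [hdiag, ← Matrix.diagonal_one]
  congr 1
  funext a
  by_cases ha : a = ⟨0, hN⟩
  · rw [ha, h00]
  · exact hd a ha

end

noncomputable section

/-! ### The accuracy of the fixed point elimination -/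

/-- With `χ = 1 / (2 N)` the contraction factor is `1 - 1 / (4 N)`, and `(1 - 1 / (4 N)) ^ (4 N) ≤
e⁻¹ ≤ 3 / 4`. This is why `4 * N * k` iterations are made for an angle. -/
theorem one_sub_pow_le_cisErr {N k : ℕ} (hN : 0 < N) :
    (1 - 1 / (2 * (N : ℝ)) / 2) ^ (4 * N * k) ≤ cisErr k := by
  have hN' : (1 : ℝ) ≤ N := by exact_mod_cast hN
  have h1 : (1 - 1 / (2 * (N : ℝ)) / 2) ^ (4 * N) ≤ 3 / 4 := by
    have h2 : 1 - 1 / (2 * (N : ℝ)) / 2 ≤ Real.exp (-(1 / (4 * (N : ℝ)))) := by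
      have := Real.add_one_le_exp (-(1 / (4 * (N : ℝ))))
      have e : 1 / (2 * (N : ℝ)) / 2 = 1 / (4 * N) := by field_simp; norm_num
      linarith
    have h0 : 0 ≤ 1 - 1 / (2 * (N : ℝ)) / 2 := by
      have : 1 / (2 * (N : ℝ)) / 2 ≤ 1 := by
        rw [div_div, div_le_one (by positivity)]; linarith
      linarith
    calc (1 - 1 / (2 * (N : ℝ)) / 2) ^ (4 * N) ≤ Real.exp (-(1 / (4 * (N : ℝ)))) ^ (4 * N) := by
          gcongr
      _ = Real.exp (-1) := by
          rw [← Real.exp_nat_mul]; congr 1; push_cast; field_simp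
      _ ≤ 3 / 4 := by
          have := Real.exp_neg_one_lt_d9
          linarith
  have h0 : 0 ≤ (1 - 1 / (2 * (N : ℝ)) / 2) ^ (4 * N) :=
    Even.pow_nonneg ⟨2 * N, by ring⟩ _
  rw [pow_mul]
  calc ((1 - 1 / (2 * (N : ℝ)) / 2) ^ (4 * N)) ^ k ≤ (3 / 4) ^ k := by gcongr
    _ ≤ cisErr k := by
      unfold cisErr
      have : (0 : ℝ) < (3 / 4) ^ k := by positivity
      linarith

/-- The accuracy of the matrices before step `t` of the elimination. -/
def elimErr (k N : ℕ) (S : ℝ) (t : ℕ) : ℝ := (68 * N) ^ t * (cisErr k + expErr k N S)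

theorem expErr_nonneg {k N : ℕ} {S : ℝ} (hS : 0 ≤ S) : 0 ≤ expErr k N S := by
  unfold expErr; positivity

theorem elimErr_le_elimErr {k N : ℕ} {S : ℝ} (hS : 0 ≤ S) (hN : 0 < N) {t t' : ℕ} (h : t ≤ t') :
    elimErr k N S t ≤ elimErr k N S t' := by
  have hN' : (1 : ℝ) ≤ N := by exact_mod_cast hN
  have := cisErr_pos k
  have := expErr_nonneg (k := k) (N := N) hS
  unfold elimErr
  gcongr
  linarith

theorem elimErr_anti {k k' N : ℕ} {S : ℝ} (hS : 0 ≤ S) (h : k ≤ k') (t : ℕ) :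
    elimErr k' N S t ≤ elimErr k N S t := by
  have h1 : ((3 : ℝ) / 4) ^ k' ≤ (3 / 4) ^ k :=
    pow_le_pow_of_le_one (by norm_num) (by norm_num) h
  unfold elimErr cisErr expErr
  gcongr

theorem elimErr_succ (k N : ℕ) (S : ℝ) (t : ℕ) :
    elimErr k N S (t + 1) = 68 * N * elimErr k N S t := by
  unfold elimErr; rw [pow_succ]; ring

theorem cisErr_le_elimErr {k N : ℕ} {S : ℝ} (hS : 0 ≤ S) (hN : 0 < N) (t : ℕ) :
    cisErr k ≤ elimErr k N S t := by
  refine le_trans ?_ (elimErr_le_elimErr hS hN (Nat.zero_le t))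
  have := expErr_nonneg (k := k) (N := N) hS
  simp only [elimErr, pow_zero, one_mul]
  linarith

/-- The entries of the fixed point matrix are those of the exact one, up to an error `ε`. -/
def Tracks (k N : ℕ) (ε : ℝ) (Y : ℕ → ℕ → ℤ) (X : ℕ → ℕ → ℝ) : Prop :=
  ∀ r l, r < N → l < N → |(Y r l : ℝ) / 4 ^ k - X r l| ≤ ε

theorem Tracks.abs_le {k N : ℕ} {ε : ℝ} {Y : ℕ → ℕ → ℤ} {X : ℕ → ℕ → ℝ} (h : Tracks k N ε Y X)
    (hX : (toMat N X).transpose * toMat N X = 1) (hε : ε ≤ 0.01) {r l : ℕ} (hr : r < N)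
    (hl : l < N) : |(Y r l : ℝ) / 4 ^ k| ≤ 1.01 := by
  have h1 := abs_entry_le_one hX ⟨r, hr⟩ ⟨l, hl⟩
  simp only [toMat, Matrix.of_apply] at h1
  have h2 := h r l hr hl
  have h1 := _root_.abs_le.1 h1
  have h2 := _root_.abs_le.1 h2
  rw [_root_.abs_le]
  constructor <;> linarith

theorem Tracks.abs_le_int {k N : ℕ} {ε : ℝ} {Y : ℕ → ℕ → ℤ} {X : ℕ → ℕ → ℝ} (h : Tracks k N ε Y X)
    (hX : (toMat N X).transpose * toMat N X = 1) (hε : ε ≤ 0.01) {r l : ℕ} (hr : r < N)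
    (hl : l < N) : |Y r l| ≤ 2 * 4 ^ k := by
  have h4 := h.abs_le hX hε hr hl
  rw [abs_div, abs_of_pos (by positivity : (0 : ℝ) < 4 ^ k), div_le_iff₀ (by positivity)] at h4
  have h5 : |(Y r l : ℝ)| ≤ 2 * 4 ^ k := by
    have : (0 : ℝ) < 4 ^ k := by positivity
    linarith
  exact_mod_cast h5

/-- A bound for one product in a rotation. -/
theorem abs_mul_sub_mul_le {c c' a a' v ε : ℝ} (hc : |c| ≤ 1) (ha : |a'| ≤ 1.01)
    (hcc : |c' - c| ≤ v) (haa : |a' - a| ≤ ε) : |c' * a' - c * a| ≤ 1.01 * v + ε := by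
  have e : c' * a' - c * a = (c' - c) * a' + c * (a' - a) := by ring
  rw [e]
  have h1 := abs_mul_le_mul hcc ha
  have h2 := abs_mul_le_mul hc haa
  have := abs_add_le ((c' - c) * a') (c * (a' - a))
  linarith

/-- A new entry consists of two products, each with an error of at most `1.01 v + ε`, and of one
rounding. -/
theorem Tracks.rotRows_smooth {k N p : ℕ} {ε v ε' ψ : ℝ} {Y : ℕ → ℕ → ℤ} {X : ℕ → ℕ → ℝ}
    {c s : ℤ} (h : Tracks k N ε Y X) (hX : (toMat N X).transpose * toMat N X = 1) (hε : ε ≤ 0.01)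
    (hp : p + 1 < N) (hc : |(c : ℝ) / 4 ^ k - Real.cos ψ| ≤ v)
    (hs : |(s : ℝ) / 4 ^ k - Real.sin ψ| ≤ v) (hε' : 2.02 * v + 2 * ε + 1 / 4 ^ k ≤ ε') :
    Tracks k N ε' (fixRotRows k p c s Y) (rotRows p (Real.cos ψ) (Real.sin ψ) X) := by
  have hv : 0 ≤ v := (abs_nonneg _).trans hc
  have hk : (0 : ℝ) ≤ 1 / 4 ^ k := by positivity
  intro r l hr hl
  have hε0 : 0 ≤ ε := (abs_nonneg _).trans (h r l hr hl)
  have ha := h p l (by omega) hl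
  have hb := h (p + 1) l (by omega) hl
  have ha' := h.abs_le hX hε (show p < N by omega) hl
  have hb' := h.abs_le hX hε (show p + 1 < N by omega) hl
  simp only [fixRotRows, rotRows]
  split_ifs with h1 h2
  · have hf := abs_ediv_four_pow_sub_le (c * Y p l - s * Y (p + 1) l) k
    have e : ((c * Y p l - s * Y (p + 1) l : ℤ) : ℝ) / 4 ^ k / 4 ^ k =
        (c : ℝ) / 4 ^ k * ((Y p l : ℝ) / 4 ^ k) -
          (s : ℝ) / 4 ^ k * ((Y (p + 1) l : ℝ) / 4 ^ k) := by
      push_cast; ring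
    rw [e] at hf
    have t1 := _root_.abs_le.1 (abs_mul_sub_mul_le (Real.abs_cos_le_one ψ) ha' hc ha)
    have t2 := _root_.abs_le.1 (abs_mul_sub_mul_le (Real.abs_sin_le_one ψ) hb' hs hb)
    have t3 := _root_.abs_le.1 hf
    rw [_root_.abs_le]
    constructor <;> linarith
  · have hf := abs_ediv_four_pow_sub_le (s * Y p l + c * Y (p + 1) l) k
    have e : ((s * Y p l + c * Y (p + 1) l : ℤ) : ℝ) / 4 ^ k / 4 ^ k =
        (s : ℝ) / 4 ^ k * ((Y p l : ℝ) / 4 ^ k) +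
          (c : ℝ) / 4 ^ k * ((Y (p + 1) l : ℝ) / 4 ^ k) := by
      push_cast; ring
    rw [e] at hf
    have t1 := _root_.abs_le.1 (abs_mul_sub_mul_le (Real.abs_cos_le_one ψ) hb' hc hb)
    have t2 := _root_.abs_le.1 (abs_mul_sub_mul_le (Real.abs_sin_le_one ψ) ha' hs ha)
    have t3 := _root_.abs_le.1 hf
    rw [_root_.abs_le]
    constructor <;> linarith
  · have := h r l hr hl
    linarith

/-- Quarter turns involve no rounding, since the factor `4 ^ k` cancels exactly in the integer
division. They permute entries up to signs, so the error does not grow either. -/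
theorem fixRotRows_turn (q : ℤ × ℤ × ℤ) (k p : ℕ)
    (Y : ℕ → ℕ → ℤ) (r l : ℕ) :
    fixRotRows k p (q.1 * 4 ^ k) (q.2.1 * 4 ^ k) Y r l =
      if r = p then q.1 * Y p l - q.2.1 * Y (p + 1) l
      else if r = p + 1 then q.2.1 * Y p l + q.1 * Y (p + 1) l else Y r l := by
  have h4 : (4 : ℤ) ^ k ≠ 0 := by positivity
  unfold fixRotRows
  have e1 : q.1 * 4 ^ k * Y p l - q.2.1 * 4 ^ k * Y (p + 1) l =
    (q.1 * Y p l - q.2.1 * Y (p + 1) l) * 4 ^ k := by ring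
  have e2 : q.2.1 * 4 ^ k * Y p l + q.1 * 4 ^ k * Y (p + 1) l =
    (q.2.1 * Y p l + q.1 * Y (p + 1) l) * 4 ^ k := by ring
  rw [e1, e2, Int.mul_ediv_cancel _ h4, Int.mul_ediv_cancel _ h4]

theorem Tracks.rotRows_turn {k N p : ℕ} {ε ψ : ℝ} {Y : ℕ → ℕ → ℤ} {X : ℕ → ℕ → ℝ}
    {q : ℤ × ℤ × ℤ} (h : Tracks k N ε Y X) (hp : p + 1 < N) (hq : IsQuarterTurn q)
    (hc : Real.cos ψ = q.1) (hs : Real.sin ψ = q.2.1) :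
    Tracks k N ε (fixRotRows k p (q.1 * 4 ^ k) (q.2.1 * 4 ^ k) Y)
      (rotRows p (Real.cos ψ) (Real.sin ψ) X) := by
  intro r l hr hl
  have ha := h p l (by omega) hl
  have hb := h (p + 1) l (by omega) hl
  have ha' := ha
  have hb' := hb
  rw [← abs_neg] at ha' hb'
  rw [fixRotRows_turn, hc, hs]
  unfold rotRows
  split_ifs with h1 h2
  · rcases hq with rfl | rfl | rfl | rfl <;> push_cast
    · convert hb using 2; ring
    · convert hb' using 2; ring
    · convert ha' using 2; ring
    · convert ha using 2; ring
  · rcases hq with rfl | rfl | rfl | rfl <;> push_cast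
    · convert ha' using 2; ring
    · convert ha using 2; ring
    · convert hb' using 2; ring
    · convert hb using 2; ring
  · exact h r l hr hl

/-- The vector to be turned in an elimination step, in polar coordinates. -/
theorem ElimInv.exists_polar {N : ℕ} {σ : ElimPos} {X : ℕ → ℕ → ℝ} (h : ElimInv N σ X)
    (h1 : 1 ≤ σ.row) (h2 : σ.row ≤ σ.col) (h3 : σ.col < N) (hs : σ.smooth = true) {ψ : ℝ}
    (hψ : ψ = Complex.arg ⟨X σ.row σ.col, X (σ.row - 1) σ.col⟩) :
    ∃ r, 1 / (2 * (N : ℝ)) ≤ r ∧ r ≤ 1 ∧ 0 ≤ ψ ∧ ψ ≤ Real.pi ∧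
      X (σ.row - 1) σ.col = r * Real.sin ψ ∧ X σ.row σ.col = r * Real.cos ψ := by
  have hN : (0 : ℝ) < N := by exact_mod_cast (by omega : 0 < N)
  have hx := h.pivot hs
  have hx0 : 0 < X (σ.row - 1) σ.col := lt_of_lt_of_le (by positivity) hx
  obtain ⟨r, hr0, hr2, hrx, hry⟩ := arg_cos_sin (y := X σ.row σ.col) hx0
  rw [← hψ] at hrx hry
  have hle := sq_add_sq_le_one h.orth (p := ⟨σ.row - 1, by omega⟩) (q := ⟨σ.row, by omega⟩)
    (by simp; omega) ⟨σ.col, h3⟩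
  simp only [toMat, Matrix.of_apply] at hle
  refine ⟨r, ?_, ?_, ?_, ?_, hrx, hry⟩
  · nlinarith [sq_nonneg (X σ.row σ.col)]
  · nlinarith
  · rw [hψ]; exact Complex.arg_nonneg_iff.2 hx0.le
  · rw [hψ]; exact Complex.arg_le_pi _

/-- The fixed point value of a right angle. -/
theorem abs_rightAngle_sub_le {k N : ℕ} (hk : 3 ≤ k) (hN : 0 < N) {u : ℝ} (hu : cisErr k ≤ u)
    (hu1 : 480 * N * u ≤ 1) :
    |((angIter k (4 ^ k) 0 (4 * N * k)).1 : ℝ) / 4 ^ k - Real.pi / 2| ≤ 28 * N * u ∧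
    ∀ j, |((angIter k (4 ^ k) 0 j).1 : ℝ) / 4 ^ k| ≤ 8 := by
  have hN' : (1 : ℝ) ≤ N := by exact_mod_cast hN
  have hχ : (0 : ℝ) < 1 / (2 * N) := by positivity
  have hr : 1 / (2 * (N : ℝ)) ≤ 1 := by rw [div_le_one (by positivity)]; linarith
  have hu0 := (cisErr_pos k).trans_le hu
  have hu1' : 240 * u ≤ 1 / (2 * N) := by
    rw [le_div_iff₀ (by positivity)]; linarith
  have hp := Real.pi_pos
  -- A right angle is the angle of the vector with `r sin ψ = 1` and `r cos ψ = 0`.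
  have hx : |(((4 ^ k : ℤ) : ℤ) : ℝ) / 4 ^ k - 1 * Real.sin (Real.pi / 2)| ≤ 0 := by
    rw [Real.sin_pi_div_two]; push_cast; rw [div_self (by positivity)]; simp
  have hy : |((0 : ℤ) : ℝ) / 4 ^ k - 1 * Real.cos (Real.pi / 2)| ≤ 0 := by
    rw [Real.cos_pi_div_two]; simp
  have := angIter_spec hk hχ hr le_rfl (by linarith) (by linarith) hx hy hu0.le hu hu1'
    ((one_sub_pow_le_cisErr hN).trans hu)
  refine ⟨this.1.trans (le_of_eq ?_),
    abs_angIter_le hk hχ hr le_rfl (by linarith) (by linarith) hx hy hu0.le hu hu1'⟩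
  field_simp; norm_num

section Step

variable {k N t : ℕ} {D : ℕ → ℤ × ℤ × ℤ} {Y : ℕ → ℕ → ℤ} {X : ℕ → ℕ → ℝ} {u : ℝ}

theorem realAngle_of_smooth (hs : (elimPos N t).smooth = true) :
    realAngle N D t X = Complex.arg ⟨X (elimPos N t).row (elimPos N t).col,
      X ((elimPos N t).row - 1) (elimPos N t).col⟩ := by
  unfold realAngle; rw [if_pos hs]

theorem realAngle_of_turn (hs : (elimPos N t).smooth = false) :
    realAngle N D t X = (D t).2.2 * (Real.pi / 2) := by
  unfold realAngle; rw [hs]; simp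

theorem fixAngle_of_smooth (hs : (elimPos N t).smooth = true) :
    fixAngle k N D t Y = angIter k (Y ((elimPos N t).row - 1) (elimPos N t).col)
      (Y (elimPos N t).row (elimPos N t).col) (4 * N * k) := by
  unfold fixAngle; rw [if_pos hs]

theorem fixAngle_of_turn (hs : (elimPos N t).smooth = false) :
    fixAngle k N D t Y = ((D t).2.2 * (angIter k (4 ^ k) 0 (4 * N * k)).1,
      (D t).1 * 4 ^ k, (D t).2.1 * 4 ^ k) := by
  unfold fixAngle; rw [hs]; simp

/-- All the intermediate results in the computation of the angle are moderate. -/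
theorem abs_angIter_le_of_elimInv (hk : 3 ≤ k) (hN : 2 ≤ N) (ht : t < N * (N - 1))
    (h : ElimInv N (elimPos N t) X) (hY : Tracks k N u Y X) (hu : cisErr k ≤ u)
    (hu1 : 480 * N * u ≤ 1) (hs : (elimPos N t).smooth = true) (j : ℕ) :
    |((angIter k (Y ((elimPos N t).row - 1) (elimPos N t).col)
      (Y (elimPos N t).row (elimPos N t).col) j).1 : ℝ) / 4 ^ k| ≤ 8 := by
  obtain ⟨-, h2, h3, h1⟩ := elimPos_valid hN ht.le
  have h1 := h1 ht
  have hN' : (1 : ℝ) ≤ N := by exact_mod_cast (by omega : 1 ≤ N)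
  obtain ⟨r, hr, hr1, hψ0, hψ1, hx, hy⟩ := h.exists_polar h1 h2 h3 hs rfl
  have hχ : (0 : ℝ) < 1 / (2 * N) := by positivity
  have hu1' : 240 * u ≤ 1 / (2 * N) := by
    rw [le_div_iff₀ (by positivity)]; linarith
  refine abs_angIter_le hk hχ hr hr1 hψ0 hψ1 ?_ ?_ le_rfl hu hu1' j
  · rw [← hx]; exact hY _ _ (by omega) h3
  · rw [← hy]; exact hY _ _ (by omega) h3

/-- One step of the elimination in fixed point arithmetic. -/
theorem Tracks.step (hk : 3 ≤ k) (hN : 2 ≤ N) (ht : t < N * (N - 1))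
    (h : ElimInv N (elimPos N t) X) (hD : (elimPos N t).smooth = false → IsQuarterTurn (D t))
    (hY : Tracks k N u Y X) (hu : cisErr k ≤ u) (hu1 : 480 * N * u ≤ 1) :
    |((fixAngle k N D t Y).1 : ℝ) / 4 ^ k - realAngle N D t X| ≤ 68 * N * u ∧
    Tracks k N (68 * N * u)
      (fixRotRows k ((elimPos N t).row - 1) (fixAngle k N D t Y).2.1 (fixAngle k N D t Y).2.2 Y)
      (rotRows ((elimPos N t).row - 1) (Real.cos (realAngle N D t X))
        (Real.sin (realAngle N D t X)) X) := by
  obtain ⟨-, h2, h3, h1⟩ := elimPos_valid hN ht.le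
  have h1 := h1 ht
  have hN' : (2 : ℝ) ≤ N := by exact_mod_cast hN
  have hu0 : 0 < u := (cisErr_pos k).trans_le hu
  have hNu : u ≤ N * u := by nlinarith
  cases hs : (elimPos N t).smooth with
  | true =>
    obtain ⟨r, hr, hr1, hψ0, hψ1, hx, hy⟩ := h.exists_polar h1 h2 h3 hs
      (realAngle_of_smooth (D := D) hs)
    have hχ : (0 : ℝ) < 1 / (2 * N) := by positivity
    have hu1' : 240 * u ≤ 1 / (2 * N) := by
      rw [le_div_iff₀ (by positivity)]; linarith
    have hx' := hY ((elimPos N t).row - 1) _ (by omega) h3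
    have hy' := hY (elimPos N t).row _ (by omega) h3
    rw [hx] at hx'
    rw [hy] at hy'
    obtain ⟨a1, a2, a3⟩ := angIter_spec hk hχ hr hr1 hψ0 hψ1 hx' hy' le_rfl hu hu1'
      ((one_sub_pow_le_cisErr (by omega : 0 < N)).trans hu)
    -- With `χ = 1 / (2 N)` the cosine and sine have the accuracy `30 N u`. A rotation then has the
    -- error `2.02 * 30 N u + 3 u`, and `68 N u` leaves room for it.
    have e14 : 14 * u / (1 / (2 * (N : ℝ))) = 28 * (N * u) := by field_simp; norm_num
    have e15 : 15 * u / (1 / (2 * (N : ℝ))) = 30 * (N * u) := by field_simp; norm_num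
    rw [e14] at a1
    rw [e15] at a2 a3
    rw [fixAngle_of_smooth hs]
    refine ⟨a1.trans (by linarith), hY.rotRows_smooth h.orth ?_ (by omega) a2 a3 ?_⟩
    · linarith
    · have := (one_div_four_pow_le_cisErr k).trans hu
      linarith
  | false =>
    have hq := hD hs
    obtain ⟨hc, hsn⟩ := hq.cos_sin
    rw [fixAngle_of_turn hs, realAngle_of_turn hs]
    constructor
    · have hra := (abs_rightAngle_sub_le hk (by omega : 0 < N) hu hu1).1
      have e : (((D t).2.2 * (angIter k (4 ^ k) 0 (4 * N * k)).1 : ℤ) : ℝ) / 4 ^ k -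
          (D t).2.2 * (Real.pi / 2) = (D t).2.2 *
            (((angIter k (4 ^ k) 0 (4 * N * k)).1 : ℝ) / 4 ^ k - Real.pi / 2) := by
        push_cast; ring
      -- At most two right angles of accuracy `28 N u` are added.
      have hA : |((D t).2.2 : ℝ)| ≤ 2 := by
        rcases hq with hq | hq | hq | hq <;> rw [hq] <;> norm_num
      simp only
      rw [e]
      have := abs_mul_le_mul hA hra
      linarith
    · intro r l hr hl
      refine (hY.rotRows_turn (by omega) hq hc hsn r l hr hl).trans ?_
      linarith

/-- A decision taken on the basis of accurate approximations is good. -/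
theorem goodTurn_quarterTurn (hN : 2 ≤ N) (ht : t < N * (N - 1)) (hY : Tracks k N u Y X)
    (hu1 : 480 * N ^ 2 * u ≤ 1) :
    GoodTurn N X (elimPos N t) (quarterTurn (Y ((elimPos N t).row - 1) (elimPos N t).col)
      (Y (elimPos N t).row (elimPos N t).col)) := by
  obtain ⟨-, h2, h3, h1⟩ := elimPos_valid hN ht.le
  have h1 := h1 ht
  refine ⟨isQuarterTurn_quarterTurn _ _, ?_⟩
  have hN' : (0 : ℝ) < N := by exact_mod_cast (by omega : 0 < N)
  have hx := hY ((elimPos N t).row - 1) _ (by omega) h3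
  have hy := hY (elimPos N t).row _ (by omega) h3
  set x := Y ((elimPos N t).row - 1) (elimPos N t).col
  set y := Y (elimPos N t).row (elimPos N t).col
  set a := X ((elimPos N t).row - 1) (elimPos N t).col
  set b := X (elimPos N t).row (elimPos N t).col
  -- Both entries are known up to `u`, so a comparison errs by at most `2 u`. This is the slack
  -- granted by `GoodTurn`.
  have hδ : 2 * u ≤ 1 / (2 * (N : ℝ) ^ 2) := by
    rw [le_div_iff₀ (by positivity)]
    have hu0 : 0 ≤ u := (abs_nonneg _).trans hx
    have : 0 ≤ (N : ℝ) ^ 2 * u := by positivity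
    nlinarith
  have h4 : (0 : ℝ) < 4 ^ k := by positivity
  have mono : ∀ v w : ℤ, v ≤ w → (v : ℝ) / 4 ^ k ≤ (w : ℝ) / 4 ^ k := fun v w hvw => by
    gcongr
  have hx := abs_le.1 hx
  have hy := abs_le.1 hy
  unfold quarterTurn
  split_ifs with c1 c2 c3
  · have m1 := mono x y (by nlinarith)
    have m2 := mono (-y) x (by nlinarith)
    have m3 := mono 0 y c2.le
    push_cast at m1 m2 m3 ⊢
    rw [neg_div] at m2
    rw [zero_div] at m3
    constructor <;> rw [abs_le] <;> constructor <;> linarith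
  · have m1 := mono x (-y) (by nlinarith)
    have m2 := mono y x (by nlinarith)
    have m3 := mono y 0 (by linarith)
    push_cast at m1 m2 m3 ⊢
    rw [neg_div] at m1
    rw [zero_div] at m3
    constructor <;> rw [abs_le] <;> constructor <;> linarith
  · have m1 := mono y (-x) (by nlinarith)
    have m2 := mono x y (by nlinarith)
    have m3 := mono x 0 (by linarith)
    push_cast at m1 m2 m3 ⊢
    rw [neg_div] at m1
    rw [zero_div] at m3
    constructor <;> rw [abs_le] <;> constructor <;> linarith
  · have m1 := mono y x (by nlinarith)
    have m2 := mono (-x) y (by nlinarith)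
    have m3 := mono 0 x (by linarith)
    push_cast at m1 m2 m3 ⊢
    rw [neg_div] at m2
    rw [zero_div] at m3
    constructor <;> rw [abs_le] <;> constructor <;> linarith

end Step

/-- The decisions are those suggested by the elimination with parameter `k`. -/
def SelfConsistent (k N : ℕ) (D : ℕ → ℤ × ℤ × ℤ) (Y : ℕ → ℕ → ℤ) : Prop :=
  ∀ t, D t = quarterTurn (fixElim k N D Y t ((elimPos N t).row - 1) (elimPos N t).col)
    (fixElim k N D Y t (elimPos N t).row (elimPos N t).col)

theorem elimInv_succ {N t : ℕ} {D : ℕ → ℤ × ℤ × ℤ} {X : ℕ → ℕ → ℝ} (hN : 2 ≤ N)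
    (ht : t < N * (N - 1)) (h : ElimInv N (elimPos N t) (realElim N D X t))
    (hD : (elimPos N t).smooth = false → GoodTurn N (realElim N D X t) (elimPos N t) (D t)) :
    ElimInv N (elimPos N (t + 1)) (realElim N D X (t + 1)) := by
  obtain ⟨-, h2, h3, h1⟩ := elimPos_valid hN ht.le
  rw [elimPos_succ]
  refine h.next (h1 ht) h2 h3 (fun hs => ⟨D t, hD hs, ?_⟩) realAngle_of_smooth
  rw [realAngle_of_turn hs]
  exact (hD hs).1.cos_sin

/-- The elimination with self-consistent decisions is stable. -/
theorem elimInv_of_selfConsistent {k N : ℕ} {D : ℕ → ℤ × ℤ × ℤ} {Y : ℕ → ℕ → ℤ} {X : ℕ → ℕ → ℝ}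
    {S : ℝ} (hS : 0 ≤ S) (hk : 3 ≤ k) (hN : 2 ≤ N) (hD : SelfConsistent k N D Y)
    (h0 : ElimInv N (elimPos N 0) X) (hY : Tracks k N (elimErr k N S 0) Y X)
    (hsmall : 480 * N ^ 2 * elimErr k N S (N * (N - 1)) ≤ 1) :
    ∀ t ≤ N * (N - 1), ElimInv N (elimPos N t) (realElim N D X t) ∧
      Tracks k N (elimErr k N S t) (fixElim k N D Y t) (realElim N D X t) := by
  have hN' : (1 : ℝ) ≤ N := by exact_mod_cast (by omega : 1 ≤ N)
  -- Accuracy and stability need a joint induction: an accurate matrix gives a good turn, a good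
  -- turn preserves the invariant, and the invariant bounds the next error.
  intro t
  induction t with
  | zero => exact fun _ => ⟨h0, hY⟩
  | succ t ih =>
    intro ht
    obtain ⟨h1, h2⟩ := ih (by omega)
    have hle := elimErr_le_elimErr (k := k) hS (by omega : 0 < N) (by omega : t ≤ N * (N - 1))
    have hsm : 480 * N ^ 2 * elimErr k N S t ≤ 1 := le_trans (by gcongr) hsmall
    have hpos : 0 < elimErr k N S t :=
      (cisErr_pos k).trans_le (cisErr_le_elimErr hS (by omega) t)
    have hsm' : 480 * N * elimErr k N S t ≤ 1 := by
      refine le_trans ?_ hsm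
      gcongr
      nlinarith
    have hgood := goodTurn_quarterTurn hN (by omega : t < N * (N - 1)) h2 hsm
    rw [← hD t] at hgood
    refine ⟨elimInv_succ hN (by omega) h1 fun _ => hgood, ?_⟩
    rw [elimErr_succ]
    exact (h2.step hk hN (by omega) h1 (fun _ => hgood.1) (cisErr_le_elimErr hS (by omega) t)
      hsm').2

/-- The accuracy of an elimination with given decisions. -/
theorem tracks_of_elimInv {k N : ℕ} {D : ℕ → ℤ × ℤ × ℤ} {Y : ℕ → ℕ → ℤ} {X : ℕ → ℕ → ℝ}
    {S : ℝ} (hS : 0 ≤ S) (hk : 3 ≤ k) (hN : 2 ≤ N) (hD : ∀ t, IsQuarterTurn (D t))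
    (hinv : ∀ t ≤ N * (N - 1), ElimInv N (elimPos N t) (realElim N D X t))
    (hY : Tracks k N (elimErr k N S 0) Y X)
    (hsmall : 480 * N ^ 2 * elimErr k N S (N * (N - 1)) ≤ 1) :
    ∀ t ≤ N * (N - 1), Tracks k N (elimErr k N S t) (fixElim k N D Y t) (realElim N D X t) ∧
      (t < N * (N - 1) → |((fixAngle k N D t (fixElim k N D Y t)).1 : ℝ) / 4 ^ k -
        realAngle N D t (realElim N D X t)| ≤ elimErr k N S (t + 1)) := by
  have hN' : (1 : ℝ) ≤ N := by exact_mod_cast (by omega : 1 ≤ N)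
  -- The invariant of the exact elimination is given here, so the turns need not be those that this
  -- precision would suggest. This is what allows the second pass to reuse the recorded turns.
  have step : ∀ t < N * (N - 1), Tracks k N (elimErr k N S t) (fixElim k N D Y t)
      (realElim N D X t) → |((fixAngle k N D t (fixElim k N D Y t)).1 : ℝ) / 4 ^ k -
        realAngle N D t (realElim N D X t)| ≤ elimErr k N S (t + 1) ∧
      Tracks k N (elimErr k N S (t + 1)) (fixElim k N D Y (t + 1)) (realElim N D X (t + 1)) := by
    intro t ht h
    have hle := elimErr_le_elimErr (k := k) hS (by omega : 0 < N) ht.le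
    have hpos : 0 < elimErr k N S t :=
      (cisErr_pos k).trans_le (cisErr_le_elimErr hS (by omega) t)
    have hsm' : 480 * N * elimErr k N S t ≤ 1 := by
      refine le_trans ?_ hsmall
      gcongr
      nlinarith
    rw [elimErr_succ]
    exact h.step hk hN ht (hinv t ht.le) (fun _ => hD t) (cisErr_le_elimErr hS (by omega) t) hsm'
  intro t
  induction t with
  | zero => exact fun _ => ⟨hY, fun ht => (step 0 ht hY).1⟩
  | succ t ih =>
    intro ht
    have := (step t (by omega) (ih (by omega)).1).2
    exact ⟨this, fun ht => (step (t + 1) ht this).1⟩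

end

noncomputable section

/-! ### Products of one-qubit operators -/

theorem productOp_mul {n : ℕ} (P Q : Fin n → Matrix (Fin 2) (Fin 2) ℂ) :
    productOp P * productOp Q = productOp fun i => P i * Q i := by
  ext x y
  simp only [productOp, Matrix.mul_apply, Matrix.of_apply, ← Finset.prod_mul_distrib]
  exact (Fintype.prod_sum fun i j => P i (x i) j * Q i j (y i)).symm

theorem productOp_one {n : ℕ} : productOp (fun _ : Fin n => 1) = 1 := by
  ext x y
  simp only [productOp, Matrix.of_apply, Matrix.one_apply]
  by_cases h : x = y
  · subst h; simp
  · obtain ⟨i, hi⟩ := Function.ne_iff.1 h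
    rw [if_neg h]
    exact Finset.prod_eq_zero (Finset.mem_univ i) (if_neg hi)

theorem productOp_smul {n : ℕ} (a : Fin n → ℂ) (P : Fin n → Matrix (Fin 2) (Fin 2) ℂ) :
    productOp (fun i => a i • P i) = (∏ i, a i) • productOp P := by
  ext x y
  simp [productOp, Finset.prod_mul_distrib]

theorem productOp_conjTranspose {n : ℕ} (P : Fin n → Matrix (Fin 2) (Fin 2) ℂ) :
    (productOp P).conjTranspose = productOp fun i => (P i).conjTranspose := by
  ext x y
  simp [productOp]

theorem productOp_map_star {n : ℕ} (P : Fin n → Matrix (Fin 2) (Fin 2) ℂ) :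
    (productOp P).map (starRingEnd ℂ) = productOp fun i => (P i).map (starRingEnd ℂ) := by
  ext x y
  simp [productOp]

/-! ### The Jordan–Wigner generators -/

/-- The factor of a generator on the line `i`. -/
def jwFactor (μ i : ℕ) : Matrix (Fin 2) (Fin 2) ℂ :=
  if i < μ / 2 then pauliZ
  else if i = μ / 2 then (if μ % 2 = 0 then pauliX else pauliY)
  else 1

theorem jw_eq {n : ℕ} (μ : Fin (2 * n)) : jw μ = productOp fun i : Fin n => jwFactor μ i := rfl

theorem pauliX_sq : pauliX * pauliX = 1 := by
  ext i j; fin_cases i <;> fin_cases j <;> simp [pauliX]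

theorem pauliY_sq : pauliY * pauliY = 1 := by
  ext i j; fin_cases i <;> fin_cases j <;> simp [pauliY]

theorem pauliZ_sq : pauliZ * pauliZ = 1 := by
  ext i j; fin_cases i <;> fin_cases j <;> simp [pauliZ]

theorem pauliX_mul_pauliY : pauliX * pauliY = (-1 : ℂ) • (pauliY * pauliX) := by
  ext i j; fin_cases i <;> fin_cases j <;> simp [pauliX, pauliY]

theorem pauliX_mul_pauliZ : pauliX * pauliZ = (-1 : ℂ) • (pauliZ * pauliX) := by
  ext i j; fin_cases i <;> fin_cases j <;> simp [pauliX, pauliZ]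

theorem pauliY_mul_pauliZ : pauliY * pauliZ = (-1 : ℂ) • (pauliZ * pauliY) := by
  ext i j; fin_cases i <;> fin_cases j <;> simp [pauliY, pauliZ]

theorem jwFactor_sq (μ i : ℕ) : jwFactor μ i * jwFactor μ i = 1 := by
  unfold jwFactor
  split_ifs <;> simp [pauliX_sq, pauliY_sq, pauliZ_sq]

theorem jwFactor_conjTranspose (μ i : ℕ) : (jwFactor μ i).conjTranspose = jwFactor μ i := by
  unfold jwFactor
  split_ifs <;> ext a b <;> fin_cases a <;> fin_cases b <;> simp [pauliX, pauliY, pauliZ]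

/-- For `μ < ν` the factors anticommute on the line `μ / 2` and commute on all the others. -/
theorem jwFactor_anticomm {μ ν : ℕ} (h : μ < ν) (i : ℕ) :
    jwFactor μ i * jwFactor ν i =
      (if i = μ / 2 then -1 else 1 : ℂ) • (jwFactor ν i * jwFactor μ i) := by
  have hle : μ / 2 ≤ ν / 2 := Nat.div_le_div_right h.le
  unfold jwFactor
  rcases lt_trichotomy i (μ / 2) with h1 | h1 | h1
  · rw [if_pos h1, if_pos (h1.trans_le hle), if_neg h1.ne, one_smul]
  · rw [if_neg (by omega), if_pos h1, if_pos h1]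
    by_cases h2 : i < ν / 2
    · rw [if_pos h2]
      split_ifs
      · exact pauliX_mul_pauliZ
      · exact pauliY_mul_pauliZ
    · rw [if_neg h2, if_pos (by omega), if_pos (by omega), if_neg (by omega)]
      exact pauliX_mul_pauliY
  · simp only [not_lt.2 h1.le, h1.ne', if_false, one_mul, mul_one, one_smul]

variable {n : ℕ}

theorem jw_sq (μ : Fin (2 * n)) : jw μ * jw μ = 1 := by
  rw [jw_eq, productOp_mul]
  simp only [jwFactor_sq]
  exact productOp_one

theorem jw_conjTranspose (μ : Fin (2 * n)) : (jw μ).conjTranspose = jw μ := by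
  rw [jw_eq, productOp_conjTranspose]
  simp only [jwFactor_conjTranspose]

theorem jw_anticomm_of_lt {μ ν : Fin (2 * n)} (h : μ < ν) : jw μ * jw ν = -(jw ν * jw μ) := by
  have hμ : (μ : ℕ) / 2 < n := by have := μ.2; omega
  rw [jw_eq, jw_eq, productOp_mul, productOp_mul]
  have : (fun i : Fin n => jwFactor μ i * jwFactor ν i) = fun i : Fin n =>
      (if i = ⟨(μ : ℕ) / 2, hμ⟩ then -1 else 1 : ℂ) • (jwFactor ν i * jwFactor μ i) := by
    funext i
    rw [jwFactor_anticomm h]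
    simp [Fin.ext_iff]
  rw [this, productOp_smul, Finset.prod_ite_eq' Finset.univ (⟨(μ : ℕ) / 2, hμ⟩ : Fin n)]
  simp

theorem jw_anticomm {μ ν : Fin (2 * n)} (h : μ ≠ ν) : jw μ * jw ν = -(jw ν * jw μ) := by
  rcases lt_or_gt_of_ne h with h | h
  · exact jw_anticomm_of_lt h
  · rw [jw_anticomm_of_lt h, neg_neg]

theorem jw_mul_jw_add (μ ν : Fin (2 * n)) :
    jw μ * jw ν + jw ν * jw μ = (if μ = ν then 2 else 0 : ℂ) • (1 : QOp n) := by
  split_ifs with h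
  · subst h; rw [jw_sq, two_smul]
  · rw [jw_anticomm h]; simp

/-- The generators are linearly independent. -/
theorem jw_coeff_eq_zero {a : Fin (2 * n) → ℂ} (h : ∑ ν, a ν • jw ν = 0) (μ : Fin (2 * n)) :
    a μ = 0 := by
  -- The anticommutator with `jw μ` annihilates all other generators and so isolates the coefficient
  -- of `jw μ`.
  have h1 : (∑ ν, a ν • jw ν) * jw μ + jw μ * ∑ ν, a ν • jw ν = (2 * a μ) • (1 : QOp n) := by
    rw [Finset.sum_mul, Finset.mul_sum, ← Finset.sum_add_distrib]
    simp only [Matrix.smul_mul, Matrix.mul_smul, ← smul_add, jw_mul_jw_add, smul_smul]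
    rw [Finset.sum_eq_single μ]
    · simp [mul_comm]
    · intro b _ hb; simp [hb]
    · simp
  rw [h] at h1
  have h2 := congrFun (congrFun h1 0) 0
  simpa using h2.symm

/-! ### The conjugation that fixes the generators -/

/-- The operator `X ⊗ Y ⊗ X ⊗ ⋯`. -/
def conjOp (n : ℕ) : QOp n := productOp fun i => if (i : ℕ) % 2 = 0 then pauliX else pauliY

theorem conjOp_mul_self : conjOp n * conjOp n = 1 := by
  rw [conjOp, productOp_mul, ← productOp_one]
  congr 1
  funext i
  split_ifs <;> simp [pauliX_sq, pauliY_sq]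

/-- Complex conjugation fixes `X` and `Z` and negates `Y`. Each of the `μ / 2` factors `Z`
anticommutes with the factor of `conjOp` and contributes `-1`. The line `k = μ / 2` contributes
`(-1) ^ k` in each of the four cases, so the signs cancel. Hence `A ↦ conjOp * conj A * conjOp` is
antilinear and fixes all generators; it is used to show that a scalar is real. -/
theorem conjOp_mul_conj_jw (μ : Fin (2 * n)) :
    conjOp n * (jw μ).map (starRingEnd ℂ) = jw μ * conjOp n := by
  have hμ : (μ : ℕ) / 2 < n := by have := μ.2; omega
  have hX : pauliX.map (starRingEnd ℂ) = pauliX := by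
    ext i j; fin_cases i <;> fin_cases j <;> simp [pauliX]
  have hY : pauliY.map (starRingEnd ℂ) = (-1 : ℂ) • pauliY := by
    ext i j; fin_cases i <;> fin_cases j <;> simp [pauliY]
  have hZ : pauliZ.map (starRingEnd ℂ) = pauliZ := by
    ext i j; fin_cases i <;> fin_cases j <;> simp [pauliZ]
  rw [jw_eq, productOp_map_star, conjOp, productOp_mul, productOp_mul]
  have key : ∀ i : Fin n, (if (i : ℕ) % 2 = 0 then pauliX else pauliY) *
      (jwFactor μ i).map (starRingEnd ℂ) =
      ((if (i : ℕ) < (μ : ℕ) / 2 then -1 else 1) *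
        (if i = ⟨(μ : ℕ) / 2, hμ⟩ then (-1) ^ ((μ : ℕ) / 2) else 1) : ℂ) •
        (jwFactor μ i * if (i : ℕ) % 2 = 0 then pauliX else pauliY) := by
    intro i
    simp only [Fin.ext_iff]
    unfold jwFactor
    rcases lt_trichotomy (i : ℕ) ((μ : ℕ) / 2) with h1 | h1 | h1
    · simp only [h1, h1.ne, if_true, if_false, mul_one, hZ]
      split_ifs
      · exact pauliX_mul_pauliZ
      · exact pauliY_mul_pauliZ
    · simp only [h1, lt_irrefl, if_true, if_false, one_mul]
      rcases Nat.even_or_odd ((μ : ℕ) / 2) with he | ho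
      · rw [if_pos (Nat.even_iff.1 he), he.neg_one_pow, one_smul]
        split_ifs
        · rw [hX]
        · rw [hY, Matrix.mul_smul, pauliX_mul_pauliY, smul_smul]; simp
      · rw [if_neg (by rw [Nat.odd_iff.1 ho]; decide), ho.neg_one_pow]
        split_ifs
        · rw [hX, pauliX_mul_pauliY, smul_smul]; simp
        · rw [hY, Matrix.mul_smul]
    · simp [h1.ne', not_lt.2 h1.le]
  have hfun : (fun i : Fin n => (if (i : ℕ) % 2 = 0 then pauliX else pauliY) *
      (jwFactor μ i).map (starRingEnd ℂ)) = _ := funext key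
  rw [hfun, productOp_smul, Finset.prod_mul_distrib, Finset.prod_ite_eq' Finset.univ,
    Fin.prod_univ_eq_prod_range (fun i => if i < (μ : ℕ) / 2 then (-1 : ℂ) else 1) n,
    Finset.prod_ite]
  have hf : (Finset.range n).filter (fun i => i < (μ : ℕ) / 2) = Finset.range ((μ : ℕ) / 2) := by
    ext i; simp; omega
  rw [hf]
  simp [← mul_pow]

/-! ### Operators that commute with all generators -/

theorem jw_even_mul_jw_odd {k : ℕ} (hk : k < n) :
    (jw ⟨2 * k, by omega⟩ : QOp n) * jw ⟨2 * k + 1, by omega⟩ =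
      productOp fun i : Fin n => if (i : ℕ) = k then Complex.I • pauliZ else 1 := by
  rw [jw_eq, jw_eq, productOp_mul]
  congr 1
  funext i
  have h1 : 2 * k / 2 = k := by omega
  have h2 : (2 * k + 1) / 2 = k := by omega
  have h3 : (2 * k + 1) % 2 = 1 := by omega
  simp only [jwFactor, h1, h2, h3, Nat.mul_mod_right, if_true, one_ne_zero, if_false]
  split_ifs with h4 h5
  · omega
  · exact pauliZ_sq
  · ext a b; fin_cases a <;> fin_cases b <;> simp [pauliX, pauliY, pauliZ]
  · simp

/-- Operators that commute with all generators are scalars. -/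
theorem eq_smul_one_of_commute_jw {A : QOp n} (h : ∀ μ : Fin (2 * n), A * jw μ = jw μ * A) :
    ∃ z : ℂ, A = z • (1 : QOp n) := by
  -- The products `c_{2k} c_{2k+1}` are the operators `i Z` on single lines; together they separate
  -- all bit strings.
  have hdiag : ∀ x y, x ≠ y → A x y = 0 := by
    intro x y hxy
    obtain ⟨k, hk⟩ := Function.ne_iff.1 hxy
    have hc : A * ((jw ⟨2 * k, by omega⟩ : QOp n) * jw ⟨2 * k + 1, by omega⟩) =
        ((jw ⟨2 * k, by omega⟩ : QOp n) * jw ⟨2 * k + 1, by omega⟩) * A := by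
      rw [← Matrix.mul_assoc, h, Matrix.mul_assoc, h, Matrix.mul_assoc]
    rw [jw_even_mul_jw_odd k.2] at hc
    have hd : (productOp fun i : Fin n => if (i : ℕ) = k then Complex.I • pauliZ else 1) =
        Matrix.diagonal fun x : Fin n → Fin 2 => if x k = 0 then Complex.I else -Complex.I := by
      ext u v
      simp only [productOp, Matrix.of_apply]
      by_cases huv : u = v
      · subst huv
        rw [Matrix.diagonal_apply_eq, Finset.prod_eq_single k]
        · simp only [if_true]
          generalize u k = a
          fin_cases a <;> simp [pauliZ]
        · intro i _ hi
          rw [if_neg (fun he => hi (Fin.ext he))]; simp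
        · simp
      · rw [Matrix.diagonal_apply_ne _ huv]
        obtain ⟨i, hi⟩ := Function.ne_iff.1 huv
        refine Finset.prod_eq_zero (Finset.mem_univ i) ?_
        split_ifs
        · generalize u i = a at hi
          generalize v i = b at hi
          fin_cases a <;> fin_cases b <;> simp [pauliZ] at hi ⊢
        · exact Matrix.one_apply_ne hi
    rw [hd] at hc
    have h2 := congrFun (congrFun hc x) y
    rw [Matrix.mul_diagonal, Matrix.diagonal_mul] at h2
    have hI := Complex.I_ne_zero
    generalize x k = a at hk h2
    generalize y k = b at hk h2
    fin_cases a <;> fin_cases b <;> simp at hk h2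
    · have : (2 * Complex.I) * A x y = 0 := by linear_combination -h2
      simpa using this
    · have : (2 * Complex.I) * A x y = 0 := by linear_combination h2
      simpa using this
  -- In each row `c_{2k}` has a single nonzero entry, at the string with the bit `k` flipped.
  -- Commuting with it equates the diagonal entries of `A` at the two strings.
  have hflip : ∀ (x : Fin n → Fin 2) (k : Fin n) (b : Fin 2),
      A (Function.update x k b) (Function.update x k b) = A x x := by
    intro x k b
    by_cases hb : b = x k
    · rw [hb, Function.update_eq_self]
    · set y := Function.update x k b with hy
      have h2 := congrFun (congrFun (h ⟨2 * k, by omega⟩) y) x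
      rw [Matrix.mul_apply, Matrix.mul_apply, Finset.sum_eq_single y, Finset.sum_eq_single x] at h2
      · have hne : (jw ⟨2 * k, by omega⟩ : QOp n) y x ≠ 0 := by
          rw [jw_eq]
          simp only [productOp, Matrix.of_apply]
          refine Finset.prod_ne_zero_iff.2 fun i _ => ?_
          have h1 : 2 * (k : ℕ) / 2 = k := by omega
          simp only [jwFactor, h1, Nat.mul_mod_right, if_true]
          by_cases hi : i = k
          · subst hi
            rw [if_neg (lt_irrefl _), if_pos rfl, hy, Function.update_self]
            generalize x i = a at hb
            fin_cases a <;> fin_cases b <;> simp [pauliX] at hb ⊢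
          · have hi' : (i : ℕ) ≠ k := fun he => hi (Fin.ext he)
            rw [hy, Function.update_of_ne hi, if_neg hi']
            generalize x i = a
            split_ifs <;> fin_cases a <;> simp [pauliZ]
        have h3 : (A y y - A x x) * (jw ⟨2 * k, by omega⟩ : QOp n) y x = 0 := by
          linear_combination h2
        exact sub_eq_zero.1 ((mul_eq_zero.1 h3).resolve_right hne)
      · intro z _ hz; rw [hdiag z x hz, mul_zero]
      · simp
      · intro z _ hz; rw [hdiag y z (Ne.symm hz), zero_mul]
      · simp
  have hconst : ∀ (s : Finset (Fin n)) (x : Fin n → Fin 2), (∀ i ∉ s, x i = 0) →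
      A x x = A 0 0 := by
    intro s
    induction s using Finset.induction_on with
    | empty =>
      intro x hx
      have : x = 0 := funext fun i => hx i (by simp)
      rw [this]
    | insert k s _ ih =>
      intro x hx
      rw [← hflip x k 0]
      refine ih _ fun i hi => ?_
      by_cases hik : i = k
      · subst hik; simp
      · rw [Function.update_of_ne hik]; exact hx i (by simp [hik, hi])
  refine ⟨A 0 0, ?_⟩
  ext x y
  by_cases hxy : x = y
  · subst hxy
    simp [hconst Finset.univ x (by simp)]
  · simp [hdiag x y hxy, hxy]

end

noncomputable section

/-! ### Exponentials and linear transformations of the generators -/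

section Exp

open scoped Matrix.Norms.L2Operator

theorem hasDerivAt_exp_smul_apply {N : ℕ} (a : Matrix (Fin N) (Fin N) ℝ) (l j : Fin N) (t : ℝ) :
    HasDerivAt (fun t : ℝ => NormedSpace.exp (t • a) l j)
      ((a * NormedSpace.exp (t • a)) l j) t :=
  (LinearMap.toContinuousLinearMap (Matrix.entryLinearMap ℝ ℝ l j)).hasFDerivAt.comp_hasDerivAt t
    (hasDerivAt_exp_smul_const' (𝕂 := ℝ) a t)

/-- If `[X, c j] = ∑ l, a l j • c l`, then conjugation by `exp X` acts as `exp a`. -/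
theorem exp_mul_eq_sum_exp_mul {𝔸 : Type*} [NormedRing 𝔸] [NormedAlgebra ℝ 𝔸] [CompleteSpace 𝔸]
    {N : ℕ} {X : 𝔸} {c : Fin N → 𝔸} {a : Matrix (Fin N) (Fin N) ℝ}
    (h : ∀ j, X * c j = c j * X + ∑ l, a l j • c l) (j : Fin N) :
    NormedSpace.exp X * c j = (∑ l, NormedSpace.exp a l j • c l) * NormedSpace.exp X := by
  let _ : NormedAlgebra ℚ 𝔸 := NormedAlgebra.restrictScalars ℚ ℝ 𝔸
  set S : ℝ → 𝔸 := fun t => ∑ l, NormedSpace.exp (t • a) l j • c l with hS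
  have hS' : ∀ t, HasDerivAt S (∑ l, (a * NormedSpace.exp (t • a)) l j • c l) t := fun t =>
    HasDerivAt.fun_sum fun l _ => (hasDerivAt_exp_smul_apply a l j t).smul_const (c l)
  have hcomm : ∀ t, X * S t = S t * X + ∑ l, (a * NormedSpace.exp (t • a)) l j • c l := by
    intro t
    simp only [hS, Finset.mul_sum, Finset.sum_mul, mul_smul_comm, h, smul_add,
      Finset.sum_add_distrib, smul_mul_assoc, Finset.smul_sum, Matrix.mul_apply, Finset.sum_smul,
      smul_smul]
    congr 1
    rw [Finset.sum_comm]
    exact Finset.sum_congr rfl fun _ _ => Finset.sum_congr rfl fun _ _ => by rw [mul_comm]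
  -- As `S' = X S - S X`, the function `e^{-tX} S(t) e^{tX}` is constant; its values at `0` and `1`
  -- are then compared.
  have hg : ∀ t : ℝ, HasDerivAt (fun t : ℝ => NormedSpace.exp (t • -X) * S t *
      NormedSpace.exp (t • X)) 0 t := by
    intro t
    have := ((hasDerivAt_exp_smul_const (𝕂 := ℝ) (-X) t).fun_mul (hS' t)).fun_mul
      (hasDerivAt_exp_smul_const' (𝕂 := ℝ) X t)
    convert this using 1
    have e := hcomm t
    generalize (∑ l, (a * NormedSpace.exp (t • a)) l j • c l) = S' at e ⊢
    have e' : S' = X * S t - S t * X := by rw [e]; abel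
    rw [e']
    noncomm_ring
  have hconst := is_const_of_deriv_eq_zero (fun t => (hg t).differentiableAt)
    (fun t => (hg t).deriv) 1 0
  simp only [one_smul, zero_smul, NormedSpace.exp_zero, one_mul, mul_one] at hconst
  have hS0 : S 0 = c j := by
    simp only [hS, zero_smul, NormedSpace.exp_zero, Matrix.one_apply]
    rw [Finset.sum_eq_single j] <;> simp +contextual
  have hS1 : S 1 = ∑ l, NormedSpace.exp a l j • c l := by simp only [hS, one_smul]
  rw [hS0, hS1] at hconst
  have hinv : NormedSpace.exp X * NormedSpace.exp (-X) = 1 := by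
    rw [← NormedSpace.exp_add_of_commute (Commute.refl X).neg_right, add_neg_cancel,
      NormedSpace.exp_zero]
  rw [← hconst, ← mul_assoc, ← mul_assoc, hinv, one_mul]

theorem exp_map_star {ι : Type*} [Fintype ι] [DecidableEq ι] (X : Matrix ι ι ℂ) :
    (NormedSpace.exp X).map (starRingEnd ℂ) = NormedSpace.exp (X.map (starRingEnd ℂ)) := by
  let _ : NormedAlgebra ℚ (Matrix ι ι ℂ) := NormedAlgebra.restrictScalars ℚ ℂ _
  exact NormedSpace.map_exp ((starRingEnd ℂ).mapMatrix (m := ι))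
    (Continuous.matrix_map continuous_id Complex.continuous_conj) X

theorem mul_exp_of_mul_eq {ι : Type*} [Fintype ι] [DecidableEq ι] {W X Y : Matrix ι ι ℂ}
    (h : W * X = Y * W) : W * NormedSpace.exp X = NormedSpace.exp Y * W := by
  let _ : NormedAlgebra ℚ (Matrix ι ι ℂ) := NormedAlgebra.restrictScalars ℚ ℂ _
  exact SemiconjBy.exp_right (x := W) h

theorem exp_neg_mul_exp {ι : Type*} [Fintype ι] [DecidableEq ι] (X : Matrix ι ι ℂ) :
    NormedSpace.exp (-X) * NormedSpace.exp X = 1 := by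
  rw [← Matrix.exp_add_of_commute _ _ (Commute.refl X).neg_left, neg_add_cancel,
    NormedSpace.exp_zero]

/-- Since `B` has square `-1`, sending `i` to `B` defines an algebra homomorphism from the complex
numbers, which carries Euler's formula over. -/
theorem exp_smul_of_mul_self_eq_neg_one {ι : Type*} [Fintype ι] [DecidableEq ι]
    {B : Matrix ι ι ℂ} (hB : B * B = -1) (θ : ℝ) :
    NormedSpace.exp (θ • B) = Real.cos θ • (1 : Matrix ι ι ℂ) + Real.sin θ • B := by
  let f : ℂ →ₐ[ℝ] Matrix ι ι ℂ := Complex.liftAux B hB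
  have hf : Continuous f := LinearMap.continuous_of_finiteDimensional f.toLinearMap
  have h := NormedSpace.map_exp f hf (θ * Complex.I)
  rw [← Complex.exp_eq_exp_ℂ] at h
  simp only [f, Complex.liftAux_apply, Complex.exp_ofReal_mul_I_re, Complex.exp_ofReal_mul_I_im,
    Complex.mul_re, Complex.mul_im, Complex.ofReal_re, Complex.ofReal_im, Complex.I_re,
    Complex.I_im, mul_zero, mul_one, sub_zero, add_zero, map_zero, zero_add] at h
  rw [← h, Algebra.algebraMap_eq_smul_one]

end Exp

end

noncomputable section

variable {n : ℕ}

/-! ### Operations that transform the generators linearly -/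

/-- The unitary operator `U` is fixed by the conjugation that fixes the generators, and transforms
them by the matrix `R`. -/
structure IsSpin (U : QOp n) (R : Matrix (Fin (2 * n)) (Fin (2 * n)) ℝ) : Prop where
  map : ∀ μ, U * jw μ = (∑ ν, R ν μ • jw ν) * U
  unitary : U.conjTranspose * U = 1
  conj : conjOp n * U.map (starRingEnd ℂ) = U * conjOp n

theorem IsSpin.one : IsSpin (1 : QOp n) 1 := by
  refine ⟨fun μ => ?_, by simp, by simp⟩
  rw [one_mul, mul_one, Finset.sum_eq_single μ] <;> simp +contextual

theorem IsSpin.mul {U V : QOp n} {R S : Matrix (Fin (2 * n)) (Fin (2 * n)) ℝ} (hU : IsSpin U R)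
    (hV : IsSpin V S) : IsSpin (U * V) (R * S) := by
  refine ⟨fun μ => ?_, ?_, ?_⟩
  · rw [mul_assoc, hV.map, ← mul_assoc, ← mul_assoc]
    congr 1
    simp only [Finset.mul_sum, mul_smul_comm, hU.map, Finset.sum_mul, smul_mul_assoc,
      Finset.smul_sum, Matrix.mul_apply, Finset.sum_smul, smul_smul]
    rw [Finset.sum_comm]
    exact Finset.sum_congr rfl fun _ _ => Finset.sum_congr rfl fun _ _ => by rw [mul_comm]
  · rw [Matrix.conjTranspose_mul, mul_assoc, ← mul_assoc U.conjTranspose, hU.unitary, one_mul,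
      hV.unitary]
  · rw [Matrix.map_mul, ← mul_assoc, hU.conj, mul_assoc, hV.conj, mul_assoc]

/-- Two operations with the same effect on the generators differ by a sign. -/
theorem IsSpin.mul_self_eq {U V : QOp n} {R : Matrix (Fin (2 * n)) (Fin (2 * n)) ℝ}
    (hU : IsSpin U R) (hV : IsSpin V R) : U * U = V * V := by
  have hV' : V * V.conjTranspose = 1 := mul_eq_one_comm.1 hV.unitary
  have hUc : U * V.conjTranspose * V = U := by rw [mul_assoc, hV.unitary, mul_one]
  -- `V† U` commutes with every generator, because `U` and `V` transform the generators alike.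
  obtain ⟨z, hz⟩ := eq_smul_one_of_commute_jw (A := V.conjTranspose * U) fun μ => by
    have h1 : jw μ = V.conjTranspose * (∑ ν, R ν μ • jw ν) * V := by
      rw [mul_assoc, ← hV.map, ← mul_assoc, hV.unitary, one_mul]
    calc V.conjTranspose * U * jw μ = V.conjTranspose * (∑ ν, R ν μ • jw ν) * (V *
          V.conjTranspose) * U := by rw [hV', mul_one, mul_assoc, hU.map, mul_assoc]
      _ = jw μ * (V.conjTranspose * U) := by
        conv_rhs => rw [h1]
        simp only [mul_assoc]
  have hUV : U = z • V := by
    rw [← one_mul U, ← hV', mul_assoc, hz, mul_smul_comm, mul_one]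
  -- The conjugation fixes both `U` and `V`, but it is antilinear. Unitarity will then leave only `z
  -- = 1` and `z = -1`.
  have hreal : starRingEnd ℂ z = z := by
    have h1 := hU.conj
    have h2 : (z • V).map (starRingEnd ℂ) = starRingEnd ℂ z • V.map (starRingEnd ℂ) := by
      ext i j; simp
    rw [hUV, h2, mul_smul_comm, hV.conj, smul_mul_assoc] at h1
    have h3 : (starRingEnd ℂ z - z) • (V * conjOp n) = 0 := by rw [sub_smul, h1, sub_self]
    have h4 : (starRingEnd ℂ z - z) • (1 : QOp n) = 0 := by
      have := congrArg (fun M => V.conjTranspose * (M * conjOp n)) h3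
      simpa [smul_mul_assoc, mul_assoc, conjOp_mul_self, hV.unitary] using this
    have h5 := congrFun (congrFun h4 0) 0
    simp only [Matrix.smul_apply, Matrix.one_apply_eq, smul_eq_mul, mul_one,
      Matrix.zero_apply] at h5
    exact sub_eq_zero.1 h5
  have hnorm : z * z = 1 := by
    have h1 := hU.unitary
    rw [hUV, Matrix.conjTranspose_smul, smul_mul_smul_comm, hV.unitary] at h1
    have h5 := congrFun (congrFun h1 0) 0
    simp only [Matrix.smul_apply, Matrix.one_apply_eq, smul_eq_mul, mul_one] at h5
    rwa [show star z = z from hreal] at h5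
  rw [hUV, smul_mul_smul_comm, hnorm, one_smul]

theorem jw_mul_jw_conjTranspose {μ ν : Fin (2 * n)} :
    (jw μ * jw ν : QOp n).conjTranspose = jw ν * jw μ := by
  rw [Matrix.conjTranspose_mul, jw_conjTranspose, jw_conjTranspose]

theorem conjOp_mul_conj_jw_mul_jw (μ ν : Fin (2 * n)) :
    conjOp n * (jw μ * jw ν).map (starRingEnd ℂ) = jw μ * jw ν * conjOp n := by
  rw [Matrix.map_mul, ← mul_assoc, conjOp_mul_conj_jw, mul_assoc, conjOp_mul_conj_jw, mul_assoc]

theorem IsSpin.exp {X : QOp n} {a : Matrix (Fin (2 * n)) (Fin (2 * n)) ℝ}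
    (h1 : ∀ μ, NormedSpace.exp X * jw μ = (∑ ν, a ν μ • jw ν) * NormedSpace.exp X)
    (h2 : X.conjTranspose = -X) (h3 : conjOp n * X.map (starRingEnd ℂ) = X * conjOp n) :
    IsSpin (NormedSpace.exp X) a := by
  refine ⟨h1, ?_, ?_⟩
  · rw [← Matrix.exp_conjTranspose, h2, exp_neg_mul_exp]
  · rw [exp_map_star, mul_exp_of_mul_eq h3]

/-- The real quadratic form `∑ x μ ν c_μ c_ν` in the generators. -/
def bivector (x : Matrix (Fin (2 * n)) (Fin (2 * n)) ℝ) : QOp n :=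
  ∑ μ, ∑ ν, x μ ν • (jw μ * jw ν)

/-- The commutator of `c_μ c_ν` with `c_j` is `2 δ_{νj} c_μ - 2 δ_{μj} c_ν`. By antisymmetry of `x`
the two resulting sums agree, which gives the factor `4`. -/
theorem bivector_commutator {x : Matrix (Fin (2 * n)) (Fin (2 * n)) ℝ} (hx : x.transpose = -x)
    (j : Fin (2 * n)) :
    bivector x * jw j = jw j * bivector x + ∑ l, ((4 : ℝ) • x) l j • jw l := by
  have key : ∀ μ ν, jw μ * jw ν * jw j = jw j * (jw μ * jw ν) +
      ((if ν = j then (2 : ℝ) else 0) • jw μ - (if μ = j then (2 : ℝ) else 0) • jw ν) := by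
    intro μ ν
    have e1 := jw_mul_jw_add ν j
    have e2 := jw_mul_jw_add μ j
    have a1 : jw ν * jw j = (if ν = j then 2 else 0 : ℂ) • (1 : QOp n) - jw j * jw ν :=
      eq_sub_of_add_eq e1
    have a2 : jw μ * jw j = (if μ = j then 2 else 0 : ℂ) • (1 : QOp n) - jw j * jw μ :=
      eq_sub_of_add_eq e2
    rw [mul_assoc, a1, mul_sub, ← mul_assoc, a2, sub_mul, mul_smul_comm, mul_one, smul_mul_assoc,
      one_mul, mul_assoc]
    have c1 : ∀ (p : Prop) [Decidable p] (M : QOp n),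
        (if p then (2 : ℂ) else 0) • M = (if p then (2 : ℝ) else 0) • M := by
      intro p _ M
      split_ifs
      · ext i j; simp
      · simp
    rw [c1, c1]
    abel
  unfold bivector
  simp only [Finset.sum_mul, Finset.mul_sum, smul_mul_assoc, mul_smul_comm, key, smul_add,
    Finset.sum_add_distrib, smul_sub, Finset.sum_sub_distrib, smul_smul]
  congr 1
  have hanti : ∀ l, x j l = - x l j := fun l => by
    have := congrFun (congrFun hx l) j
    simpa using this
  have s1 : ∑ μ, ∑ ν, (x μ ν * if ν = j then (2 : ℝ) else 0) • (jw μ : QOp n) =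
      ∑ l, (2 * x l j) • jw l := by
    refine Finset.sum_congr rfl fun μ _ => ?_
    rw [Finset.sum_eq_single j] <;> simp +contextual [mul_comm]
  have s2 : ∑ μ, ∑ ν, (x μ ν * if μ = j then (2 : ℝ) else 0) • (jw ν : QOp n) =
      ∑ l, (-(2 * x l j)) • jw l := by
    rw [Finset.sum_eq_single j]
    · refine Finset.sum_congr rfl fun l _ => ?_
      rw [if_pos rfl, hanti]; congr 1; ring
    · simp +contextual
    · simp
  rw [s1, s2, ← Finset.sum_sub_distrib]
  refine Finset.sum_congr rfl fun l _ => ?_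
  rw [← sub_smul, Matrix.smul_apply, smul_eq_mul]
  congr 1; ring

/-- Antisymmetry makes the bivector antihermitian, so its exponential is unitary. Its coefficients
are real, so it is fixed by the conjugation that fixes the generators. -/
theorem isSpin_exp_bivector {x : Matrix (Fin (2 * n)) (Fin (2 * n)) ℝ} (hx : x.transpose = -x) :
    IsSpin (NormedSpace.exp (bivector x)) (NormedSpace.exp ((4 : ℝ) • x)) := by
  open scoped Matrix.Norms.L2Operator in
  have h1 := fun μ => exp_mul_eq_sum_exp_mul (X := (bivector x : QOp n)) (c := jw)
    (bivector_commutator hx) μ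
  refine IsSpin.exp h1 ?_ ?_
  · simp only [bivector, Matrix.conjTranspose_sum, Matrix.conjTranspose_smul,
      jw_mul_jw_conjTranspose, star_trivial]
    rw [Finset.sum_comm, ← Finset.sum_neg_distrib]
    refine Finset.sum_congr rfl fun μ _ => ?_
    rw [← Finset.sum_neg_distrib]
    refine Finset.sum_congr rfl fun ν _ => ?_
    have := congrFun (congrFun hx μ) ν
    simp only [Matrix.transpose_apply, Matrix.neg_apply] at this
    rw [this, neg_smul]
  · have : (bivector x : QOp n).map (starRingEnd ℂ) =
        ∑ μ, ∑ ν, x μ ν • (jw μ * jw ν : QOp n).map (starRingEnd ℂ) := by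
      ext i j
      simp [bivector, Matrix.sum_apply, -Matrix.map_mul]
    rw [this, bivector]
    simp only [Finset.mul_sum, Finset.sum_mul, mul_smul_comm, smul_mul_assoc,
      conjOp_mul_conj_jw_mul_jw]

/-! ### Rotations in the plane of two neighbouring generators -/

section Rotation

variable {μ ν : Fin (2 * n)}

theorem jw_mul_jw_sq (h : μ ≠ ν) : (jw μ * jw ν : QOp n) * (jw μ * jw ν) = -1 := by
  rw [mul_assoc, ← mul_assoc (jw ν), jw_anticomm h.symm, neg_mul, mul_neg, mul_assoc, jw_sq,
    mul_one, jw_sq]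

/-- The rotation by the angle `ψ` in the plane of two generators. -/
def rotOp (μ ν : Fin (2 * n)) (ψ : ℝ) : QOp n :=
  NormedSpace.exp ((-(ψ / 2)) • (jw μ * jw ν))

theorem rotOp_eq (h : μ ≠ ν) (ψ : ℝ) : rotOp μ ν ψ =
    Real.cos (ψ / 2) • (1 : QOp n) - Real.sin (ψ / 2) • (jw μ * jw ν) := by
  rw [rotOp, exp_smul_of_mul_self_eq_neg_one (jw_mul_jw_sq h), Real.cos_neg, Real.sin_neg,
    neg_smul, sub_eq_add_neg]

/-- Conjugation multiplies by the operator and by its inverse, so the half angle in `rotOp` turns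
into the full angle `ψ` through the double angle formulas. All other generators anticommute with
both factors and hence commute with their product. -/
theorem isSpin_rotOp {p : ℕ} (hp : p + 1 < 2 * n) (ψ : ℝ) :
    IsSpin (rotOp ⟨p, by omega⟩ ⟨p + 1, hp⟩ ψ : QOp n) (givens (2 * n) p ψ) := by
  set μ : Fin (2 * n) := ⟨p, by omega⟩ with hμ
  set ν : Fin (2 * n) := ⟨p + 1, hp⟩ with hν
  have hne : μ ≠ ν := by simp [hμ, hν]
  have hcos : Real.cos ψ = Real.cos (ψ / 2) * Real.cos (ψ / 2) -
      Real.sin (ψ / 2) * Real.sin (ψ / 2) := by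
    rw [← Real.cos_add]; congr 1; ring
  have hsin : Real.sin ψ = 2 * (Real.sin (ψ / 2) * Real.cos (ψ / 2)) := by
    rw [← mul_assoc, ← Real.sin_two_mul]; congr 1; ring
  have hone := Real.sin_sq_add_cos_sq (ψ / 2)
  refine IsSpin.exp (fun j => ?_) ?_ ?_
  · change rotOp μ ν ψ * jw j = _ * rotOp μ ν ψ
    rw [rotOp_eq hne]
    set C := Real.cos (ψ / 2)
    set S := Real.sin (ψ / 2)
    have b1 : (jw μ * jw ν : QOp n) * jw μ = -jw ν := by
      rw [mul_assoc, jw_anticomm hne.symm, mul_neg, ← mul_assoc, jw_sq, one_mul]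
    have b2 : (jw μ * jw ν : QOp n) * jw ν = jw μ := by rw [mul_assoc, jw_sq, mul_one]
    have b3 : (jw μ : QOp n) * (jw μ * jw ν) = jw ν := by rw [← mul_assoc, jw_sq, one_mul]
    have b4 : (jw ν : QOp n) * (jw μ * jw ν) = -jw μ := by
      rw [← mul_assoc, jw_anticomm hne.symm, neg_mul, mul_assoc, jw_sq, mul_one]
    have hcol : ∀ (f : Fin (2 * n) → ℝ), (∀ l, l ≠ μ → l ≠ ν → f l = 0) →
        ∑ l, f l • (jw l : QOp n) = f μ • jw μ + f ν • jw ν := by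
      intro f hf
      rw [← Finset.sum_pair (f := fun l => f l • (jw l : QOp n)) hne]
      symm
      refine Finset.sum_subset (Finset.subset_univ _) fun l _ hl => ?_
      simp only [Finset.mem_insert, Finset.mem_singleton, not_or] at hl
      rw [hf l hl.1 hl.2, zero_smul]
    by_cases h1 : j = μ
    · have g : ∑ l, givens (2 * n) p ψ l j • (jw l : QOp n) =
          Real.cos ψ • jw μ + Real.sin ψ • jw ν := by
        subst h1
        rw [hcol]
        · simp [givens, toMat, rotRows, hμ, hν]
        · intro l hl1 hl2
          have e1 : (l : ℕ) ≠ p := fun he => hl1 (Fin.ext he)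
          have e2 : (l : ℕ) ≠ p + 1 := fun he => hl2 (Fin.ext he)
          simp [givens, toMat, rotRows, hμ, e1, e2]
      rw [g, h1, hcos, hsin]
      simp only [sub_mul, mul_sub, add_mul, smul_mul_assoc, mul_smul_comm, one_mul, mul_one, b1, b3,
        b4, smul_neg]
      -- Multiplying by `S ^ 2 + C ^ 2 = 1` makes both sides cubic in `C` and `S`; the identity then
      -- holds coefficientwise.
      have : (C • jw μ : QOp n) - -(S • jw ν) = (C * (S ^ 2 + C ^ 2)) • jw μ +
          (S * (S ^ 2 + C ^ 2)) • jw ν := by rw [hone]; simp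
      rw [this]
      module
    · by_cases h2 : j = ν
      · have g : ∑ l, givens (2 * n) p ψ l j • (jw l : QOp n) =
            (-Real.sin ψ) • jw μ + Real.cos ψ • jw ν := by
          subst h2
          rw [hcol]
          · simp [givens, toMat, rotRows, hμ, hν]
          · intro l hl1 hl2
            have e1 : (l : ℕ) ≠ p := fun he => hl1 (Fin.ext he)
            have e2 : (l : ℕ) ≠ p + 1 := fun he => hl2 (Fin.ext he)
            simp [givens, toMat, rotRows, hν, e1, e2]
        rw [g, h2, hcos, hsin]
        simp only [sub_mul, mul_sub, add_mul, smul_mul_assoc, mul_smul_comm, one_mul, mul_one, b2,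
          b3, b4, smul_neg]
        have : (C • jw ν : QOp n) - S • jw μ = (C * (S ^ 2 + C ^ 2)) • jw ν -
            (S * (S ^ 2 + C ^ 2)) • jw μ := by rw [hone]; simp
        rw [this]
        module
      · have e1 : (j : ℕ) ≠ p := fun he => h1 (Fin.ext he)
        have e2 : (j : ℕ) ≠ p + 1 := fun he => h2 (Fin.ext he)
        have g : ∑ l, givens (2 * n) p ψ l j • (jw l : QOp n) = jw j := by
          rw [Finset.sum_eq_single j]
          · simp [givens, toMat, rotRows, e1, e2]
          · intro l _ hl
            have e3 : (l : ℕ) ≠ j := fun he => hl (Fin.ext he)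
            have : givens (2 * n) p ψ l j = 0 := by
              simp only [givens, toMat, rotRows, Matrix.of_apply, e1.symm, e2.symm, e3, if_false]
              simp
            rw [this, zero_smul]
          · simp
        rw [g, sub_mul, mul_sub, smul_mul_assoc, smul_mul_assoc, one_mul, mul_smul_comm,
          mul_smul_comm, mul_one]
        congr 2
        rw [mul_assoc, jw_anticomm (Ne.symm h2), mul_neg, ← mul_assoc, jw_anticomm (Ne.symm h1),
          neg_mul, neg_neg, mul_assoc]
  · rw [Matrix.conjTranspose_smul, jw_mul_jw_conjTranspose, jw_anticomm hne.symm, star_trivial,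
      smul_neg]
  · have : ((-(ψ / 2)) • (jw μ * jw ν : QOp n)).map (starRingEnd ℂ) =
        (-(ψ / 2)) • (jw μ * jw ν : QOp n).map (starRingEnd ℂ) := by
      ext i j
      simp only [Matrix.map_apply, Matrix.smul_apply, Complex.real_smul, map_mul,
        Complex.conj_ofReal]
    rw [this, mul_smul_comm, conjOp_mul_conj_jw_mul_jw, smul_mul_assoc]

end Rotation

end

noncomputable section

variable {n : ℕ}

/-! ### Gates that rotate two neighbouring generators -/

open scoped Kronecker

/-- The two-qubit operator `P ⊗ Q`. -/
def kronOp (P Q : Matrix (Fin 2) (Fin 2) ℂ) : Matrix (Fin 4) (Fin 4) ℂ :=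
  Matrix.reindex finProdFinEquiv finProdFinEquiv (P ⊗ₖ Q)

theorem productOp_eq_onLines {k : ℕ} (hk : k + 1 < n) (P Q : Matrix (Fin 2) (Fin 2) ℂ) :
    productOp (fun i : Fin n => if (i : ℕ) = k then P else if (i : ℕ) = k + 1 then Q else 1) =
      onLines k hk (kronOp P Q) := by
  ext x y
  simp only [productOp, onLines, Matrix.of_apply]
  split_ifs with h
  · rw [Fintype.prod_eq_mul (⟨k, by omega⟩ : Fin n) ⟨k + 1, hk⟩]
    · simp [kronOp]
    · simp
    · rintro i ⟨h1, h2⟩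
      have h1 : (i : ℕ) ≠ k := fun e => h1 (Fin.ext e)
      have h2 : (i : ℕ) ≠ k + 1 := fun e => h2 (Fin.ext e)
      rw [if_neg h1, if_neg h2, h i h1 h2, Matrix.one_apply_eq]
  · push Not at h
    obtain ⟨i, h1, h2, h3⟩ := h
    refine Finset.prod_eq_zero (Finset.mem_univ i) ?_
    rw [if_neg h1, if_neg h2, Matrix.one_apply_ne h3]

theorem onLines_one {k : ℕ} (hk : k + 1 < n) : onLines k hk 1 = 1 := by
  have h1 : kronOp 1 1 = 1 := by
    simp [kronOp]
  rw [← h1, ← productOp_eq_onLines hk, ← productOp_one]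
  simp

theorem onLines_smul_sub_smul {k : ℕ} (hk : k + 1 < n) (c s : ℝ) (M : Matrix (Fin 4) (Fin 4) ℂ) :
    c • (1 : QOp n) - s • onLines k hk M = onLines k hk (c • 1 - s • M) := by
  rw [← onLines_one hk]
  ext x y
  simp only [onLines, Matrix.sub_apply, Matrix.smul_apply, Matrix.of_apply]
  split_ifs <;> simp

theorem jw_mul_jw_first {k : ℕ} (hk : k + 1 < n) :
    (jw ⟨2 * k, by omega⟩ : QOp n) * jw ⟨2 * k + 1, by omega⟩ =
      onLines k hk (kronOp (Complex.I • pauliZ) 1) := by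
  rw [jw_even_mul_jw_odd (by omega), ← productOp_eq_onLines]
  simp

theorem jw_mul_jw_third {k : ℕ} (hk : k + 1 < n) :
    (jw ⟨2 * k + 2, by omega⟩ : QOp n) * jw ⟨2 * k + 3, by omega⟩ =
      onLines k hk (kronOp 1 (Complex.I • pauliZ)) := by
  have := jw_even_mul_jw_odd (n := n) (k := k + 1) hk
  rw [← productOp_eq_onLines]
  refine this.trans ?_
  congr 1
  funext i
  split_ifs <;> first | rfl | omega

theorem pauliY_mul_pauliZ_eq : pauliY * pauliZ = Complex.I • pauliX := by
  ext i j; fin_cases i <;> fin_cases j <;> simp [pauliX, pauliY, pauliZ]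

/-- The strings of `Z` cancel before line `k`. Line `k` is left with `Y Z = i X`, and line `k + 1`
with `X`. -/
theorem jw_mul_jw_second {k : ℕ} (hk : k + 1 < n) :
    (jw ⟨2 * k + 1, by omega⟩ : QOp n) * jw ⟨2 * k + 2, by omega⟩ =
      onLines k hk (kronOp (Complex.I • pauliX) pauliX) := by
  rw [← productOp_eq_onLines, jw_eq, jw_eq, productOp_mul]
  congr 1
  funext i
  have e1 : (2 * k + 1) / 2 = k := by omega
  have e2 : (2 * k + 2) / 2 = k + 1 := by omega
  have e3 : (2 * k + 1) % 2 ≠ 0 := by omega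
  have e4 : (2 * k + 2) % 2 = 0 := by omega
  simp only [jwFactor, e1, e2, if_neg e3, if_pos e4]
  split_ifs <;> first | omega | simp [pauliZ_sq, pauliY_mul_pauliZ_eq]

/-- The coefficients of a rotation by the angle `ψ` in the plane of the generators `a` and `a + 1`
out of the four generators of two lines. -/
def planeCoeff (a : ℕ) (ψ : ℝ) : Matrix (Fin 4) (Fin 4) ℝ :=
  -- The two entries `ψ / 4` and `-(ψ / 4)` give `H = i (ψ / 2) c c'`, so that `e^{iH} = exp (-(ψ /
  -- 2) c c')`, which is `rotOp`.
  Matrix.of fun i j => if (i : ℕ) = a ∧ (j : ℕ) = a + 1 then ψ / 4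
    else if (i : ℕ) = a + 1 ∧ (j : ℕ) = a then -(ψ / 4) else 0

theorem planeCoeff_transpose (a : ℕ) (ψ : ℝ) :
    (planeCoeff a ψ).transpose = -planeCoeff a ψ := by
  ext i j
  simp only [planeCoeff, Matrix.transpose_apply, Matrix.of_apply, Matrix.neg_apply]
  split_ifs <;> first | omega | simp

/-- The first line of a gate that rotates the generators `p` and `p + 1`. -/
def rotLine (n p : ℕ) : ℕ := min (p / 2) (n - 2)

/-- The gate that rotates the generators `p` and `p + 1` by the angle `ψ`. -/
def rotGate (hn : 2 ≤ n) (p : ℕ) (ψ : ℝ) : NNGate n where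
  line := rotLine n p
  line_lt := by unfold rotLine; omega
  -- The offset is `0` or `1`, except for `p = 2 n - 2`: there both generators lie on the last line,
  -- which must be the second line of the gate, and the offset is `2`.
  coeff := planeCoeff (p - 2 * rotLine n p) ψ
  coeff_antisymm := planeCoeff_transpose _ _

theorem sum_planeCoeff {A : Type*} [Ring A] [Algebra ℂ A] {a : ℕ} (ha : a + 1 < 4) (ψ : ℝ)
    (f : Fin 4 → A) (hf : ∀ i j, i ≠ j → f i * f j = -(f j * f i)) :
    ∑ i, ∑ j, (planeCoeff a ψ i j : ℂ) • (f i * f j) =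
      ((ψ / 2 : ℝ) : ℂ) • (f ⟨a, by omega⟩ * f ⟨a + 1, ha⟩) := by
  set i : Fin 4 := ⟨a, by omega⟩ with hi
  set j : Fin 4 := ⟨a + 1, ha⟩ with hj
  have hij : i ≠ j := by simp [hi, hj]
  rw [Fintype.sum_eq_add i j hij, Finset.sum_eq_single j, Finset.sum_eq_single i, hf j i hij.symm]
  · have e1 : planeCoeff a ψ i j = ψ / 4 := by simp [planeCoeff, hi, hj]
    have e2 : planeCoeff a ψ j i = -(ψ / 4) := by simp [planeCoeff, hi, hj]
    rw [e1, e2, smul_neg, ← neg_smul, ← add_smul]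
    congr 1
    push_cast
    ring
  · intro l _ hl
    have : (l : ℕ) ≠ a := fun e => hl (Fin.ext e)
    simp [planeCoeff, hj, this]
  · simp
  · intro l _ hl
    have : (l : ℕ) ≠ a + 1 := fun e => hl (Fin.ext e)
    simp [planeCoeff, hi, this]
  · simp
  · rintro l ⟨h1, h2⟩
    have h1 : (l : ℕ) ≠ a := fun e => h1 (Fin.ext e)
    have h2 : (l : ℕ) ≠ a + 1 := fun e => h2 (Fin.ext e)
    exact Finset.sum_eq_zero fun m _ => by simp [planeCoeff, h1, h2]

theorem rotGate_op (hn : 2 ≤ n) {p : ℕ} (hp : p + 1 < 2 * n) (ψ : ℝ) :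
    (rotGate hn p ψ).op = rotOp ⟨p, by omega⟩ ⟨p + 1, hp⟩ ψ := by
  have ha : p - 2 * rotLine n p + 1 < 4 := by unfold rotLine; omega
  have hle : 2 * rotLine n p ≤ p := by unfold rotLine; omega
  rw [NNGate.op, expI, NNGate.ham, rotOp]
  congr 1
  have := sum_planeCoeff ha ψ (rotGate hn p ψ).gen fun i j hij => jw_anticomm (by
    simp only [ne_eq, Fin.mk.injEq]
    have := Fin.val_ne_of_ne hij
    omega)
  rw [show (rotGate hn p ψ).coeff = planeCoeff (p - 2 * rotLine n p) ψ from rfl, this, smul_smul,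
    smul_smul, mul_comm, ← mul_assoc]
  have g1 : (rotGate hn p ψ).gen ⟨p - 2 * rotLine n p, by omega⟩ = jw ⟨p, by omega⟩ := by
    unfold NNGate.gen
    congr 2
    exact Nat.add_sub_cancel' hle
  have g2 : (rotGate hn p ψ).gen ⟨p - 2 * rotLine n p + 1, ha⟩ = jw ⟨p + 1, hp⟩ := by
    unfold NNGate.gen
    congr 2
    exact (Nat.add_assoc _ _ _).symm.trans (by simp only [rotGate]; omega)
  rw [g1, g2]
  ext x y
  simp only [Matrix.smul_apply, Complex.real_smul, smul_eq_mul]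
  push_cast
  linear_combination (ψ / 2 * (jw ⟨p, by omega⟩ * jw ⟨p + 1, hp⟩ : QOp n) x y) * Complex.I_mul_I

theorem kronOp_eq (P Q : Matrix (Fin 2) (Fin 2) ℂ) : kronOp P Q =
    !![P 0 0 * Q 0 0, P 0 0 * Q 0 1, P 0 1 * Q 0 0, P 0 1 * Q 0 1;
       P 0 0 * Q 1 0, P 0 0 * Q 1 1, P 0 1 * Q 1 0, P 0 1 * Q 1 1;
       P 1 0 * Q 0 0, P 1 0 * Q 0 1, P 1 1 * Q 0 0, P 1 1 * Q 0 1;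
       P 1 0 * Q 1 0, P 1 0 * Q 1 1, P 1 1 * Q 1 0, P 1 1 * Q 1 1] := by
  ext i j
  fin_cases i <;> fin_cases j <;> rfl

/-- On its two lines the product of the generators is `i Z ⊗ 1`, `i X ⊗ X` or `1 ⊗ i Z`. Each
preserves the span of `00, 11` and that of `01, 10`. The two blocks of the gate coincide in the
first two cases and differ by an exchange of the diagonal entries in the third, so their
determinants agree. -/
theorem rotGate_isG (hn : 2 ≤ n) {p : ℕ} (hp : p + 1 < 2 * n) (ψ : ℝ) :
    (rotGate hn p ψ).IsG := by
  have hone := Real.sin_sq_add_cos_sq (ψ / 2)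
  have hop := rotGate_op hn hp ψ
  rw [rotOp_eq (by simp)] at hop
  obtain ⟨k, hk⟩ : ∃ k, rotLine n p = k := ⟨_, rfl⟩
  have hk1 : k + 1 < n := by rw [← hk]; unfold rotLine; omega
  have hline : ∀ M, onLines (rotGate hn p ψ).line (rotGate hn p ψ).line_lt M =
      onLines k hk1 M := fun M => by congr 1
  set c := Real.cos (ψ / 2)
  set s := Real.sin (ψ / 2)
  have honeC : (s : ℂ) * s + c * c = 1 := by
    rw [← sq, ← sq]; exact_mod_cast hone
  have key : ∃ A B : Matrix (Fin 2) (Fin 2) ℂ, Allowable A B ∧ ∃ M,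
      (jw ⟨p, by omega⟩ * jw ⟨p + 1, hp⟩ : QOp n) = onLines k hk1 M ∧
      c • 1 - s • M = gMatrix A B := by
    have hcase : p = 2 * k ∨ p = 2 * k + 1 ∨ p = 2 * k + 2 := by
      rw [← hk]; unfold rotLine; omega
    have hdiag : ∀ z : ℂ, star z * z = 1 → ∀ w : ℂ, star w * w = 1 →
        !![z, 0; 0, w] ∈ Matrix.unitaryGroup (Fin 2) ℂ := by
      intro z hz w hw
      rw [Matrix.mem_unitaryGroup_iff']
      ext i j
      fin_cases i <;> fin_cases j <;>
        simp [Matrix.mul_apply, Matrix.star_apply] <;> assumption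
    have n1 : star ((c : ℂ) - s * Complex.I) * (c - s * Complex.I) = 1 := by
      simp
      linear_combination honeC - (s : ℂ) * s * Complex.I_mul_I
    have n2 : star ((c : ℂ) + s * Complex.I) * (c + s * Complex.I) = 1 := by
      simp
      linear_combination honeC - (s : ℂ) * s * Complex.I_mul_I
    rcases hcase with rfl | rfl | rfl
    · refine ⟨!![c - s * Complex.I, 0; 0, c + s * Complex.I],
        !![c - s * Complex.I, 0; 0, c + s * Complex.I],
        ⟨hdiag _ n1 _ n2, hdiag _ n1 _ n2, rfl⟩, _, jw_mul_jw_first hk1, ?_⟩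
      rw [kronOp_eq]
      ext i j
      fin_cases i <;> fin_cases j <;> simp [gMatrix, pauliZ]
    · have hU : !![(c : ℂ), -(s * Complex.I); -(s * Complex.I), (c : ℂ)] ∈
          Matrix.unitaryGroup (Fin 2) ℂ := by
        rw [Matrix.mem_unitaryGroup_iff']
        ext i j
        fin_cases i <;> fin_cases j <;> simp [Matrix.mul_apply, Matrix.star_apply]
        · linear_combination honeC - (s : ℂ) * s * Complex.I_mul_I
        · ring
        · ring
        · linear_combination honeC - (s : ℂ) * s * Complex.I_mul_I
      refine ⟨_, _, ⟨hU, hU, rfl⟩, _, jw_mul_jw_second hk1, ?_⟩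
      rw [kronOp_eq]
      ext i j
      fin_cases i <;> fin_cases j <;> simp [gMatrix, pauliX]
    · refine ⟨!![c - s * Complex.I, 0; 0, c + s * Complex.I],
        !![c + s * Complex.I, 0; 0, c - s * Complex.I],
        ⟨hdiag _ n1 _ n2, hdiag _ n2 _ n1, by simp [Matrix.det_fin_two, mul_comm]⟩, _,
        jw_mul_jw_third hk1, ?_⟩
      rw [kronOp_eq]
      ext i j
      fin_cases i <;> fin_cases j <;> simp [gMatrix, pauliZ]
  obtain ⟨A, B, hAB, M, h1, h2⟩ := key
  refine ⟨A, B, hAB, ?_⟩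
  rw [hline, hop, h1, onLines_smul_sub_smul, h2]

/-! ### Quadratic Hamiltonians -/

theorem quadraticOp_ofReal {x : Matrix (Fin (2 * n)) (Fin (2 * n)) ℝ} (hx : x.transpose = -x) :
    quadraticOp (x.map Complex.ofReal) = Complex.I • (bivector x : QOp n) := by
  unfold quadraticOp bivector
  congr 1
  refine Finset.sum_congr rfl fun μ _ => Finset.sum_congr rfl fun ν _ => ?_
  split_ifs with h
  · subst h
    have := congrFun (congrFun hx μ) μ
    simp only [Matrix.transpose_apply, Matrix.neg_apply] at this
    rw [show x μ μ = 0 by linarith, zero_smul]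
  · ext i j; simp

theorem quadraticOp_add (g h : Matrix (Fin (2 * n)) (Fin (2 * n)) ℂ) :
    quadraticOp (g + h) = (quadraticOp g + quadraticOp h : QOp n) := by
  unfold quadraticOp
  rw [← smul_add, ← Finset.sum_add_distrib]
  congr 1
  refine Finset.sum_congr rfl fun μ _ => ?_
  rw [← Finset.sum_add_distrib]
  refine Finset.sum_congr rfl fun ν _ => ?_
  split_ifs <;> simp [add_smul]

theorem quadraticOp_smul (z : ℂ) (h : Matrix (Fin (2 * n)) (Fin (2 * n)) ℂ) :
    quadraticOp (z • h) = (z • quadraticOp h : QOp n) := by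
  unfold quadraticOp
  rw [smul_comm z]
  congr 1
  rw [Finset.smul_sum]
  refine Finset.sum_congr rfl fun μ _ => ?_
  rw [Finset.smul_sum]
  refine Finset.sum_congr rfl fun ν _ => ?_
  split_ifs <;> simp [smul_smul]

theorem quadraticOp_neg_transpose (h : Matrix (Fin (2 * n)) (Fin (2 * n)) ℂ) :
    quadraticOp (-h.transpose) = (quadraticOp h : QOp n) := by
  unfold quadraticOp
  congr 1
  trans
  · exact Finset.sum_comm
  refine Finset.sum_congr rfl fun μ _ => Finset.sum_congr rfl fun ν _ => ?_
  by_cases h1 : μ = ν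
  · simp [h1]
  · rw [if_neg h1, if_neg (Ne.symm h1), jw_anticomm h1]
    simp

theorem quadraticOp_conjTranspose (h : Matrix (Fin (2 * n)) (Fin (2 * n)) ℂ) :
    (quadraticOp h : QOp n).conjTranspose = quadraticOp (h.map (starRingEnd ℂ)) := by
  unfold quadraticOp
  rw [Matrix.conjTranspose_smul, Matrix.conjTranspose_sum, Complex.star_def, Complex.conj_I,
    neg_smul, ← smul_neg, ← Finset.sum_neg_distrib]
  congr 1
  refine Finset.sum_congr rfl fun μ _ => ?_
  rw [Matrix.conjTranspose_sum, ← Finset.sum_neg_distrib]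
  refine Finset.sum_congr rfl fun ν _ => ?_
  split_ifs with h1
  · simp
  · rw [Matrix.conjTranspose_smul, jw_mul_jw_conjTranspose, jw_anticomm (Ne.symm h1)]
    simp

/-- Antisymmetrizing the coefficients does not change `H` because different generators anticommute,
and averaging them with their conjugates does not because `H` is hermitian. -/
theorem IsQuadraticHamiltonian.exists_real {H : QOp n} (hH : IsQuadraticHamiltonian H) :
    ∃ x : Matrix (Fin (2 * n)) (Fin (2 * n)) ℝ, x.transpose = -x ∧
      H = quadraticOp (x.map Complex.ofReal) := by
  obtain ⟨hherm, h, rfl⟩ := hH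
  refine ⟨Matrix.of fun μ ν => ((h μ ν).re - (h ν μ).re) / 2, ?_, ?_⟩
  · ext μ ν
    simp only [Matrix.transpose_apply, Matrix.of_apply, Matrix.neg_apply]
    ring
  · have h1 : quadraticOp (h.map (starRingEnd ℂ)) = (quadraticOp h : QOp n) := by
      rw [← quadraticOp_conjTranspose]; exact hherm
    have h2 := quadraticOp_neg_transpose h
    have h3 := quadraticOp_neg_transpose (h.map (starRingEnd ℂ))
    have h4 : (Matrix.of fun μ ν => ((h μ ν).re - (h ν μ).re) / 2).map Complex.ofReal =
        (1 / 4 : ℂ) • (h + h.map (starRingEnd ℂ) + -h.transpose +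
          -(h.map (starRingEnd ℂ)).transpose) := by
      ext μ ν
      simp only [Matrix.map_apply, Matrix.of_apply, Matrix.smul_apply, Matrix.add_apply,
        Matrix.neg_apply, Matrix.transpose_apply, smul_eq_mul]
      push_cast
      rw [Complex.re_eq_add_conj, Complex.re_eq_add_conj]
      ring
    rw [h4, quadraticOp_smul, quadraticOp_add, quadraticOp_add, quadraticOp_add, h3, h2, h1]
    module

/-- The commutators with the linearly independent generators determine the coefficients. -/
theorem bivector_injective {x y : Matrix (Fin (2 * n)) (Fin (2 * n)) ℝ} (hx : x.transpose = -x)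
    (hy : y.transpose = -y) (h : (bivector x : QOp n) = bivector y) : x = y := by
  ext μ j
  have h1 := bivector_commutator hx j
  rw [h, bivector_commutator hy j] at h1
  have h2 := add_left_cancel h1
  have h3 : ∑ l, ((4 * (y l j - x l j) : ℝ) : ℂ) • (jw l : QOp n) = 0 := by
    rw [← sub_eq_zero, ← Finset.sum_sub_distrib] at h2
    rw [← h2]
    refine Finset.sum_congr rfl fun l _ => ?_
    rw [← sub_smul]
    ext i k
    simp only [Matrix.smul_apply, Complex.real_smul, smul_eq_mul]
    congr 1
    push_cast
    ring
  have h4 := jw_coeff_eq_zero h3 μ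
  have h5 : 4 * (y μ j - x μ j) = 0 := by exact_mod_cast h4
  linarith

open Classical in
/-- The real antisymmetric coefficients of a quadratic Hamiltonian. -/
def realCoeff (H : QOp n) : Matrix (Fin (2 * n)) (Fin (2 * n)) ℝ :=
  if h : ∃ x : Matrix (Fin (2 * n)) (Fin (2 * n)) ℝ, x.transpose = -x ∧
      H = quadraticOp (x.map Complex.ofReal) then h.choose else 0

theorem IsQuadraticHamiltonian.realCoeff_spec {H : QOp n} (hH : IsQuadraticHamiltonian H) :
    (realCoeff H).transpose = -realCoeff H ∧ H = Complex.I • bivector (realCoeff H) := by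
  have h := hH.exists_real
  rw [realCoeff, dif_pos h]
  refine ⟨h.choose_spec.1, ?_⟩
  rw [← quadraticOp_ofReal h.choose_spec.1]
  exact h.choose_spec.2

/-- The arbitrary choice in `realCoeff` is harmless: the circuit depends on the operator alone and
can still be computed from the given matrix. -/
theorem realCoeff_quadraticOp {x : Matrix (Fin (2 * n)) (Fin (2 * n)) ℝ} (hx : x.transpose = -x) :
    realCoeff (quadraticOp (x.map Complex.ofReal) : QOp n) = x := by
  have h : ∃ y : Matrix (Fin (2 * n)) (Fin (2 * n)) ℝ, y.transpose = -y ∧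
      (quadraticOp (x.map Complex.ofReal) : QOp n) = quadraticOp (y.map Complex.ofReal) :=
    ⟨x, hx, rfl⟩
  rw [realCoeff, dif_pos h]
  refine (bivector_injective hx h.choose_spec.1 ?_).symm
  have h2 := (quadraticOp_ofReal hx).symm.trans
    (h.choose_spec.2.trans (quadraticOp_ofReal h.choose_spec.1))
  have h3 := congrArg (fun M => (-Complex.I) • M) h2
  simpa [smul_smul] using h3

/-! ### The operation of the eliminating circuit -/

theorem circuitOp_append_singleton (l : List (NNGate n)) (g : NNGate n) :
    circuitOp (l ++ [g]) = g.op * circuitOp l := by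
  simp [circuitOp]

theorem circuitOp_append (l l' : List (NNGate n)) :
    circuitOp (l ++ l') = circuitOp l' * circuitOp l := by
  simp [circuitOp]

/-- The gates of the first `t` steps of the elimination. -/
def elimGates (hn : 2 ≤ n) (D : ℕ → ℤ × ℤ × ℤ) (X : ℕ → ℕ → ℝ) (t : ℕ) : List (NNGate n) :=
  (List.range t).map fun i => rotGate hn ((elimPos (2 * n) i).row - 1)
    (realAngle (2 * n) D i (realElim (2 * n) D X i))

theorem elimPos_row_lt {N t : ℕ} (hN : 2 ≤ N) (ht : t < N * (N - 1)) :
    (elimPos N t).row - 1 + 1 < N := by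
  obtain ⟨-, h2, h3, h4⟩ := elimPos_valid hN ht.le
  have := h4 ht
  omega

theorem isSpin_elimGates (hn : 2 ≤ n) (D : ℕ → ℤ × ℤ × ℤ) (X : ℕ → ℕ → ℝ) {t : ℕ}
    (ht : t ≤ 2 * n * (2 * n - 1)) : ∃ R, IsSpin (circuitOp (elimGates hn D X t)) R ∧
      R * toMat (2 * n) X = toMat (2 * n) (realElim (2 * n) D X t) := by
  induction t with
  | zero => exact ⟨1, by simpa [circuitOp, elimGates] using IsSpin.one, by simp [realElim]⟩
  | succ t ih =>
    obtain ⟨R, h1, h2⟩ := ih (by omega)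
    have hp := elimPos_row_lt (N := 2 * n) (t := t) (by omega) (by omega)
    refine ⟨givens (2 * n) ((elimPos (2 * n) t).row - 1)
      (realAngle (2 * n) D t (realElim (2 * n) D X t)) * R, ?_, ?_⟩
    · rw [elimGates, List.range_succ, List.map_append, List.map_singleton,
        circuitOp_append_singleton, rotGate_op hn hp]
      exact (isSpin_rotOp hp _).mul h1
    · rw [Matrix.mul_assoc, h2, ← toMat_rotRows hp]
      rfl

/-- The half circuit rotates the generators by the inverse of `exp (2 x)`, and so does `V = exp
(bivector (-x / 2))`. The half circuit equals `V` up to a sign, which disappears in the square `V *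
V = exp (-bivector x)`. -/
theorem circuitOp_elimGates_append_self (hn : 2 ≤ n) {D : ℕ → ℤ × ℤ × ℤ} {X : ℕ → ℕ → ℝ}
    {x : Matrix (Fin (2 * n)) (Fin (2 * n)) ℝ} (hx : x.transpose = -x)
    (hX : toMat (2 * n) X = NormedSpace.exp ((2 : ℝ) • x))
    (hD : toMat (2 * n) (realElim (2 * n) D X (2 * n * (2 * n - 1))) = 1) :
    circuitOp (elimGates hn D X (2 * n * (2 * n - 1)) ++ elimGates hn D X (2 * n * (2 * n - 1))) =
      expI (Complex.I • bivector x : QOp n) := by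
  obtain ⟨R, h1, h2⟩ := isSpin_elimGates hn D X le_rfl
  have hx' : ((-(1 / 2 : ℝ)) • x).transpose = -((-(1 / 2 : ℝ)) • x) := by
    rw [Matrix.transpose_smul, hx, smul_neg]
  have h3 := isSpin_exp_bivector hx'
  have e1 : (4 : ℝ) • ((-(1 / 2 : ℝ)) • x) = -((2 : ℝ) • x) := by module
  have e2 : R = NormedSpace.exp (-((2 : ℝ) • x)) := by
    rw [hD, hX] at h2
    have e3 : NormedSpace.exp ((2 : ℝ) • x) * NormedSpace.exp (-((2 : ℝ) • x)) = 1 := by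
      rw [← Matrix.exp_add_of_commute _ _ (Commute.refl ((2 : ℝ) • x)).neg_right, add_neg_cancel,
        NormedSpace.exp_zero]
    rw [← Matrix.mul_one R, ← e3, ← Matrix.mul_assoc, h2, Matrix.one_mul]
  rw [e1, ← e2] at h3
  rw [circuitOp_append, h1.mul_self_eq h3, expI, ← Matrix.exp_add_of_commute _ _ (Commute.refl _)]
  congr 1
  have e4 : (bivector ((-(1 / 2 : ℝ)) • x) : QOp n) = (-(1 / 2 : ℝ)) • bivector x := by
    simp [bivector, Finset.smul_sum, smul_smul]
  rw [e4, smul_smul, Complex.I_mul_I, ← add_smul]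
  norm_num

end

noncomputable section

/-! ### The circuit of a quadratic Hamiltonian -/

/-- The entries of a matrix, extended by `0`. -/
def Matrix.entries {N : ℕ} {α : Type*} [Zero α] (M : Matrix (Fin N) (Fin N) α) (r l : ℕ) : α :=
  if h : r < N ∧ l < N then M ⟨r, h.1⟩ ⟨l, h.2⟩ else 0

theorem Matrix.entries_apply {N : ℕ} {α : Type*} [Zero α] (M : Matrix (Fin N) (Fin N) α) {r l : ℕ}
    (hr : r < N) (hl : l < N) : M.entries r l = M ⟨r, hr⟩ ⟨l, hl⟩ := dif_pos ⟨hr, hl⟩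

theorem toMat_entries {N : ℕ} (M : Matrix (Fin N) (Fin N) ℝ) : toMat N M.entries = M := by
  ext r l
  simp [toMat, M.entries_apply r.2 l.2]

/-- The elimination with quarter turns read off from the current matrix: the matrix and the turns
made so far. -/
def selfElim (k N : ℕ) (Y : ℕ → ℕ → ℤ) : ℕ → (ℕ → ℕ → ℤ) × (ℕ → ℤ × ℤ × ℤ)
  | 0 => (Y, fun _ => (1, 0, 0))
  | t + 1 =>
    let Z := (selfElim k N Y t).1
    let D := Function.update (selfElim k N Y t).2 t
      (quarterTurn (Z ((elimPos N t).row - 1) (elimPos N t).col)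
        (Z (elimPos N t).row (elimPos N t).col))
    (fixRotRows k ((elimPos N t).row - 1) (fixAngle k N D t Z).2.1 (fixAngle k N D t Z).2.2 Z, D)

/-- The quarter turns in the elimination at the precision `k`. -/
def selfTurns (k N : ℕ) (Y : ℕ → ℕ → ℤ) (t : ℕ) : ℤ × ℤ × ℤ := (selfElim k N Y (t + 1)).2 t

theorem selfTurns_eq (k N : ℕ) (Y : ℕ → ℕ → ℤ) (t : ℕ) : selfTurns k N Y t =
    quarterTurn ((selfElim k N Y t).1 ((elimPos N t).row - 1) (elimPos N t).col)
        ((selfElim k N Y t).1 (elimPos N t).row (elimPos N t).col) := by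
  simp [selfTurns, selfElim]

theorem fixAngle_congr {k N t : ℕ} {D D' : ℕ → ℤ × ℤ × ℤ} (h : D t = D' t) (X : ℕ → ℕ → ℤ) :
    fixAngle k N D t X = fixAngle k N D' t X := by
  simp only [fixAngle, h]

theorem fixElim_selfTurns (k N : ℕ) (Y : ℕ → ℕ → ℤ) (t : ℕ) :
    fixElim k N (selfTurns k N Y) Y t = (selfElim k N Y t).1 := by
  induction t with
  | zero => rfl
  | succ t ih =>
    have h : fixAngle k N (selfTurns k N Y) t (selfElim k N Y t).1 =
        fixAngle k N (selfElim k N Y (t + 1)).2 t (selfElim k N Y t).1 := fixAngle_congr rfl _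
    simp only [fixElim, ih, h]
    rfl

theorem selfConsistent_selfTurns (k N : ℕ) (Y : ℕ → ℕ → ℤ) :
    SelfConsistent k N (selfTurns k N Y) Y := by
  intro t
  rw [fixElim_selfTurns, selfTurns_eq]

/-- An integer that is larger than the sum of the squares of the entries. -/
def normBound {N : ℕ} (x : Matrix (Fin N) (Fin N) ℝ) : ℕ := ⌊∑ r, ∑ l, x r l ^ 2⌋₊ + 1

theorem sum_sq_le_normBound {N : ℕ} (x : Matrix (Fin N) (Fin N) ℝ) :
    ∑ r, ∑ l, x r l ^ 2 ≤ (normBound x : ℝ) := by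
  unfold normBound
  push_cast
  exact (Nat.lt_floor_add_one _).le

/-- A precision at which the quarter turns can be chosen. -/
def basePrec {N : ℕ} (x : Matrix (Fin N) (Fin N) ℝ) : ℕ :=
  -- The factor `3` is due to `(3 / 4) ^ 3 ≤ 1 / 2`. The rest counts binary digits: the growth `(68
  -- N) ^ (N (N - 1))` is at most `2 ^ ((N + 7) N ^ 2)`, the additional `3 (N + 7)` pays for `480 N
  -- ^ 2` and the constants, and the last term for the size of `x`.
  3 * ((N + 7) * (N * N + 3) + (normBound x - 1).size)

theorem three_le_basePrec {N : ℕ} (x : Matrix (Fin N) (Fin N) ℝ) : 3 ≤ basePrec x := by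
  unfold basePrec
  nlinarith

theorem elimErr_basePrec_le {N : ℕ} (hN : 0 < N) (x : Matrix (Fin N) (Fin N) ℝ) :
    480 * N ^ 2 * elimErr (basePrec x) N (normBound x) (N * (N - 1)) ≤ 1 := by
  set b := (normBound x - 1).size with hb
  have hS : (normBound x : ℝ) ≤ 2 ^ b := by
    have h1 : normBound x - 1 < 2 ^ b := Nat.lt_size_self _
    have : normBound x ≤ 2 ^ b := by omega
    exact_mod_cast this
  have hS1 : (1 : ℝ) ≤ normBound x := by
    have : 1 ≤ normBound x := by unfold normBound; omega
    exact_mod_cast this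
  have hN1 : (1 : ℝ) ≤ N := by exact_mod_cast hN
  have hN2 : (N : ℝ) ≤ 2 ^ N := by exact_mod_cast Nat.lt_two_pow_self.le
  have h1 : ((3 : ℝ) / 4) ^ basePrec x ≤ (1 / 2) ^ ((N + 7) * (N * N + 3) + b) := by
    rw [basePrec, pow_mul]
    exact pow_le_pow_left₀ (by positivity) (by norm_num) _
  have h2 : cisErr (basePrec x) + expErr (basePrec x) N (normBound x) ≤
      2 ^ (7 + b + N) * (1 / 2) ^ ((N + 7) * (N * N + 3) + b) := by
    have e : cisErr (basePrec x) + expErr (basePrec x) N (normBound x) =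
      (67 + 4 * normBound x + 2 * N) * (3 / 4) ^ basePrec x := by unfold cisErr expErr; ring
    rw [e]
    gcongr
    calc (67 + 4 * normBound x + 2 * N : ℝ) ≤ 2 ^ 7 * normBound x * N := by nlinarith
      _ ≤ 2 ^ 7 * 2 ^ b * 2 ^ N := by gcongr
      _ = 2 ^ (7 + b + N) := by rw [pow_add, pow_add]
  have h3 : (68 * N : ℝ) ^ (N * (N - 1)) ≤ 2 ^ ((N + 7) * (N * N)) := by
    calc (68 * N : ℝ) ^ (N * (N - 1)) ≤ (2 ^ (N + 7)) ^ (N * (N - 1)) := by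
          apply pow_le_pow_left₀ (by positivity)
          rw [pow_add]
          nlinarith
      _ ≤ (2 ^ (N + 7)) ^ (N * N) := by
          apply pow_le_pow_right₀ (one_le_pow₀ (by norm_num))
          exact Nat.mul_le_mul_left _ (Nat.sub_le _ _)
      _ = _ := (pow_mul _ _ _).symm
  have h4 : (480 * N ^ 2 : ℝ) ≤ 2 ^ (9 + 2 * N) := by
    calc (480 * N ^ 2 : ℝ) ≤ 2 ^ 9 * (2 ^ N) ^ 2 := by gcongr; norm_num
      _ = _ := by rw [← pow_mul, pow_add, mul_comm N 2]
  have h5 : 0 ≤ cisErr (basePrec x) + expErr (basePrec x) N (normBound x) :=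
    add_nonneg (cisErr_pos _).le (expErr_nonneg (by linarith))
  calc 480 * N ^ 2 * elimErr (basePrec x) N (normBound x) (N * (N - 1))
      ≤ 2 ^ (9 + 2 * N) * (2 ^ ((N + 7) * (N * N)) *
        (2 ^ (7 + b + N) * (1 / 2) ^ ((N + 7) * (N * N + 3) + b))) := by
        unfold elimErr
        gcongr
    _ = 2 ^ ((9 + 2 * N) + (N + 7) * (N * N) + (7 + b + N)) *
        (1 / 2) ^ ((N + 7) * (N * N + 3) + b) := by
        rw [pow_add 2 (9 + 2 * N + _) (7 + b + N), pow_add 2 (9 + 2 * N)]; ring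
    _ ≤ 2 ^ ((N + 7) * (N * N + 3) + b) * (1 / 2) ^ ((N + 7) * (N * N + 3) + b) := by
        refine mul_le_mul_of_nonneg_right (pow_le_pow_right₀ (by norm_num) ?_) (by positivity)
        nlinarith
    _ = 1 := by rw [← mul_pow]; norm_num

/-- The fixed point approximation of `exp (2 x)`. -/
def expEntries {N : ℕ} (k : ℕ) (x : Matrix (Fin N) (Fin N) ℝ) : ℕ → ℕ → ℤ :=
  (expIter k x k).entries

/-- The quarter turns in the circuit. -/
def turns {N : ℕ} (x : Matrix (Fin N) (Fin N) ℝ) : ℕ → ℤ × ℤ × ℤ :=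
  selfTurns (basePrec x) N (expEntries (basePrec x) x)

/-- The exact matrices in the elimination. -/
def exactElim {N : ℕ} (x : Matrix (Fin N) (Fin N) ℝ) : ℕ → ℕ → ℕ → ℝ :=
  realElim N (turns x) (NormedSpace.exp ((2 : ℝ) • x)).entries

/-- The matrices in the elimination in fixed point arithmetic. -/
def approxElim {N : ℕ} (k : ℕ) (x : Matrix (Fin N) (Fin N) ℝ) : ℕ → ℕ → ℕ → ℤ :=
  fixElim k N (turns x) (expEntries k x)

/-! ### Accuracy and stability at all precisions from `basePrec x` on -/

section Antisymm

variable {N : ℕ} {x : Matrix (Fin N) (Fin N) ℝ}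

theorem det_exp_two_smul_pos : 0 < (NormedSpace.exp ((2 : ℝ) • x)).det := by
  rw [two_smul, Matrix.exp_add_of_commute _ _ (Commute.refl x), Matrix.det_mul]
  exact mul_self_pos.2 ((Matrix.isUnit_iff_isUnit_det _).1 (Matrix.isUnit_exp x)).ne_zero

theorem elimInv_zero (hx : x.transpose = -x) :
    ElimInv N (elimPos N 0) (NormedSpace.exp ((2 : ℝ) • x)).entries where
  orth := by rw [toMat_entries]; exact exp_two_smul_orthogonal hx 2
  det_pos := by rw [toMat_entries]; exact det_exp_two_smul_pos
  done := fun l h1 h2 => by simp only [elimPos, Function.iterate_zero, id] at h1; omega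
  turn := fun _ l h1 h2 => by
    simp only [elimPos, Function.iterate_zero, id] at h1 h2
    obtain rfl : l = N - 1 := by omega
    simp [elimPos]
  pivot := fun h => by simp [elimPos] at h
  zero := fun h => by simp [elimPos] at h

theorem elimErr_le_of_basePrec_le (hN : 0 < N) {k : ℕ} (hk : basePrec x ≤ k) :
    480 * N ^ 2 * elimErr k N (normBound x) (N * (N - 1)) ≤ 1 :=
  le_trans (mul_le_mul_of_nonneg_left (elimErr_anti (Nat.cast_nonneg _) hk _) (by positivity))
    (elimErr_basePrec_le hN x)

theorem elimErr_le (hN : 0 < N) {k t : ℕ} (hk : basePrec x ≤ k) (ht : t ≤ N * (N - 1)) :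
    480 * N * elimErr k N (normBound x) t ≤ 1 := by
  have h1 := elimErr_le_of_basePrec_le hN hk
  have h2 := elimErr_le_elimErr (k := k) (S := normBound x) (Nat.cast_nonneg _) hN ht
  have h3 := (cisErr_pos k).le.trans
    (cisErr_le_elimErr (k := k) (S := normBound x) (Nat.cast_nonneg _) hN t)
  have hN1 : (1 : ℝ) ≤ N := by exact_mod_cast hN
  refine le_trans ?_ h1
  have : (N : ℝ) ≤ N ^ 2 := by nlinarith
  gcongr

theorem elimErr_le_one_div (hN : 0 < N) {k t : ℕ} (hk : basePrec x ≤ k) (ht : t ≤ N * (N - 1)) :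
    elimErr k N (normBound x) t ≤ 0.01 := by
  have h1 := elimErr_le hN hk ht
  have h3 := (cisErr_pos k).le.trans
    (cisErr_le_elimErr (k := k) (S := normBound x) (Nat.cast_nonneg _) hN t)
  have hN1 : (1 : ℝ) ≤ N := by exact_mod_cast hN
  have : 480 * elimErr k N (normBound x) t ≤ 480 * N * elimErr k N (normBound x) t := by
    nlinarith
  norm_num
  linarith

theorem cisErr_le_one (hN : 0 < N) {k : ℕ} (hk : basePrec x ≤ k) : cisErr k ≤ 1 := by
  have h1 := elimErr_le_one_div hN hk (Nat.zero_le _)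
  have h2 := cisErr_le_elimErr (k := k) (S := normBound x) (Nat.cast_nonneg _) hN 0
  linarith

theorem expErr_le_one (hN : 0 < N) {k : ℕ} (hk : basePrec x ≤ k) :
    expErr k N (normBound x) ≤ 1 := by
  have h1 := elimErr_le_one_div hN hk (Nat.zero_le _)
  have h2 := cisErr_pos k
  simp only [elimErr, pow_zero, one_mul] at h1
  linarith

theorem tracks_zero (hx : x.transpose = -x) (hN : 0 < N) {k : ℕ} (hk : basePrec x ≤ k) :
    Tracks k N (elimErr k N (normBound x) 0) (expEntries k x)
      (NormedSpace.exp ((2 : ℝ) • x)).entries := by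
  intro r l hr hl
  rw [expEntries, Matrix.entries_apply _ hr hl, Matrix.entries_apply _ hr hl]
  refine (abs_expIter_sub_le hx (sum_sq_le_normBound x) (expErr_le_one hN hk) _ _).trans ?_
  simp only [elimErr, pow_zero, one_mul]
  linarith [cisErr_pos k]

theorem isQuarterTurn_turns (t : ℕ) : IsQuarterTurn (turns x t) := by
  rw [turns, selfTurns_eq]
  exact isQuarterTurn_quarterTurn _ _

/-- The turns are self-consistent at the precision `basePrec x`, where the errors are small enough.
The conclusion about the exact elimination no longer involves any precision. -/
theorem elimInv_exactElim (hx : x.transpose = -x) (hN : 2 ≤ N) {t : ℕ} (ht : t ≤ N * (N - 1)) :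
    ElimInv N (elimPos N t) (exactElim x t) :=
  (elimInv_of_selfConsistent (Nat.cast_nonneg _) (three_le_basePrec x) hN
    (selfConsistent_selfTurns _ _ _) (elimInv_zero hx) (tracks_zero hx (by omega) le_rfl)
    (elimErr_basePrec_le (by omega) x) t ht).1

theorem toMat_exactElim_eq_one (hx : x.transpose = -x) (hN : 2 ≤ N) :
    toMat N (exactElim x (N * (N - 1))) = 1 :=
  (elimInv_exactElim hx hN le_rfl).eq_one (elimPos_last_col hN) (by omega)

/-- As the turns are kept, every higher precision approximates one and the same exact elimination.
-/
theorem tracks_approxElim (hx : x.transpose = -x) (hN : 2 ≤ N) {k t : ℕ} (hk : basePrec x ≤ k)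
    (ht : t ≤ N * (N - 1)) :
    Tracks k N (elimErr k N (normBound x) t) (approxElim k x t) (exactElim x t) ∧
      (t < N * (N - 1) → |((fixAngle k N (turns x) t (approxElim k x t)).1 : ℝ) / 4 ^ k -
        realAngle N (turns x) t (exactElim x t)| ≤ elimErr k N (normBound x) (t + 1)) :=
  tracks_of_elimInv (Nat.cast_nonneg _) ((three_le_basePrec x).trans hk) hN isQuarterTurn_turns
    (fun _ ht => elimInv_exactElim hx hN ht) (tracks_zero hx (by omega) hk)
    (elimErr_le_of_basePrec_le (by omega) hk) t ht

theorem abs_approxElim_le (hx : x.transpose = -x) (hN : 2 ≤ N) {k t : ℕ} (hk : basePrec x ≤ k)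
    (ht : t ≤ N * (N - 1)) {r l : ℕ} (hr : r < N) (hl : l < N) :
    |approxElim k x t r l| ≤ 2 * 4 ^ k :=
  (tracks_approxElim hx hN hk ht).1.abs_le_int (elimInv_exactElim hx hN ht).orth
    (elimErr_le_one_div (by omega) hk ht) hr hl

/-- All the angles that occur in the iteration of the elimination are moderate. -/
theorem abs_angIter_approxElim_le (hx : x.transpose = -x) (hN : 2 ≤ N) {k t : ℕ}
    (hk : basePrec x ≤ k) (ht : t < N * (N - 1)) (hs : (elimPos N t).smooth = true) (j : ℕ) :
    |((angIter k (approxElim k x t ((elimPos N t).row - 1) (elimPos N t).col)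
      (approxElim k x t (elimPos N t).row (elimPos N t).col) j).1 : ℝ) / 4 ^ k| ≤ 8 :=
  abs_angIter_le_of_elimInv ((three_le_basePrec x).trans hk) hN ht (elimInv_exactElim hx hN ht.le)
    (tracks_approxElim hx hN hk ht.le).1 (cisErr_le_elimErr (Nat.cast_nonneg _) (by omega) t)
    (elimErr_le (by omega) hk ht.le) hs j

theorem abs_rightAngle_le (hN : 2 ≤ N) {k : ℕ} (hk : basePrec x ≤ k) (j : ℕ) :
    |((angIter k (4 ^ k) 0 j).1 : ℝ) / 4 ^ k| ≤ 8 :=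
  (abs_rightAngle_sub_le ((three_le_basePrec x).trans hk) (by omega)
    (cisErr_le_elimErr (S := normBound x) (Nat.cast_nonneg _) (by omega) 0)
    (elimErr_le (by omega) hk (Nat.zero_le _))).2 j

theorem turns_eq (t : ℕ) : turns x t =
    quarterTurn (approxElim (basePrec x) x t ((elimPos N t).row - 1) (elimPos N t).col)
      (approxElim (basePrec x) x t (elimPos N t).row (elimPos N t).col) :=
  selfConsistent_selfTurns _ _ _ t

/-- Raising `k` by `3 m` multiplies the error by `(27 / 64) ^ m`, which is at most `2 ^ (-m)`. -/
theorem abs_fixAngle_sub_le (hx : x.transpose = -x) (hN : 2 ≤ N) (m : ℕ) {t : ℕ}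
    (ht : t < N * (N - 1)) :
    |((fixAngle (basePrec x + 3 * m) N (turns x) t (approxElim (basePrec x + 3 * m) x t)).1 : ℝ) /
      4 ^ (basePrec x + 3 * m) - realAngle N (turns x) t (exactElim x t)| ≤ 1 / 2 ^ m := by
  refine ((tracks_approxElim hx hN (Nat.le_add_right _ _) ht.le).2 ht).trans ?_
  have h1 : elimErr (basePrec x + 3 * m) N (normBound x) (t + 1) =
      ((3 / 4) ^ 3) ^ m * elimErr (basePrec x) N (normBound x) (t + 1) := by
    unfold elimErr cisErr expErr
    rw [pow_add _ (basePrec x), pow_mul]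
    ring
  have h2 := elimErr_le_one_div (x := x) (k := basePrec x) (t := t + 1) (by omega) le_rfl ht
  have h3 := (cisErr_pos (basePrec x)).le.trans
    (cisErr_le_elimErr (S := normBound x) (Nat.cast_nonneg _) (by omega : 0 < N) (t + 1))
  rw [h1, ← one_div_pow, ← mul_one ((1 / 2 : ℝ) ^ m)]
  gcongr
  · norm_num
  · linarith

end Antisymm

/-- The circuit of a quadratic Hamiltonian. -/
def gaussianCircuit (n : ℕ) (H : QOp n) : List (NNGate n) :=
  if hn : 2 ≤ n then
    elimGates hn (turns (realCoeff H)) (NormedSpace.exp ((2 : ℝ) • realCoeff H)).entries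
        (2 * n * (2 * n - 1)) ++
      elimGates hn (turns (realCoeff H)) (NormedSpace.exp ((2 : ℝ) • realCoeff H)).entries
        (2 * n * (2 * n - 1))
  else []

theorem gaussianCircuit_length {n : ℕ} (H : QOp n) : (gaussianCircuit n H).length ≤ 8 * n ^ 3 := by
  unfold gaussianCircuit
  split_ifs with hn
  · simp only [elimGates, List.length_append, List.length_map, List.length_range]
    have : 2 * n * (2 * n - 1) ≤ 2 * n * (2 * n) := Nat.mul_le_mul_left _ (Nat.sub_le _ _)
    nlinarith [Nat.mul_le_mul_left (n * n) (by omega : 1 ≤ n)]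
  · simp

theorem gaussianCircuit_isG {n : ℕ} (H : QOp n) : ∀ g ∈ gaussianCircuit n H, g.IsG := by
  intro g hg
  unfold gaussianCircuit at hg
  split_ifs at hg with hn
  · rw [List.mem_append, or_self, elimGates, List.mem_map] at hg
    obtain ⟨t, ht, rfl⟩ := hg
    exact rotGate_isG hn (elimPos_row_lt (by omega) (List.mem_range.1 ht)) _
  · simp at hg

theorem circuitOp_gaussianCircuit {n : ℕ} (hn : 2 ≤ n) {H : QOp n}
    (hH : IsQuadraticHamiltonian H) : circuitOp (gaussianCircuit n H) = expI H := by
  obtain ⟨h1, h2⟩ := hH.realCoeff_spec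
  conv_rhs => rw [h2]
  rw [gaussianCircuit, dif_pos hn]
  exact circuitOp_elimGates_append_self hn h1 (toMat_entries _)
    (toMat_exactElim_eq_one h1 (by omega))

end

noncomputable section

/-! ### Programs in structured form -/

instance : Add Arith := ⟨Arith.add⟩
instance : Sub Arith := ⟨Arith.sub⟩
instance : Mul Arith := ⟨Arith.mul⟩
instance : Div Arith := ⟨Arith.quo⟩
instance (n : ℕ) : OfNat Arith n := ⟨Arith.lit n⟩

/-- The variable `v`, which is kept in cell `0` of array `v`. -/
def var (v : ℕ) : Arith := .cell v 0

/-- Assignment to a variable. -/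
def Prog.set (v : ℕ) (f : Arith) : Prog := .assign v 0 f

/-- Execution of several programs in order. -/
def Prog.block : List Prog → Prog
  | [] => .skip
  | p :: l => .seq p (Prog.block l)

/-- Execution of `p` for the values `0, …, b - 1` of the variable `v`. -/
def Prog.for (v : ℕ) (b : Arith) (p : Prog) : Prog :=
  .seq (.set v 0) (.loop (b - var v) (.seq p (.set v (var v + 1))))

section Eval

variable (s : Store) (e f : Arith)

@[simp] theorem Arith.eval_add' : (e + f).eval s = e.eval s + f.eval s := rfl
@[simp] theorem Arith.eval_sub' : (e - f).eval s = e.eval s - f.eval s := rfl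
@[simp] theorem Arith.eval_mul' : (e * f).eval s = e.eval s * f.eval s := rfl
@[simp] theorem Arith.eval_div' : (e / f).eval s = e.eval s / f.eval s := rfl
@[simp] theorem Arith.eval_zero : (0 : Arith).eval s = 0 := rfl
@[simp] theorem Arith.eval_one : (1 : Arith).eval s = 1 := rfl
@[simp] theorem Arith.eval_ofNat (n : ℕ) : (ofNat(n) : Arith).eval s = (OfNat.ofNat n : ℤ) := rfl
@[simp] theorem Arith.eval_cell (a : ℕ) : (Arith.cell a e).eval s = s a (e.eval s) := rfl
@[simp] theorem eval_var (v : ℕ) : (var v).eval s = s v 0 := rfl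

end Eval

section Write

variable {s : Store} {a b : ℕ} {i j z : ℤ}

theorem Store.write_same : s.write a i z a i = z := by simp [Store.write]

theorem Store.write_of_ne (h : b ≠ a) : s.write a i z b = s b := by
  funext j; simp [Store.write, h]

theorem Store.write_self_apply : s.write a i z a j = if j = i then z else s a j := by
  simp [Store.write]

end Write

section Wp

variable {B : ℕ} {Q : Store → Prop} {s : Store}

theorem wp_seq {p q : Prog} : wp B (.seq p q) Q s ↔ wp B p (wp B q Q) s := Iff.rfl

@[simp] theorem wp_set {v : ℕ} {f : Arith} :
    wp B (.set v f) Q s ↔ |f.eval s| < 2 ^ B ∧ Q (s.write v 0 (f.eval s)) := Iff.rfl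

@[simp] theorem wp_assign {a : ℕ} {e f : Arith} :
    wp B (.assign a e f) Q s ↔ |f.eval s| < 2 ^ B ∧ Q (s.write a (e.eval s) (f.eval s)) := Iff.rfl

@[simp] theorem wp_branch {b : Arith} {p q : Prog} : wp B (.branch b p q) Q s ↔
    (0 < b.eval s → wp B p Q s) ∧ (b.eval s ≤ 0 → wp B q Q s) := Iff.rfl

@[simp] theorem wp_block_nil : wp B (.block []) Q s ↔ Q s := Iff.rfl

@[simp] theorem wp_block_cons {p : Prog} {l : List Prog} :
    wp B (.block (p :: l)) Q s ↔ wp B p (wp B (.block l) Q) s := Iff.rfl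

/-- The invariant is stated for the store in which the counter has already been set, so it may
mention the counter's array. The body must leave the counter unchanged, and the bound, which is
evaluated anew at every test, must keep its value. -/
theorem wp_for {v : ℕ} {b : Arith} {p : Prog} (c : ℕ) (I : ℕ → Store → Prop) (hc : c ≤ B)
    (hb : ∀ j ≤ c, ∀ s, I j s → b.eval s = c) (h0 : I 0 (s.write v 0 0))
    (hstep : ∀ j < c, ∀ s, I j s → s v 0 = j →
      wp B p (fun s' => s' v 0 = j ∧ I (j + 1) (s'.write v 0 (j + 1))) s)
    (hend : ∀ s, I c s → Q s) : wp B (.for v b p) Q s := by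
  refine ⟨by simp, wp_loop c (fun j s => s v 0 = j ∧ I j s) hc ?_ ?_ ?_⟩
  · exact ⟨by simp [Store.write], h0⟩
  · rintro j hj s ⟨h1, h2⟩
    constructor
    · rw [Arith.eval_sub', hb j hj.le s h2, eval_var, h1]
      have : (j : ℤ) < c := by exact_mod_cast hj
      omega
    · rw [wp_seq]
      refine wp_mono ?_ (hstep j hj s h2 h1)
      rintro s' ⟨h3, h4⟩
      rw [wp_set, Arith.eval_add', eval_var, h3, Arith.eval_one]
      refine ⟨?_, by simp [Store.write_same], h4⟩
      rw [abs_of_nonneg (by positivity)]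
      have h5 : j + 1 < 2 ^ B := lt_of_le_of_lt (by omega) (Nat.lt_two_pow_self (n := B))
      exact_mod_cast h5
  · rintro s ⟨h1, h2⟩
    refine ⟨?_, hend s h2⟩
    rw [Arith.eval_sub', hb c le_rfl s h2, eval_var, h1, sub_self]

end Wp

/-- Only the arrays in `S` have been changed. -/
def Frame (S : List ℕ) (s s' : Store) : Prop := ∀ a, a ∉ S → s' a = s a

theorem Frame.refl (S : List ℕ) (s : Store) : Frame S s s := fun _ _ => rfl

theorem Frame.trans {S : List ℕ} {s s' s'' : Store} (h : Frame S s s') (h' : Frame S s' s'') :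
    Frame S s s'' := fun a ha => (h' a ha).trans (h a ha)

theorem Frame.mono {S S' : List ℕ} {s s' : Store} (h : Frame S s s') (hS : S ⊆ S') :
    Frame S' s s' := fun a ha => h a fun h' => ha (hS h')

@[simp] theorem frame_write_iff {S : List ℕ} {s s' : Store} {a : ℕ} {i z : ℤ} (ha : a ∈ S) :
    Frame S s (s'.write a i z) ↔ Frame S s s' :=
  forall₂_congr fun b hb => by rw [Store.write_of_ne (fun e => hb (by rwa [e]))]

theorem Frame.write {S : List ℕ} {s s' : Store} (h : Frame S s s') {a : ℕ} (ha : a ∈ S) (i z : ℤ) :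
    Frame S s (s'.write a i z) := fun b hb => by
  rw [Store.write_of_ne (fun e => hb (by rwa [e])), h b hb]

/-- The array `a` holds the `N × N` matrix `E`, row by row. -/
def HoldsMat (s : Store) (a N : ℕ) (E : ℕ → ℕ → ℤ) : Prop :=
  ∀ r l, r < N → l < N → s a (N * r + l) = E r l

theorem index_inj {N r l r' l' : ℕ} (hl : l < N) (hl' : l' < N) :
    (N * r + l : ℤ) = N * r' + l' ↔ r = r' ∧ l = l' := by
  constructor
  · intro h
    have h : N * r + l = N * r' + l' := by exact_mod_cast h
    have e1 : (N * r + l) / N = r := by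
      rw [Nat.mul_add_div (by omega), Nat.div_eq_of_lt hl, add_zero]
    have e2 : (N * r' + l') / N = r' := by
      rw [Nat.mul_add_div (by omega), Nat.div_eq_of_lt hl', add_zero]
    have : r = r' := by rw [← e1, h, e2]
    subst this
    exact ⟨rfl, by omega⟩
  · rintro ⟨rfl, rfl⟩; rfl

theorem HoldsMat.write {s : Store} {a N r l : ℕ} {E : ℕ → ℕ → ℤ} (h : HoldsMat s a N E)
    (hl : l < N) (z : ℤ) : HoldsMat (s.write a (N * r + l) z) a N
      fun r' l' => if r' = r ∧ l' = l then z else E r' l' := by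
  intro r' l' hr' hl'
  simp only [Store.write_self_apply, index_inj hl' hl, h r' l' hr' hl']

theorem HoldsMat.congr {s : Store} {a N : ℕ} {E E' : ℕ → ℕ → ℤ} (h : HoldsMat s a N E)
    (hE : ∀ r l, r < N → l < N → E r l = E' r l) : HoldsMat s a N E' :=
  fun r l hr hl => (h r l hr hl).trans (hE r l hr hl)

theorem HoldsMat.of_eq {s s' : Store} {a a' N : ℕ} {E : ℕ → ℕ → ℤ} (h : HoldsMat s a N E)
    (hs : s' a' = s a) : HoldsMat s' a' N E := fun r l hr hl => by rw [hs, h r l hr hl]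

theorem holdsMat_iff_flat {s : Store} {a N : ℕ} {E : ℕ → ℕ → ℤ} :
    HoldsMat s a N E ↔ ∀ i : ℕ, i < N * N → s a i = E (i / N) (i % N) := by
  constructor
  · intro h i hi
    have hN : 0 < N := Nat.pos_of_ne_zero fun h0 => by simp [h0] at hi
    rw [← h _ _ (Nat.div_lt_of_lt_mul hi) (Nat.mod_lt _ hN)]
    congr 1
    exact_mod_cast (Nat.div_add_mod i N).symm
  · intro h r l hr hl
    have h1 : N * r + l < N * N := by nlinarith
    have := h _ h1
    push_cast at this
    rw [this, Nat.mul_add_div (by omega), Nat.div_eq_of_lt hl, Nat.mul_add_mod,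
      Nat.mod_eq_of_lt hl, add_zero]

/-! ### Subprograms

Variables: `10` the size `N`, `15` the precision `k`, `16` and `17` the powers `2 ^ k` and `4 ^ k`,
`27` and `28` the coordinates of a vector, `29`, `30`, `31` an angle, its cosine and its sine. -/

/-- Cosine and sine of an angle. -/
def cisProg : Prog := .block
  [.set 30 (var 17), .set 31 (var 29 / var 16),
   .for 34 (var 15) (.block
     [.set 32 ((var 30 * var 30 - var 31 * var 31) / var 17),
      .set 31 (2 * var 30 * var 31 / var 17), .set 30 (var 32)])]

/-- The scale of the fixed point numbers is that of the precision `k`. -/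
structure HasPrec (B : ℕ) (k : ℕ) (s : Store) : Prop where
  prec : s 15 0 = k
  scale2 : s 16 0 = 2 ^ k
  scale4 : s 17 0 = 4 ^ k
  three_le : 3 ≤ k
  err : cisErr k ≤ 1
  le : k ≤ B
  lt : 16 * (4 : ℤ) ^ k < 2 ^ B

theorem HasPrec.of_frame {B k : ℕ} {s s' : Store} (h : HasPrec B k s) {S : List ℕ}
    (hs : Frame S s s') (h15 : 15 ∉ S) (h16 : 16 ∉ S) (h17 : 17 ∉ S) : HasPrec B k s' :=
  ⟨by rw [hs _ h15, h.prec], by rw [hs _ h16, h.scale2], by rw [hs _ h17, h.scale4], h.three_le,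
    h.err, h.le, h.lt⟩

theorem wp_cisProg {B k : ℕ} {s : Store} {ψ : ℤ} (h : HasPrec B k s) (hψ : s 29 0 = ψ)
    (hψ8 : |(ψ : ℝ) / 4 ^ k| ≤ 8) :
    wp B cisProg (fun s' => Frame [30, 31, 32, 34] s s' ∧ (s' 30 0, s' 31 0) = cis k ψ) s := by
  have hb := fun j (hj : j ≤ k) => abs_cisIter_le h.three_le h.err hψ8 hj
  have h4 : (0 : ℤ) < 4 ^ k := by positivity
  have hlt := h.lt
  have hb0 := hb 0 (Nat.zero_le _)
  simp only [cisIter, Function.iterate_zero, id] at hb0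
  simp only [cisProg, wp_block_cons, wp_set, eval_var, Arith.eval_div']
  refine ⟨?_, ?_, ?_⟩
  · rw [h.scale4]; linarith [hb0.1]
  · rw [Store.write_of_ne (by decide), Store.write_of_ne (by decide), hψ, h.scale2]
    linarith [hb0.2]
  · refine wp_for k (fun j s' => Frame [30, 31, 32, 34] s s' ∧ (s' 30 0, s' 31 0) = cisIter k ψ j)
      h.le ?_ ?_ ?_ ?_
    · rintro j hj s' ⟨h1, -⟩
      rw [eval_var, h1 _ (by decide), h.prec]
    · refine ⟨(((Frame.refl _ _).write (by decide) _ _).write (by decide) _ _).write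
        (by decide) _ _, ?_⟩
      simp [Store.write, cisIter, h.scale4, h.scale2, hψ]
    · rintro j hj s' ⟨h1, h2⟩ h3
      have h17 : s' 17 0 = 4 ^ k := by rw [h1 _ (by decide), h.scale4]
      have hb1 := hb (j + 1) hj
      have e : cisIter k ψ (j + 1) = cisStep k (cisIter k ψ j) := Function.iterate_succ_apply' _ _ _
      rw [e, ← h2] at hb1
      simp only [cisStep] at hb1
      simp only [wp_block_cons, wp_block_nil, wp_set, eval_var, Arith.eval_div', Arith.eval_sub',
        Arith.eval_mul', Arith.eval_ofNat]
      rw [e, ← h2]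
      simp [Store.write, h17, cisStep, h3]
      exact ⟨by linarith [hb1.1], by linarith [hb1.2], by linarith [hb1.1], h1⟩
    · rintro s' ⟨h1, h2⟩
      exact ⟨h1, h2⟩

end

/-! ### Programs for the angle of a vector, the rotation of rows and the matrix exponential -/

noncomputable section

/-- The angle of a vector, with its cosine and sine. -/
def angleProg : Prog := .block
  [.set 29 (3 * var 17 / 2), cisProg,
   .for 33 (4 * var 10 * var 15) (.block
     [.set 29 (var 29 + (var 30 * var 27 - var 31 * var 28) / var 17), cisProg])]

theorem abs_lt_of_abs_div_le {k B : ℕ} {ψ : ℤ} (h : |(ψ : ℝ) / 4 ^ k| ≤ 8)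
    (hB : 16 * (4 : ℤ) ^ k < 2 ^ B) : |ψ| < 2 ^ B := by
  rw [abs_div, abs_of_pos (by positivity : (0 : ℝ) < 4 ^ k), div_le_iff₀ (by positivity)] at h
  have h1 : |ψ| ≤ 8 * 4 ^ k := by exact_mod_cast h
  have : (0 : ℤ) < 4 ^ k := by positivity
  linarith

theorem wp_angleProg {B k N : ℕ} {s : Store} {x y : ℤ} (h : HasPrec B k s) (hN : s 10 0 = N)
    (hc : 4 * N * k ≤ B) (hx : s 27 0 = x) (hy : s 28 0 = y)
    (h8 : ∀ j, |((angIter k x y j).1 : ℝ) / 4 ^ k| ≤ 8) :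
    wp B angleProg (fun s' => Frame [29, 30, 31, 32, 33, 34] s s' ∧
      (s' 29 0, s' 30 0, s' 31 0) = angIter k x y (4 * N * k)) s := by
  have hcis : ∀ (s' : Store) (j : ℕ), Frame [29, 30, 31, 32, 33, 34] s s' →
      s' 29 0 = (angIter k x y j).1 → wp B cisProg (fun s'' => Frame [30, 31, 32, 34] s' s'' ∧
        Frame [29, 30, 31, 32, 33, 34] s s'' ∧
        (s'' 29 0, s'' 30 0, s'' 31 0) = angIter k x y j) s' := by
    intro s' j hs' hψ
    refine wp_mono ?_ (wp_cisProg (h.of_frame hs' (by decide) (by decide) (by decide)) hψ (h8 j))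
    rintro s'' ⟨h1, h2⟩
    refine ⟨h1, hs'.trans (h1.mono (by decide)), ?_⟩
    rw [h1 29 (by decide), hψ, h2, ← angIter_snd]
  have hlt := fun j => abs_lt_of_abs_div_le (h8 j) h.lt
  have h0 : (angIter k x y 0).1 = 3 * 4 ^ k / 2 := rfl
  simp only [angleProg, wp_block_cons, wp_set, eval_var, Arith.eval_div', Arith.eval_mul',
    Arith.eval_ofNat, h.scale4]
  refine ⟨by rw [← h0]; exact hlt 0, ?_⟩
  refine wp_mono ?_ (hcis _ 0 (by simp [Frame.refl]) (by simp [Store.write, h0]))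
  rintro s1 ⟨-, h1, h2⟩
  refine wp_for (4 * N * k) (fun j s' => Frame [29, 30, 31, 32, 33, 34] s s' ∧
      (s' 29 0, s' 30 0, s' 31 0) = angIter k x y j) hc ?_ ?_ ?_ ?_
  · rintro j hj s' ⟨h3, -⟩
    simp [h3 10 (by decide), h3 15 (by decide), hN, h.prec]
  · refine ⟨by simp [h1], ?_⟩
    simpa [Store.write] using h2
  · rintro j hj s' ⟨h3, h4⟩ h5
    have e : s' 29 0 + (s' 30 0 * x - s' 31 0 * y) / 4 ^ k = (angIter k x y (j + 1)).1 := by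
      rw [angIter_succ, ← h4]; rfl
    simp only [wp_block_cons, wp_set, Arith.eval_add', Arith.eval_div', Arith.eval_sub',
      Arith.eval_mul', eval_var, h3 27 (by decide), h3 28 (by decide),
      h3 17 (by decide), hx, hy, h.scale4, e]
    refine ⟨hlt _, ?_⟩
    refine wp_mono ?_ (hcis _ (j + 1) (by simp [h3]) (by simp [Store.write]))
    rintro s2 ⟨h6, h7, h8⟩
    refine ⟨by rw [h6 33 (by decide)]; simpa [Store.write] using h5, by simp [h7], ?_⟩
    simpa [Store.write] using h8
  · rintro s' ⟨h3, h4⟩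
    exact ⟨h3, h4⟩

/-- Rotation of two rows; the number of the lower one is in the variable `25`. -/
def rotProg : Prog :=
  .for 35 (var 10) (.block
    [.set 36 (.cell 5 (var 10 * (var 25 - 1) + var 35)),
     .set 37 (.cell 5 (var 10 * var 25 + var 35)),
     .assign 5 (var 10 * (var 25 - 1) + var 35) ((var 30 * var 36 - var 31 * var 37) / var 17),
     .assign 5 (var 10 * var 25 + var 35) ((var 31 * var 36 + var 30 * var 37) / var 17)])

theorem wp_rotProg {B k N p : ℕ} {s : Store} {c d : ℤ} {Y : ℕ → ℕ → ℤ} (h : HasPrec B k s)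
    (hN : s 10 0 = N) (hNB : N ≤ B) (hp : s 25 0 = p + 1) (hpN : p + 1 < N) (hc : s 30 0 = c)
    (hd : s 31 0 = d) (hY : HoldsMat s 5 N Y) (hb : ∀ r l, r < N → l < N → |Y r l| ≤ 2 * 4 ^ k)
    (hb' : ∀ r l, r < N → l < N → |fixRotRows k p c d Y r l| ≤ 2 * 4 ^ k) :
    wp B rotProg (fun s' => Frame [5, 35, 36, 37] s s' ∧
      HoldsMat s' 5 N (fixRotRows k p c d Y)) s := by
  have h4 : (0 : ℤ) < 4 ^ k := by positivity
  have hlt := h.lt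
  -- The columns before `j` are already rotated. Both entries of column `j` are copied before either
  -- of them is overwritten.
  refine wp_for N (fun j s' => Frame [5, 35, 36, 37] s s' ∧
    HoldsMat s' 5 N fun r l => if l < j then fixRotRows k p c d Y r l else Y r l) hNB ?_ ?_ ?_ ?_
  · rintro j hj s' ⟨h1, -⟩
    rw [eval_var, h1 _ (by decide), hN]
  · exact ⟨by simp [Frame.refl], hY.of_eq (Store.write_of_ne (by decide))⟩
  · rintro j hj s' ⟨h1, h2⟩ h3
    have e1 : s' 5 (N * p + j) = Y p j := by rw [h2 p j (by omega) hj]; simp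
    have e2 : s' 5 (N * (p + 1) + j) = Y (p + 1) j := by
      have := h2 (p + 1) j hpN hj
      push_cast at this
      rw [this]; simp
    have b1 := hb p j (by omega) hj
    have b2 := hb (p + 1) j hpN hj
    have b3 := hb' p j (by omega) hj
    have b4 := hb' (p + 1) j hpN hj
    simp only [fixRotRows, if_true, add_eq_left, one_ne_zero, if_false] at b3 b4
    simp [h1 10 (by decide), h1 25 (by decide), h1 17 (by decide), h1 30 (by decide),
      h1 31 (by decide), h3, hN, hp, h.scale4, hc, hd, e1, e2, Store.write_of_ne, Store.write_same]
    refine ⟨by linarith, by linarith, by linarith, by linarith, h1, ?_⟩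
    refine HoldsMat.of_eq (a := 5) (s := ((s'.write 5 (N * p + j) ((c * Y p j - d * Y (p + 1) j) /
      4 ^ k)).write 5 (N * ((p + 1 : ℕ) : ℤ) + j) ((d * Y p j + c * Y (p + 1) j) / 4 ^ k))) ?_ ?_
    · refine ((h2.write hj _).write hj _).congr fun r l hr hl => ?_
      by_cases hl' : l = j
      · subst hl'
        by_cases hr1 : r = p
        · subst hr1; simp [fixRotRows]
        · by_cases hr2 : r = p + 1
          · subst hr2; simp [fixRotRows]
          · simp [fixRotRows, hr1, hr2]
      · have : l ≤ j ↔ l < j := by omega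
        simp [hl', this]
    · funext i
      simp [Store.write]
  · rintro s' ⟨h1, h2⟩
    exact ⟨h1, h2.congr fun r l hr hl => by simp [hl]⟩

/-- Squaring of a matrix. -/
def squareProg : Prog := .block
  [.for 18 (var 10 * var 10) (.block
     [.set 19 0,
      .for 20 (var 10) (.set 19 (var 19 + .cell 5 (var 10 * (var 18 / var 10) + var 20) *
        .cell 5 (var 10 * var 20 + (var 18 - var 10 * (var 18 / var 10))))),
      .assign 6 (var 18) (var 19 / var 17)]),
   .for 18 (var 10 * var 10) (.assign 5 (var 18) (.cell 6 (var 18)))]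

theorem wp_squareProg {B k N : ℕ} {s : Store} {E : ℕ → ℕ → ℤ} (h : HasPrec B k s)
    (hN : s 10 0 = N) (hNB : N * N ≤ B) (hE : HoldsMat s 5 N E)
    (hb : ∀ r l, r < N → l < N → |E r l| ≤ 2 * 4 ^ k) (hB : 4 * N * (4 : ℤ) ^ k * 4 ^ k < 2 ^ B) :
    wp B squareProg (fun s' => Frame [5, 6, 18, 19, 20] s s' ∧
      HoldsMat s' 5 N fun r l => (∑ j ∈ Finset.range N, E r j * E j l) / 4 ^ k) s := by
  have h4 : (0 : ℤ) < 4 ^ k := by positivity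
  have hsum : ∀ r l j, r < N → l < N → j ≤ N →
      |∑ i ∈ Finset.range j, E r i * E i l| < 2 ^ B := by
    intro r l j hr hl hj
    refine lt_of_le_of_lt (Finset.abs_sum_le_sum_abs _ _) (lt_of_le_of_lt ?_ hB)
    calc ∑ i ∈ Finset.range j, |E r i * E i l| ≤ ∑ _i ∈ Finset.range j, 2 * 4 ^ k * (2 * 4 ^ k) := by
          refine Finset.sum_le_sum fun i hi => ?_
          have hi := Finset.mem_range.1 hi
          rw [abs_mul]
          exact mul_le_mul (hb _ _ hr (by omega)) (hb _ _ (by omega) hl) (abs_nonneg _)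
            (by positivity)
      _ = (j : ℤ) * (2 * 4 ^ k * (2 * 4 ^ k)) := by simp
      _ ≤ (N : ℤ) * (2 * 4 ^ k * (2 * 4 ^ k)) := by gcongr
      _ = _ := by ring
  simp only [squareProg, wp_block_cons]
  -- The square is collected in array `6` and copied back afterwards, since the old entries are
  -- needed until the end.
  refine wp_for (N * N) (fun i s' => Frame [6, 18, 19, 20] s s' ∧ ∀ i' : ℕ, i' < i →
    s' 6 i' = (∑ j ∈ Finset.range N, E (i' / N) j * E j (i' % N)) / 4 ^ k) hNB ?_ ?_ ?_ ?_
  · rintro j hj s' ⟨h1, -⟩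
    simp [h1 10 (by decide), hN]
  · exact ⟨by simp [Frame.refl], fun i' hi' => absurd hi' (by omega)⟩
  · rintro i hi s' ⟨h1, h2⟩ h3
    have hN0 : 0 < N := Nat.pos_of_ne_zero fun h0 => by simp [h0] at hi
    have hr : i / N < N := Nat.div_lt_of_lt_mul hi
    have hl : i % N < N := Nat.mod_lt _ hN0
    simp only [wp_block_cons, wp_set, Arith.eval_zero]
    refine ⟨by simp, ?_⟩
    refine wp_for N (fun j s'' => Frame [19, 20] s' s'' ∧
      s'' 19 0 = ∑ j' ∈ Finset.range j, E (i / N) j' * E j' (i % N)) (by nlinarith) ?_ ?_ ?_ ?_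
    · rintro j hj s'' ⟨h4, -⟩
      rw [eval_var, h4 _ (by decide), h1 _ (by decide), hN]
    · exact ⟨by simp [Frame.refl], by simp [Store.write]⟩
    · rintro j hj s'' ⟨h4, h5⟩ h6
      have f5 : s'' 5 = s 5 := by rw [h4 5 (by decide), h1 5 (by decide)]
      have f10 : s'' 10 0 = N := by rw [h4 10 (by decide), h1 10 (by decide), hN]
      have f18 : s'' 18 0 = i := by rw [h4 18 (by decide), h3]
      have e1 : s 5 (N * (i / N : ℕ) + j) = E (i / N) j := hE _ _ hr hj
      have e2 : s 5 (N * j + (i % N : ℕ)) = E j (i % N) := hE _ _ hj hl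
      have e3 : (i : ℤ) - N * ((i : ℤ) / N) = ((i % N : ℕ) : ℤ) := by
        have := Int.mul_ediv_add_emod (i : ℤ) N
        push_cast
        linarith
      have e4 : (i : ℤ) / N = ((i / N : ℕ) : ℤ) := by push_cast; rfl
      have e : (var 19 + .cell 5 (var 10 * (var 18 / var 10) + var 20) *
        .cell 5 (var 10 * var 20 + (var 18 - var 10 * (var 18 / var 10))) : Arith).eval s'' =
          ∑ j' ∈ Finset.range (j + 1), E (i / N) j' * E j' (i % N) := by
        simp only [Arith.eval_add', Arith.eval_mul', Arith.eval_sub', Arith.eval_div', eval_var,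
          Arith.eval_cell, f5, f10, f18, h5, h6, e3]
        rw [e4, e1, e2, Finset.sum_range_succ]
      rw [wp_set, e]
      refine ⟨hsum _ _ _ hr hl hj, ?_, by simp [h4], ?_⟩
      · simpa [Store.write] using h6
      · simp [Store.write]
    · rintro s'' ⟨h4, h5⟩
      have f18 : s'' 18 0 = i := by rw [h4 18 (by decide), h3]
      have f17 : s'' 17 0 = 4 ^ k := by rw [h4 17 (by decide), h1 17 (by decide), h.scale4]
      simp only [wp_block_cons, wp_block_nil, wp_assign, eval_var, Arith.eval_div', h5, f17, f18]
      refine ⟨lt_of_le_of_lt (Int.abs_ediv_le_abs _ _) (hsum _ _ _ hr hl le_rfl),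
        by simp [Store.write, f18], ?_, ?_⟩
      · have : Frame [6, 18, 19, 20] s s'' := h1.trans (h4.mono (by decide))
        simp [this]
      · intro i' hi'
        rw [Store.write_of_ne (by decide), Store.write_self_apply]
        by_cases hii : i' = i
        · subst hii; simp
        · rw [if_neg (by exact_mod_cast hii), h4 6 (by decide), h2 i' (by omega)]
  · rintro s1 ⟨h1, h2⟩
    refine wp_for (N * N) (fun i s' => Frame [5, 6, 18, 19, 20] s s' ∧ (∀ i' : ℕ, i' < N * N →
      s' 6 i' = (∑ j ∈ Finset.range N, E (i' / N) j * E j (i' % N)) / 4 ^ k) ∧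
      ∀ i' : ℕ, i' < i → s' 5 i' = (∑ j ∈ Finset.range N, E (i' / N) j * E j (i' % N)) / 4 ^ k)
      hNB ?_ ?_ ?_ ?_
    · rintro j hj s' ⟨h1, -⟩
      simp [h1 10 (by decide), hN]
    · refine ⟨by simp [h1.mono (S' := [5, 6, 18, 19, 20]) (by decide)], fun i' hi' => ?_,
        fun i' hi' => absurd hi' (by omega)⟩
      rw [Store.write_of_ne (by decide), h2 i' hi']
    · rintro i hi s' ⟨h3, h4, h5⟩ h6
      have hN0 : 0 < N := Nat.pos_of_ne_zero fun h0 => by simp [h0] at hi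
      simp only [wp_assign, eval_var, Arith.eval_cell, h6, h4 i hi]
      refine ⟨lt_of_le_of_lt (Int.abs_ediv_le_abs _ _) (hsum _ _ _ (Nat.div_lt_of_lt_mul hi)
        (Nat.mod_lt _ hN0) le_rfl), by simp [Store.write, h6], by simp [h3], fun i' hi' => ?_,
        fun i' hi' => ?_⟩
      · rw [Store.write_of_ne (by decide), Store.write_of_ne (by decide), h4 i' hi']
      · rw [Store.write_of_ne (by decide), Store.write_self_apply]
        by_cases hii : i' = i
        · subst hii; simp
        · rw [if_neg (by exact_mod_cast hii), h5 i' (by omega)]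
    · rintro s' ⟨h3, -, h5⟩
      exact ⟨h3, holdsMat_iff_flat.2 h5⟩

/-- The exponential of twice the matrix in array `1`, divided by the number in cell `2` of array
`0`. -/
def expProg : Prog := .block
  [.for 18 (var 10 * var 10) (.assign 5 (var 18) (2 * .cell 1 (var 18) * var 16 / .cell 0 2)),
   .for 18 (var 10) (.assign 5 (var 10 * var 18 + var 18)
     (.cell 5 (var 10 * var 18 + var 18) + var 17)),
   .for 21 (var 15) squareProg]

theorem floor_two_mul_div_mul (a : ℤ) (d k : ℕ) :
    ⌊2 * ((a : ℝ) / d) * 2 ^ k⌋ = 2 * a * 2 ^ k / d := by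
  have h := Rat.floor_intCast_div_natCast (2 * a * 2 ^ k) d
  rw [← h, ← Rat.floor_cast (α := ℝ)]
  congr 1
  push_cast
  ring

theorem wp_expProg {B k N d : ℕ} {s : Store} {a : Matrix (Fin N) (Fin N) ℤ}
    {x : Matrix (Fin N) (Fin N) ℝ} (hx : x.transpose = -x)
    (hxa : x = a.map fun z => (z : ℝ) / d) (he : expErr k N (normBound x) ≤ 1)
    (h : HasPrec B k s) (hN : s 10 0 = N) (hNB : N * N ≤ B) (ha : HoldsMat s 1 N a.entries)
    (hds : s 0 2 = d) (hB : 4 * N * (4 : ℤ) ^ k * 4 ^ k < 2 ^ B) :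
    wp B expProg (fun s' => Frame [5, 6, 18, 19, 20, 21] s s' ∧
      HoldsMat s' 5 N (expEntries k x)) s := by
  have h4 : (0 : ℤ) < 4 ^ k := by positivity
  have hlt := h.lt
  have hE := fun j (hj : j ≤ k) r l =>
    abs_expIter_le (k := k) hx (sum_sq_le_normBound x) he hj r l
  have hE0 : ∀ r l, expIter k x 0 r l = 2 * a r l * 2 ^ k / d + if r = l then 4 ^ k else 0 := by
    intro r l
    simp only [expIter, Function.iterate_zero, id, Matrix.of_apply]
    rw [hxa, Matrix.map_apply, floor_two_mul_div_mul]
  -- The bound for the starting matrix bounds the quotient as well, the diagonal term accounting for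
  -- `4 ^ k`. The numerator may be longer: `wp` restricts only values that are written.
  have hQ : ∀ r l, |2 * a r l * 2 ^ k / d| ≤ 3 * (4 : ℤ) ^ k := by
    intro r l
    have h1 := hE 0 (Nat.zero_le _) r l
    rw [hE0, abs_le] at h1
    rw [abs_le]
    split_ifs at h1 <;> constructor <;> linarith [h1.1, h1.2]
  simp only [expProg, wp_block_cons]
  refine wp_for (N * N) (fun i s' => Frame [5, 18] s s' ∧ ∀ i' : ℕ, i' < i →
    s' 5 i' = 2 * a.entries (i' / N) (i' % N) * 2 ^ k / d) hNB ?_ ?_ ?_ ?_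
  · rintro j hj s' ⟨h1, -⟩
    simp [h1 10 (by decide), hN]
  · exact ⟨by simp [Frame.refl], fun i' hi' => absurd hi' (by omega)⟩
  · rintro i hi s' ⟨h1, h2⟩ h3
    have hN0 : 0 < N := Nat.pos_of_ne_zero fun h0 => by simp [h0] at hi
    have e : (2 * .cell 1 (var 18) * var 16 / .cell 0 2 : Arith).eval s' =
        2 * a.entries (i / N) (i % N) * 2 ^ k / d := by
      simp [h3, h1 1 (by decide), h1 16 (by decide), h1 0 (by decide), hds, h.scale2,
        holdsMat_iff_flat.1 ha i hi]
    rw [wp_assign, e, eval_var, h3]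
    refine ⟨?_, by simp [Store.write, h3], by simp [h1], fun i' hi' => ?_⟩
    · rw [Matrix.entries_apply _ (Nat.div_lt_of_lt_mul hi) (Nat.mod_lt _ hN0)]
      linarith [hQ ⟨i / N, Nat.div_lt_of_lt_mul hi⟩ ⟨i % N, Nat.mod_lt _ hN0⟩]
    · rw [Store.write_of_ne (by decide), Store.write_self_apply]
      by_cases hii : i' = i
      · subst hii; simp
      · rw [if_neg (by exact_mod_cast hii), h2 i' (by omega)]
  rintro s1 ⟨h1, h2⟩
  have h2 : HoldsMat s1 5 N fun r l => 2 * a.entries r l * 2 ^ k / d := holdsMat_iff_flat.2 h2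
  refine wp_for N (fun i s' => Frame [5, 18] s s' ∧ HoldsMat s' 5 N fun r l =>
    2 * a.entries r l * 2 ^ k / d + if r = l ∧ r < i then 4 ^ k else 0) (by nlinarith) ?_ ?_ ?_ ?_
  · rintro j hj s' ⟨h1, -⟩
    simp [h1 10 (by decide), hN]
  · refine ⟨by simp [h1], ?_⟩
    exact (h2.congr fun r l _ _ => by simp).of_eq (Store.write_of_ne (by decide))
  · rintro i hi s' ⟨h3, h4⟩ h5
    have e0 := h4 i i hi hi
    have e : (.cell 5 (var 10 * var 18 + var 18) + var 17 : Arith).eval s' =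
        2 * a.entries i i * 2 ^ k / d + 4 ^ k := by
      simp [h5, h3 10 (by decide), h3 17 (by decide), h.scale4, hN, e0]
    rw [wp_assign, e]
    simp only [Arith.eval_add', Arith.eval_mul', eval_var, h5, h3 10 (by decide), hN]
    refine ⟨?_, by simp [Store.write, h5], by simp [h3], ?_⟩
    · rw [Matrix.entries_apply _ hi hi]
      have := hE 0 (Nat.zero_le _) ⟨i, hi⟩ ⟨i, hi⟩
      rw [hE0, if_pos rfl] at this
      linarith
    · refine HoldsMat.of_eq (a := 5) ((h4.write hi _).congr fun r l hr hl => ?_)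
        (Store.write_of_ne (by decide))
      by_cases hrl : r = l
      · subst hrl
        by_cases hri : r = i
        · subst hri; simp
        · have : r < i + 1 ↔ r < i := by omega
          simp [hri, this]
      · have : ¬ (r = i ∧ l = i) := fun h => hrl (h.1.trans h.2.symm)
        simp [hrl, this]
  rintro s2 ⟨h3, h4⟩
  refine wp_for k (fun j s' => Frame [5, 6, 18, 19, 20, 21] s s' ∧
    HoldsMat s' 5 N (expIter k x j).entries) h.le ?_ ?_ ?_ ?_
  · rintro j hj s' ⟨h1, -⟩
    simp [h1 15 (by decide), h.prec]
  · refine ⟨by simp [h3.mono (S' := [5, 6, 18, 19, 20, 21]) (by decide)], ?_⟩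
    refine (h4.congr fun r l hr hl => ?_).of_eq (Store.write_of_ne (by decide))
    rw [Matrix.entries_apply _ hr hl, Matrix.entries_apply _ hr hl, hE0]
    simp [hr]
  · rintro j hj s' ⟨h5, h6⟩ h7
    have hb : ∀ r l, r < N → l < N → |(expIter k x j).entries r l| ≤ 2 * 4 ^ k := by
      intro r l hr hl
      rw [Matrix.entries_apply _ hr hl]
      exact hE j hj.le _ _
    refine wp_mono ?_ (wp_squareProg (h.of_frame h5 (by decide) (by decide) (by decide))
      (by rw [h5 10 (by decide), hN]) hNB h6 hb hB)
    rintro s'' ⟨h8, h9⟩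
    refine ⟨by rw [h8 21 (by decide), h7], ?_, ?_⟩
    · have : Frame [5, 6, 18, 19, 20, 21] s s'' := h5.trans (h8.mono (by decide))
      simp [this]
    · refine (h9.congr fun r l hr hl => ?_).of_eq (Store.write_of_ne (by decide))
      rw [Matrix.entries_apply _ hr hl, expIter_succ, Matrix.map_apply, Matrix.mul_apply,
        Finset.sum_range]
      congr 1
      refine Finset.sum_congr rfl fun i _ => ?_
      rw [Matrix.entries_apply _ hr i.2, Matrix.entries_apply _ i.2 hl]
  · rintro s' ⟨h5, h6⟩
    exact ⟨h5, h6⟩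

end

noncomputable section

/-! ### The program of the elimination

Further variables: `11` the number of steps, `14` the power `2 ^ m`, `22` the right angle, `23`,
`24`, `25` the position, `26` the number of the step; the quarter turns are kept in the arrays `40`,
`41`, `42`. -/

/-- The quarter turn for the vector with the coordinates `27` and `28`. -/
def turnProg : Prog :=
  .branch (var 28 * var 28 - var 27 * var 27)
    (.branch (var 28)
      (.block [.assign 40 (var 26) 0, .assign 41 (var 26) (0 - 1), .assign 42 (var 26) (0 - 1)])
      (.block [.assign 40 (var 26) 0, .assign 41 (var 26) 1, .assign 42 (var 26) 1]))
    (.branch (0 - var 27)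
      (.block [.assign 40 (var 26) (0 - 1), .assign 41 (var 26) 0, .assign 42 (var 26) 2])
      (.block [.assign 40 (var 26) 1, .assign 41 (var 26) 0, .assign 42 (var 26) 0]))

theorem wp_turnProg {B : ℕ} {s : Store} {x y t : ℤ} (hB : (2 : ℤ) < 2 ^ B) (hx : s 27 0 = x)
    (hy : s 28 0 = y) (ht : s 26 0 = t) :
    wp B turnProg (fun s' => Frame [40, 41, 42] s s' ∧
      (s' 40 t, s' 41 t, s' 42 t) = quarterTurn x y ∧ ∀ a i, i ≠ t → s' a i = s a i) s := by
  have hB1 : (1 : ℤ) < 2 ^ B := by linarith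
  have hB0 : (0 : ℤ) < 2 ^ B := by linarith
  have h : ∀ a i, i ≠ t → ∀ z1 z2 z3, (((s.write 40 t z1).write 41 t z2).write 42 t z3) a i =
      s a i := by
    intro a i hi z1 z2 z3
    simp [Store.write, hi]
  simp only [turnProg, wp_branch, Arith.eval_sub', Arith.eval_mul', eval_var, hx, hy,
    Arith.eval_zero]
  refine ⟨fun h1 => ⟨fun h2 => ?_, fun h2 => ?_⟩, fun h1 => ⟨fun h2 => ?_, fun h2 => ?_⟩⟩
  · have e : quarterTurn x y = (0, -1, -1) := by rw [quarterTurn, if_pos h1, if_pos h2]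
    rw [e]
    simp [Store.write_of_ne, ht, hB1, Frame.refl, Store.write_same]
    exact fun a i hi => h a i hi _ _ _
  · have e : quarterTurn x y = (0, 1, 1) := by rw [quarterTurn, if_pos h1, if_neg (not_lt.2 h2)]
    rw [e]
    simp [Store.write_of_ne, ht, hB1, Frame.refl, Store.write_same]
    exact fun a i hi => h a i hi _ _ _
  · have e : quarterTurn x y = (-1, 0, 2) := by
      rw [quarterTurn, if_neg (not_lt.2 h1), if_pos (by linarith)]
    rw [e]
    simp [Store.write_of_ne, ht, hB1, Frame.refl, Store.write_same, hB]
    exact fun a i hi => h a i hi _ _ _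
  · have e : quarterTurn x y = (1, 0, 0) := by
      rw [quarterTurn, if_neg (not_lt.2 h1), if_neg (by linarith)]
    rw [e]
    simp [Store.write_of_ne, ht, hB1, Frame.refl, Store.write_same]
    exact fun a i hi => h a i hi _ _ _

/-- The variables `23`, `24` and `25` hold the position `σ`. -/
structure HoldsPos (s : Store) (σ : ElimPos) : Prop where
  col : s 23 0 = σ.col
  smooth : s 24 0 = if σ.smooth = true then 1 else 0
  row : s 25 0 = σ.row

theorem HoldsPos.of_frame {s s' : Store} {σ : ElimPos} (h : HoldsPos s σ) {S : List ℕ}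
    (hs : Frame S s s') (h23 : 23 ∉ S) (h24 : 24 ∉ S) (h25 : 25 ∉ S) : HoldsPos s' σ :=
  ⟨by rw [hs _ h23, h.col], by rw [hs _ h24, h.smooth], by rw [hs _ h25, h.row]⟩

/-- Transition to the next position. -/
def nextProg : Prog :=
  .branch (var 24)
    (.branch (var 23 - var 25) (.set 25 (var 25 + 1))
      -- The last assignment reads the column after it has been decreased.
      (.block [.set 23 (var 23 - 1), .set 24 0, .set 25 (var 23)]))
    (.branch (var 25 - 1) (.set 25 (var 25 - 1)) (.block [.set 24 1, .set 25 1]))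

theorem wp_nextProg {B : ℕ} {s : Store} {σ : ElimPos} (h : HoldsPos s σ) (h1 : 1 ≤ σ.row)
    (h2 : σ.row ≤ σ.col) (hB : (σ.col : ℤ) + 1 < 2 ^ B) :
    wp B nextProg (fun s' => Frame [23, 24, 25] s s' ∧ HoldsPos s' σ.next) s := by
  obtain ⟨c, b, r⟩ := σ
  obtain ⟨hc, hb, hr⟩ := h
  simp only at hc hb hr h1 h2 hB
  have h2' : (r : ℤ) ≤ c := by exact_mod_cast h2
  have h1' : (1 : ℤ) ≤ r := by exact_mod_cast h1
  have hc1 : ((c - 1 : ℕ) : ℤ) = c - 1 := by omega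
  have hr1 : ((r - 1 : ℕ) : ℤ) = r - 1 := by omega
  have b1 : |(c : ℤ) - 1| < 2 ^ B := by rw [abs_lt]; constructor <;> linarith
  have b2 : |(r : ℤ) - 1| < 2 ^ B := by rw [abs_lt]; constructor <;> linarith
  have b3 : |(r : ℤ) + 1| < 2 ^ B := by rw [abs_lt]; constructor <;> linarith
  have b4 : (1 : ℤ) < 2 ^ B := by linarith
  have b5 : (0 : ℤ) < 2 ^ B := by linarith
  cases b
  · simp only [Bool.false_eq_true, if_false] at hb
    simp only [nextProg, wp_branch, eval_var, hb, lt_irrefl, false_imp_iff, true_and, le_refl,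
      forall_const, Arith.eval_sub', hr, Arith.eval_one, wp_set, wp_block_cons, wp_block_nil]
    constructor
    · intro h3
      have h3 : 1 < r := by omega
      simp only [ElimPos.next, h3, Bool.false_eq_true, if_false, if_true]
      refine ⟨b2, by simp [Frame.refl], ?_, ?_, ?_⟩ <;> simp [Store.write, hc, hb, hr1]
    · intro h3
      have h3 : ¬ 1 < r := by omega
      simp only [ElimPos.next, h3, Bool.false_eq_true, if_false]
      refine ⟨by simpa using b4, by simpa using b4, by simp [Frame.refl], ?_, ?_, ?_⟩ <;>
        simp [Store.write, hc]
  · simp only [if_true] at hb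
    simp only [nextProg, wp_branch, eval_var, hb, Int.one_pos, forall_const, Arith.eval_sub', hr,
      hc, Arith.eval_one, wp_set, wp_block_cons, wp_block_nil, Arith.eval_add']
    refine ⟨⟨fun h3 => ?_, fun h3 => ?_⟩, fun h3 => absurd h3 (by norm_num)⟩
    · have h3 : r < c := by omega
      simp only [ElimPos.next, h3, if_true]
      refine ⟨b3, by simp [Frame.refl], ?_, ?_, ?_⟩ <;> simp [Store.write, hc, hb]
    · have h3 : ¬ r < c := by omega
      simp only [ElimPos.next, h3, if_true, if_false]
      refine ⟨b1, by simp, ?_, by simp [Frame.refl], ?_, ?_, ?_⟩ <;>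
        simp [Store.write, hc1, b1]

/-- The coefficients of a rotation, as multiples of `2 ^ (-m)`. -/
def intCoeff (A : ℕ) (w : ℤ) (a b : ℕ) : ℤ :=
  if a = A ∧ b = A + 1 then w else if a = A + 1 ∧ b = A then -w else 0

/-- The first `t` of the `T` gates of each half of the circuit have been written down; their first
lines are `line`, the first generators involved are `A`, and the coefficients are `w`. -/
structure Written (s : Store) (T : ℕ) (line A : ℕ → ℕ) (w : ℕ → ℤ) (t : ℕ) : Prop where
  line_first : ∀ j : ℕ, j < t → s 3 j = line j
  line_second : ∀ j : ℕ, j < t → s 3 (T + j) = line j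
  -- Coefficients not yet written are still `0`, so only two of the sixteen numbers of each gate
  -- have to be stored.
  coeff_first : ∀ j a b : ℕ, j < T → a < 4 → b < 4 →
    s 4 (16 * j + 4 * a + b) = if j < t then intCoeff (A j) (w j) a b else 0
  coeff_second : ∀ j a b : ℕ, j < T → a < 4 → b < 4 →
    s 4 (16 * (T + j) + 4 * a + b) = if j < t then intCoeff (A j) (w j) a b else 0

theorem Written.of_frame {s s' : Store} {T : ℕ} {line A : ℕ → ℕ} {w : ℕ → ℤ} {t : ℕ}
    (h : Written s T line A w t) {S : List ℕ} (hs : Frame S s s') (h3 : 3 ∉ S) (h4 : 4 ∉ S) :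
    Written s' T line A w t :=
  ⟨fun j hj => by rw [hs _ h3, h.line_first j hj], fun j hj => by rw [hs _ h3, h.line_second j hj],
    fun j a b hj ha hb => by rw [hs _ h4, h.coeff_first j a b hj ha hb],
    fun j a b hj ha hb => by rw [hs _ h4, h.coeff_second j a b hj ha hb]⟩

/-- Output of the data of a gate. -/
def outProg : Prog := .block
  [.branch (.cell 0 0 - 1 - (var 25 - 1) / 2) (.set 38 ((var 25 - 1) / 2)) (.set 38 (.cell 0 0 - 2)),
   .set 39 (var 25 - 1 - 2 * var 38),
   .set 36 ((var 29 * var 14 + 2 * var 17) / (4 * var 17)),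
   .assign 3 (var 26) (var 38), .assign 3 (var 11 + var 26) (var 38),
   -- Positions in a `4 × 4` block, row by row: `4 A + (A + 1) = 5 A + 1` and `4 (A + 1) + A = 5 A +
   -- 4`.
   .assign 4 (16 * var 26 + 5 * var 39 + 1) (var 36),
   .assign 4 (16 * var 26 + 5 * var 39 + 4) (0 - var 36),
   .assign 4 (16 * (var 11 + var 26) + 5 * var 39 + 1) (var 36),
   .assign 4 (16 * (var 11 + var 26) + 5 * var 39 + 4) (0 - var 36)]

/-- A fixed point number of precision `k`, divided by `4` and rounded to `m` binary digits. -/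
def roundQuarter (k m : ℕ) (ψ : ℤ) : ℤ := (ψ * 2 ^ m + 2 * 4 ^ k) / (4 * 4 ^ k)

theorem wp_outProg {B n k m T t p : ℕ} {s : Store} {ψ : ℤ} {line A : ℕ → ℕ} {w : ℕ → ℤ}
    (hn : s 0 0 = n) (hn2 : 2 ≤ n) (hp : s 25 0 = p + 1) (hpn : p + 1 < 2 * n) (hψ : s 29 0 = ψ)
    (hm : s 14 0 = 2 ^ m) (hk : s 17 0 = 4 ^ k) (hT : s 11 0 = T) (ht : s 26 0 = t) (htT : t < T)
    (hline : line t = rotLine n p) (hA : A t = p - 2 * rotLine n p) (hw : w t = roundQuarter k m ψ)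
    (hB : |w t| < 2 ^ B) (hnB : (2 * n : ℤ) < 2 ^ B) (h : Written s T line A w t) :
    wp B outProg (fun s' => Frame [3, 4, 36, 38, 39] s s' ∧ Written s' T line A w (t + 1)) s := by
  have hl : (rotLine n p : ℤ) = if (0 : ℤ) < n - 1 - p / 2 then (p : ℤ) / 2 else n - 2 := by
    unfold rotLine
    split_ifs <;> omega
  have hl2 : rotLine n p ≤ n := by unfold rotLine; omega
  have hAle : A t ≤ 2 := by rw [hA]; unfold rotLine; omega
  have hAz : (p : ℤ) - 2 * rotLine n p = A t := by
    rw [hA]; unfold rotLine; omega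
  have hstart : wp B (.branch (.cell 0 0 - 1 - (var 25 - 1) / 2) (.set 38 ((var 25 - 1) / 2))
      (.set 38 (.cell 0 0 - 2))) (fun s' => s' = s.write 38 0 (rotLine n p)) s := by
    simp only [wp_branch, Arith.eval_sub', Arith.eval_cell,
      Arith.eval_div', eval_var, Arith.eval_ofNat, hn, hp, add_sub_cancel_right, wp_set]
    constructor
    · intro h1
      rw [if_pos h1] at hl
      rw [← hl]
      exact ⟨by rw [abs_of_nonneg (by positivity)]; omega, rfl⟩
    · intro h1
      rw [if_neg (not_lt.2 h1)] at hl
      rw [← hl]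
      exact ⟨by rw [abs_of_nonneg (by positivity)]; omega, rfl⟩
  have b1 : |(rotLine n p : ℤ)| < 2 ^ B := by rw [abs_of_nonneg (by positivity)]; omega
  have b2 : |(A t : ℤ)| < 2 ^ B := by rw [abs_of_nonneg (by positivity)]; omega
  rw [outProg, wp_block_cons]
  refine wp_mono ?_ hstart
  rintro _ rfl
  simp only [wp_block_cons, wp_block_nil, wp_set, wp_assign, Arith.eval_sub', Arith.eval_add',
    Arith.eval_mul', Arith.eval_div', eval_var, Arith.eval_ofNat]
  simp only [Store.write, Nat.reduceEqDiff, false_and, if_false, true_and, if_true, hp, hψ, hm, hk,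
    hT, ht, hAz, add_sub_cancel_right, ← roundQuarter.eq_1, ← hw, zero_sub, abs_neg]
  refine ⟨b2, hB, b1, b1, hB, hB, hB, hB, by simp [Frame.refl], ?_⟩
  have hI : ∀ a b : ℕ, a < 4 → b < 4 → (a = A t ∧ b = A t + 1 ↔ (4 * a + b : ℤ) = 5 * A t + 1) ∧
      (a = A t + 1 ∧ b = A t ↔ (4 * a + b : ℤ) = 5 * A t + 4) := by
    intro a b ha hb
    constructor <;> constructor <;> intro h <;> omega
  constructor
  · intro j hj
    by_cases hjt : j = t
    · subst hjt; simp [Store.write, hline]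
    · have := h.line_first j (by omega)
      have e1 : (j : ℤ) ≠ t := by exact_mod_cast hjt
      have e2 : (j : ℤ) ≠ T + t := by omega
      simp [Store.write, e1, e2, this]
  · intro j hj
    by_cases hjt : j = t
    · subst hjt; simp [Store.write, hline]
    · have := h.line_second j (by omega)
      have e1 : (T + j : ℤ) ≠ t := by omega
      have e2 : (T + j : ℤ) ≠ T + t := by omega
      simp [Store.write, e1, e2, this]
  · intro j a b hj ha hb
    have h1 := h.coeff_first j a b hj ha hb
    by_cases hjt : j = t
    · subst hjt
      simp only [lt_irrefl, if_false] at h1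
      have e1 : (16 * j + 4 * a + b : ℤ) ≠ 16 * (T + j) + 5 * A j + 1 := by omega
      have e2 : (16 * j + 4 * a + b : ℤ) ≠ 16 * (T + j) + 5 * A j + 4 := by omega
      have e3 : (16 * j + 4 * a + b : ℤ) = 16 * j + 5 * A j + 1 ↔ a = A j ∧ b = A j + 1 := by
        rw [(hI a b ha hb).1]; constructor <;> intro h <;> linarith
      have e4 : (16 * j + 4 * a + b : ℤ) = 16 * j + 5 * A j + 4 ↔ a = A j + 1 ∧ b = A j := by
        rw [(hI a b ha hb).2]; constructor <;> intro h <;> linarith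
      simp only [Store.write, Nat.reduceEqDiff, false_and, true_and, e1, e2, e3, e4, if_false, h1,
         Nat.lt_succ_self, if_true, intCoeff]
      split_ifs <;> omega
    · have e1 : (16 * j + 4 * a + b : ℤ) ≠ 16 * (T + t) + 5 * A t + 1 := by omega
      have e2 : (16 * j + 4 * a + b : ℤ) ≠ 16 * (T + t) + 5 * A t + 4 := by omega
      have e3 : (16 * j + 4 * a + b : ℤ) ≠ 16 * t + 5 * A t + 1 := by omega
      have e4 : (16 * j + 4 * a + b : ℤ) ≠ 16 * t + 5 * A t + 4 := by omega
      have e5 : j < t + 1 ↔ j < t := by omega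
      simp only [Store.write, Nat.reduceEqDiff, false_and, true_and, e1, e2, e3, e4, e5, if_false, h1]
  · intro j a b hj ha hb
    have h1 := h.coeff_second j a b hj ha hb
    by_cases hjt : j = t
    · subst hjt
      simp only [lt_irrefl, if_false] at h1
      have e1 : (16 * (T + j) + 4 * a + b : ℤ) ≠ 16 * j + 5 * A j + 1 := by omega
      have e2 : (16 * (T + j) + 4 * a + b : ℤ) ≠ 16 * j + 5 * A j + 4 := by omega
      have e3 : (16 * (T + j) + 4 * a + b : ℤ) = 16 * (T + j) + 5 * A j + 1 ↔
          a = A j ∧ b = A j + 1 := by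
        rw [(hI a b ha hb).1]; constructor <;> intro h <;> linarith
      have e4 : (16 * (T + j) + 4 * a + b : ℤ) = 16 * (T + j) + 5 * A j + 4 ↔
          a = A j + 1 ∧ b = A j := by
        rw [(hI a b ha hb).2]; constructor <;> intro h <;> linarith
      simp only [Store.write, Nat.reduceEqDiff, false_and, true_and, e1, e2, e3, e4, if_false, h1,
         Nat.lt_succ_self, if_true, intCoeff]
      split_ifs <;> omega
    · have e1 : (16 * (T + j) + 4 * a + b : ℤ) ≠ 16 * (T + t) + 5 * A t + 1 := by omega
      have e2 : (16 * (T + j) + 4 * a + b : ℤ) ≠ 16 * (T + t) + 5 * A t + 4 := by omega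
      have e3 : (16 * (T + j) + 4 * a + b : ℤ) ≠ 16 * t + 5 * A t + 1 := by omega
      have e4 : (16 * (T + j) + 4 * a + b : ℤ) ≠ 16 * t + 5 * A t + 4 := by omega
      have e5 : j < t + 1 ↔ j < t := by omega
      simp only [Store.write, Nat.reduceEqDiff, false_and, true_and, e1, e2, e3, e4, e5, if_false, h1]

end

/-! ### One step of the elimination, and the elimination as a whole -/

noncomputable section

/-- One step of the elimination. The quarter turns are chosen in the first pass, and the gates are
written down in the second one. -/
def stepProg (first : Bool) : Prog := .block
  [.set 27 (.cell 5 (var 10 * (var 25 - 1) + var 23)),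
   .set 28 (.cell 5 (var 10 * var 25 + var 23)),
   .branch (var 24) angleProg (.block
     [bif first then turnProg else .skip,
      .set 30 (.cell 40 (var 26) * var 17), .set 31 (.cell 41 (var 26) * var 17),
      .set 29 (.cell 42 (var 26) * var 22)]),
   rotProg,
   bif first then .skip else outProg,
   nextProg]

/-- The elimination. -/
def elimProg (first : Bool) : Prog := .block
  [.set 23 (var 10 - 1), .set 24 0, .set 25 (var 10 - 1), .for 26 (var 11) (stepProg first)]

/-- The arrays that are changed in the elimination. -/
def elimArrays : List ℕ := [3, 4, 5, 23, 24, 25, 26, 27, 28, 29, 30, 31, 32, 33, 34, 35, 36, 37, 38,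
  39, 40, 41, 42]

/-- The quarter turns of the steps before `t` have been chosen. -/
def Chosen (s : Store) (N : ℕ) (D : ℕ → ℤ × ℤ × ℤ) (t : ℕ) : Prop :=
  -- At eliminating steps the value of `D` enters no computation, so it is not stored.
  ∀ t' : ℕ, t' < t → (elimPos N t').smooth = false → (s 40 t', s 41 t', s 42 t') = D t'

theorem Chosen.of_frame {s s' : Store} {N : ℕ} {D : ℕ → ℤ × ℤ × ℤ} {t : ℕ} (h : Chosen s N D t)
    {S : List ℕ} (hs : Frame S s s') (h40 : 40 ∉ S) (h41 : 41 ∉ S) (h42 : 42 ∉ S) :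
    Chosen s' N D t := fun t' ht hs' => by rw [hs _ h40, hs _ h41, hs _ h42, h t' ht hs']

/-- The first line of a gate, and the first one of the two generators that it rotates, out of those
of its lines. -/
def gateLine (n t : ℕ) : ℕ := rotLine n ((elimPos (2 * n) t).row - 1)

/-- The first one of the two generators that a gate rotates, out of those of its lines. -/
def gateOffset (n t : ℕ) : ℕ := (elimPos (2 * n) t).row - 1 - 2 * gateLine n t

section Elim

variable {n : ℕ} (x : Matrix (Fin (2 * n)) (Fin (2 * n)) ℝ) (k m : ℕ)

/-- The coefficient of a gate in the output. -/
def gateWeight (t : ℕ) : ℤ :=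
  roundQuarter k m (fixAngle k (2 * n) (turns x) t (approxElim k x t)).1

/-- What does not change in the course of the elimination. -/
structure ElimSetting (B : ℕ) (first : Bool) (s : Store) : Prop where
  two_le : 2 ≤ n
  antisymm : x.transpose = -x
  prec_le : basePrec x ≤ k
  -- `turns x` is defined by the computation at `basePrec x`, so the pass that decides must run at
  -- exactly this precision.
  prec_eq : first = true → k = basePrec x
  prec : HasPrec B k s
  lines : s 0 0 = n
  size : s 10 0 = (2 * n : ℕ)
  steps : s 11 0 = (2 * n * (2 * n - 1) : ℕ)
  digits : s 14 0 = 2 ^ m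
  rightAngle : s 22 0 = (angIter k (4 ^ k) 0 (4 * (2 * n) * k)).1
  le : 4 * (2 * n) * k ≤ B
  steps_le : 2 * n * (2 * n - 1) ≤ B
  weight_lt : 8 * (2 : ℤ) ^ m < 2 ^ B

variable {x k m}

theorem ElimSetting.of_frame {B : ℕ} {first : Bool} {s s' : Store}
    (h : ElimSetting x k m B first s) {S : List ℕ} (hs : Frame S s s')
    (hS : ∀ a ∈ [0, 10, 11, 14, 15, 16, 17, 22], a ∉ S) : ElimSetting x k m B first s' where
  two_le := h.two_le
  antisymm := h.antisymm
  prec_le := h.prec_le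
  prec_eq := h.prec_eq
  prec := h.prec.of_frame hs (hS _ (by decide)) (hS _ (by decide)) (hS _ (by decide))
  lines := by rw [hs _ (hS _ (by decide)), h.lines]
  size := by rw [hs _ (hS _ (by decide)), h.size]
  steps := by rw [hs _ (hS _ (by decide)), h.steps]
  digits := by rw [hs _ (hS _ (by decide)), h.digits]
  rightAngle := by rw [hs _ (hS _ (by decide)), h.rightAngle]
  le := h.le
  steps_le := h.steps_le
  weight_lt := h.weight_lt

/-- What holds before step `t`. -/
structure ElimState (x : Matrix (Fin (2 * n)) (Fin (2 * n)) ℝ) (k m : ℕ) (first : Bool) (t : ℕ)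
    (s : Store) : Prop where
  pos : HoldsPos s (elimPos (2 * n) t)
  mat : HoldsMat s 5 (2 * n) (approxElim k x t)
  chosen : Chosen s (2 * n) (turns x) (bif first then t else 2 * n * (2 * n - 1))
  written : first = false → Written s (2 * n * (2 * n - 1)) (gateLine n) (gateOffset n)
    (gateWeight x k m) t

theorem abs_fixAngle_le {N : ℕ} {x : Matrix (Fin N) (Fin N) ℝ} (hx : x.transpose = -x) (hN : 2 ≤ N)
    {t : ℕ} (hk : basePrec x ≤ k) (ht : t < N * (N - 1)) :
    |(fixAngle k N (turns x) t (approxElim k x t)).1| ≤ 16 * 4 ^ k := by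
  have h4 : (0 : ℤ) < 4 ^ k := by positivity
  have key : ∀ ψ : ℤ, |(ψ : ℝ) / 4 ^ k| ≤ 8 → |ψ| ≤ 8 * 4 ^ k := by
    intro ψ h
    rw [abs_div, abs_of_pos (by positivity : (0 : ℝ) < 4 ^ k), div_le_iff₀ (by positivity)] at h
    exact_mod_cast h
  cases hs : (elimPos N t).smooth
  · rw [fixAngle_of_turn hs, abs_mul]
    have h1 := key _ (abs_rightAngle_le (x := x) hN hk (4 * N * k))
    have h2 : |(turns x t).2.2| ≤ 2 := by
      rcases isQuarterTurn_turns (x := x) t with h | h | h | h <;> rw [h] <;> decide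
    calc _ ≤ 2 * (8 * 4 ^ k) := mul_le_mul h2 h1 (abs_nonneg _) (by norm_num)
      _ = _ := by ring
  · rw [fixAngle_of_smooth hs]
    linarith [key _ (abs_angIter_approxElim_le hx hN hk ht hs (4 * N * k))]

theorem abs_roundQuarter_le {ψ : ℤ} (h : |ψ| ≤ 16 * 4 ^ k) : |roundQuarter k m ψ| ≤ 4 * 2 ^ m + 1 := by
  have h4 : (0 : ℤ) < 4 ^ k := by positivity
  have h2 : (1 : ℤ) ≤ 2 ^ m := one_le_pow₀ (by norm_num)
  obtain ⟨h1, h3⟩ := abs_le.1 h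
  unfold roundQuarter
  rw [abs_le]
  constructor
  · rw [Int.le_ediv_iff_mul_le (by positivity)]
    nlinarith
  · rw [← Int.lt_add_one_iff]
    rw [Int.ediv_lt_iff_lt_mul (by positivity)]
    nlinarith

/-- In the first pass a turn is decided from the current entries and agrees with `turns x` by
`turns_eq`. In the second pass it is read from the arrays `40`, `41`, `42`, whatever the more
precise entries would suggest. -/
theorem wp_anglePart {B : ℕ} {first : Bool} {t : ℕ} {s : Store} (h : ElimSetting x k m B first s)
    (hs : ElimState x k m first t s) (ht : t < 2 * n * (2 * n - 1)) (ht' : s 26 0 = t)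
    (hX : s 27 0 = approxElim k x t ((elimPos (2 * n) t).row - 1) (elimPos (2 * n) t).col)
    (hY : s 28 0 = approxElim k x t (elimPos (2 * n) t).row (elimPos (2 * n) t).col) :
    wp B (.branch (var 24) angleProg (.block
      [bif first then turnProg else .skip,
        .set 30 (.cell 40 (var 26) * var 17), .set 31 (.cell 41 (var 26) * var 17),
        .set 29 (.cell 42 (var 26) * var 22)])) (fun s' =>
      Frame [29, 30, 31, 32, 33, 34, 40, 41, 42] s s' ∧
      (s' 29 0, s' 30 0, s' 31 0) = fixAngle k (2 * n) (turns x) t (approxElim k x t) ∧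
      Chosen s' (2 * n) (turns x) (bif first then t + 1 else 2 * n * (2 * n - 1))) s := by
  have hN : 2 ≤ 2 * n := by have := h.two_le; omega
  have h4 : (0 : ℤ) < 4 ^ k := by positivity
  have hlt := h.prec.lt
  have hchosen : ∀ s' : Store, (elimPos (2 * n) t).smooth = true →
      Frame [29, 30, 31, 32, 33, 34] s s' →
      Chosen s' (2 * n) (turns x) (bif first then t + 1 else 2 * n * (2 * n - 1)) := by
    intro s' hsm hf
    have h1 := hs.chosen.of_frame hf (by decide) (by decide) (by decide)
    cases first
    · exact h1
    · intro t' ht1 ht2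
      have : t' ≠ t := fun e => by rw [e, hsm] at ht2; exact absurd ht2 (by decide)
      exact h1 t' (by simp only [cond_true] at ht1 ⊢; omega) ht2
  rw [wp_branch, eval_var, hs.pos.smooth]
  cases hsm : (elimPos (2 * n) t).smooth
  · refine ⟨fun h1 => absurd h1 (by simp), fun _ => ?_⟩
    rw [wp_block_cons]
    have hfirst : wp B (bif first then turnProg else .skip) (fun s' => Frame [40, 41, 42] s s' ∧
        (s' 40 t, s' 41 t, s' 42 t) = turns x t ∧
        Chosen s' (2 * n) (turns x) (bif first then t + 1 else 2 * n * (2 * n - 1))) s := by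
      cases hf : first
      · rw [hf] at hs
        exact ⟨Frame.refl _ _, hs.chosen t ht hsm, hs.chosen⟩
      · simp only [cond_true]
        refine wp_mono ?_ (wp_turnProg (by linarith) hX hY ht')
        rintro s' ⟨h1, h2, h3⟩
        have e : (s' 40 t, s' 41 t, s' 42 t) = turns x t := by
          rw [h2, turns_eq, ← h.prec_eq hf]
        refine ⟨h1, e, fun t' ht1 ht2 => ?_⟩
        by_cases htt : t' = t
        · rw [htt, e]
        · have hne : (t' : ℤ) ≠ t := by exact_mod_cast htt
          rw [h3 _ _ hne, h3 _ _ hne, h3 _ _ hne]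
          exact hs.chosen t' (by rw [hf, cond_true]; omega) ht2
    refine wp_mono ?_ hfirst
    rintro s1 ⟨h1, h2, h3⟩
    have hq := isQuarterTurn_turns (x := x) t
    have ha := abs_fixAngle_le h.antisymm hN h.prec_le ht
    rw [fixAngle_of_turn hsm] at ha ⊢
    rw [← h2] at hq ha ⊢
    simp only at ha
    have hc1 : |s1 40 t * 4 ^ k| < 2 ^ B := by
      have : |s1 40 t| ≤ 1 := by
        rcases hq with h | h | h | h <;> simp only [Prod.mk.injEq] at h <;> rw [h.1] <;> decide
      rw [abs_mul, abs_of_pos h4]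
      nlinarith
    have hc2 : |s1 41 t * 4 ^ k| < 2 ^ B := by
      have : |s1 41 t| ≤ 1 := by
        rcases hq with h | h | h | h <;> simp only [Prod.mk.injEq] at h <;> rw [h.2.1] <;> decide
      rw [abs_mul, abs_of_pos h4]
      nlinarith
    simp only [wp_block_cons, wp_block_nil, wp_set, Arith.eval_mul', Arith.eval_cell, eval_var]
    simp only [Store.write_of_ne, ne_eq, Nat.reduceEqDiff, not_false_eq_true, h1 26 (by decide),
      h1 17 (by decide), h1 22 (by decide), ht', h.prec.scale4, h.rightAngle]
    refine ⟨hc1, hc2, lt_of_le_of_lt ha (by linarith), ?_, ?_, ?_⟩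
    · have : Frame [29, 30, 31, 32, 33, 34, 40, 41, 42] s s1 := h1.mono (by decide)
      simp [this]
    · simp [Store.write]
    · refine h3.of_frame (S := [29, 30, 31]) ?_ (by decide) (by decide) (by decide)
      simp [Frame.refl]
  · refine ⟨fun _ => ?_, fun h1 => absurd h1 (by simp)⟩
    refine wp_mono ?_ (wp_angleProg h.prec h.size h.le hX hY
      (abs_angIter_approxElim_le h.antisymm hN h.prec_le ht hsm))
    rintro s' ⟨h1, h2⟩
    exact ⟨h1.mono (by decide), by rw [h2, fixAngle_of_smooth hsm], hchosen s' hsm h1⟩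

theorem ElimState.of_frame {first : Bool} {t : ℕ} {s s' : Store} (h : ElimState x k m first t s)
    {S : List ℕ} (hs : Frame S s s') (hS : ∀ a ∈ [3, 4, 5, 23, 24, 25, 40, 41, 42], a ∉ S) :
    ElimState x k m first t s' where
  pos := h.pos.of_frame hs (hS _ (by decide)) (hS _ (by decide)) (hS _ (by decide))
  mat := h.mat.of_eq (hs _ (hS _ (by decide)))
  chosen := h.chosen.of_frame hs (hS _ (by decide)) (hS _ (by decide)) (hS _ (by decide))
  written := fun hf => (h.written hf).of_frame hs (hS _ (by decide)) (hS _ (by decide))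

theorem wp_stepProg {B : ℕ} {first : Bool} {t : ℕ} {s : Store} (h : ElimSetting x k m B first s)
    (hs : ElimState x k m first t s) (ht : t < 2 * n * (2 * n - 1)) (ht' : s 26 0 = t) :
    wp B (stepProg first) (fun s' => s' 26 0 = t ∧ Frame elimArrays s s' ∧
      (first = true → s' 3 = s 3 ∧ s' 4 = s 4) ∧ ElimState x k m first (t + 1) s') s := by
  have hN : 2 ≤ 2 * n := by have := h.two_le; omega
  have h4 : (0 : ℤ) < 4 ^ k := by positivity
  have hlt := h.prec.lt
  have hnB : ((2 * n : ℕ) : ℤ) < 2 ^ B := by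
    have h1 : 2 * n ≤ B := by
      have := h.le
      have := h.prec.three_le
      nlinarith
    exact_mod_cast lt_of_le_of_lt h1 (Nat.lt_two_pow_self (n := B))
  obtain ⟨-, hv2, hv3, hv1⟩ := elimPos_valid hN ht.le
  have hv1 := hv1 ht
  obtain ⟨p, hp⟩ : ∃ p, (elimPos (2 * n) t).row = p + 1 := ⟨_, (Nat.sub_add_cancel hv1).symm⟩
  have hp' : (elimPos (2 * n) t).row - 1 = p := by omega
  have hbt := fun r l hr hl => abs_approxElim_le (k := k) h.antisymm hN h.prec_le ht.le
    (r := r) (l := l) hr hl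
  have hbt1 := fun r l hr hl => abs_approxElim_le (k := k) h.antisymm hN h.prec_le
    (Nat.succ_le_of_lt ht) (r := r) (l := l) hr hl
  have hsucc : approxElim k x (t + 1) = fixRotRows k p
      (fixAngle k (2 * n) (turns x) t (approxElim k x t)).2.1
      (fixAngle k (2 * n) (turns x) t (approxElim k x t)).2.2 (approxElim k x t) := by
    rw [← hp']; rfl
  have hX : s 5 ((2 * n : ℕ) * ((elimPos (2 * n) t).row - 1) + (elimPos (2 * n) t).col) =
      approxElim k x t ((elimPos (2 * n) t).row - 1) (elimPos (2 * n) t).col := by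
    rw [← hs.mat _ _ (by omega) hv3, hp]
    congr 2
    push_cast
    ring
  have hY := hs.mat (elimPos (2 * n) t).row (elimPos (2 * n) t).col (by omega) hv3
  simp only [stepProg, wp_block_cons, wp_set, Arith.eval_cell, Arith.eval_add', Arith.eval_mul',
    Arith.eval_sub', Arith.eval_one, eval_var]
  simp only [Store.write_of_ne, ne_eq, Nat.reduceEqDiff, not_false_eq_true, hs.pos.row, hs.pos.col,
    h.size, hX, hY]
  refine ⟨by linarith [hbt _ _ (by omega : (elimPos (2 * n) t).row - 1 < 2 * n) hv3],
    by linarith [hbt _ _ (by omega : (elimPos (2 * n) t).row < 2 * n) hv3], ?_⟩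
  have hf0 : Frame [27, 28] s ((s.write 27 0 (approxElim k x t ((elimPos (2 * n) t).row - 1)
      (elimPos (2 * n) t).col)).write 28 0 (approxElim k x t (elimPos (2 * n) t).row
      (elimPos (2 * n) t).col)) := by simp [Frame.refl]
  refine wp_mono ?_ (wp_anglePart (h.of_frame hf0 (by decide)) (hs.of_frame hf0 (by decide)) ht
    (by rw [hf0 26 (by decide), ht']) (by simp [Store.write]) (by simp [Store.write]))
  rintro s1 ⟨hf1, ha1, hc1⟩
  have hf1 : Frame [27, 28, 29, 30, 31, 32, 33, 34, 40, 41, 42] s s1 :=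
    (hf0.mono (by decide)).trans (hf1.mono (by decide))
  have h1 := h.of_frame hf1 (by decide)
  have hpos1 := hs.pos.of_frame hf1 (by decide) (by decide) (by decide)
  have ha30 : s1 30 0 = (fixAngle k (2 * n) (turns x) t (approxElim k x t)).2.1 := by rw [← ha1]
  have ha31 : s1 31 0 = (fixAngle k (2 * n) (turns x) t (approxElim k x t)).2.2 := by rw [← ha1]
  rw [wp_block_cons]
  refine wp_mono ?_ (wp_rotProg h1.prec h1.size (by have := h.le; have := h.prec.three_le; nlinarith)
    (by rw [hpos1.row, hp]; push_cast; rfl) (by omega) ha30 ha31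
    (hs.mat.of_eq (hf1 5 (by decide))) hbt (by rw [← hsucc]; exact hbt1))
  rintro s2 ⟨hf2, hm2⟩
  rw [← hsucc] at hm2
  have hf2' : Frame [5, 27, 28, 29, 30, 31, 32, 33, 34, 35, 36, 37, 40, 41, 42] s s2 :=
    (hf1.mono (by decide)).trans (hf2.mono (by decide))
  have h2 := h.of_frame hf2' (by decide)
  have hpos2 := hpos1.of_frame hf2 (by decide) (by decide) (by decide)
  have hout : wp B (bif first then .skip else outProg) (fun s' => Frame [3, 4, 36, 38, 39] s2 s' ∧
      (first = true → s' 3 = s 3 ∧ s' 4 = s 4) ∧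
      (first = false → Written s' (2 * n * (2 * n - 1)) (gateLine n) (gateOffset n)
        (gateWeight x k m) (t + 1))) s2 := by
    cases hf : first
    · simp only [cond_false]
      have hψ : s2 29 0 = (fixAngle k (2 * n) (turns x) t (approxElim k x t)).1 := by
        rw [hf2 29 (by decide), ← ha1]
      have hw := abs_roundQuarter_le (m := m) (abs_fixAngle_le h.antisymm hN h.prec_le ht)
      refine wp_mono ?_ (wp_outProg (line := gateLine n) (A := gateOffset n)
        (w := gateWeight x k m) (n := n) (p := p) (m := m) h2.lines h.two_le
        (by rw [hpos2.row, hp]; push_cast; rfl) (by omega) hψ h2.digits h2.prec.scale4 h2.steps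
        (by rw [hf2' 26 (by decide), ht']) ht (by rw [gateLine, hp'])
        (by rw [gateOffset, gateLine, hp']) rfl
        (lt_of_le_of_lt hw (by linarith [h.weight_lt]))
        (by exact_mod_cast hnB) ((hs.written hf).of_frame hf2' (by decide) (by decide)))
      rintro s' ⟨hf', hw'⟩
      exact ⟨hf', fun e => absurd e (by decide), fun _ => hw'⟩
    · refine ⟨Frame.refl _ _, fun _ => ⟨hf2' 3 (by decide), hf2' 4 (by decide)⟩,
        fun e => absurd e (by decide)⟩
  rw [wp_block_cons]
  refine wp_mono ?_ hout
  rintro s3 ⟨hf3, he3, hw3⟩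
  have hpos3 := hpos2.of_frame hf3 (by decide) (by decide) (by decide)
  rw [wp_block_cons]
  refine wp_mono ?_ (wp_nextProg hpos3 hv1 hv2 (lt_of_le_of_lt (by exact_mod_cast hv3) hnB))
  rintro s4 ⟨hf4, hpos4⟩
  have hF : Frame [3, 4, 5, 23, 24, 25, 27, 28, 29, 30, 31, 32, 33, 34, 35, 36, 37, 38, 39, 40, 41,
      42] s s4 := ((hf2'.mono (by decide)).trans (hf3.mono (by decide))).trans (hf4.mono (by decide))
  refine ⟨by rw [hF 26 (by decide), ht'], hF.mono (by decide), fun e => ?_, ?_, ?_, ?_, fun e => ?_⟩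
  · rw [hf4 3 (by decide), hf4 4 (by decide)]
    exact he3 e
  · rw [elimPos_succ]
    exact hpos4
  · exact (hm2.of_eq (hf3 5 (by decide))).of_eq (hf4 5 (by decide))
  · exact ((hc1.of_frame hf2 (by decide) (by decide) (by decide)).of_frame hf3 (by decide)
      (by decide) (by decide)).of_frame hf4 (by decide) (by decide) (by decide)
  · exact (hw3 e).of_frame hf4 (by decide) (by decide)

theorem wp_elimProg {B : ℕ} {first : Bool} {s : Store} (h : ElimSetting x k m B first s)
    (hmat : HoldsMat s 5 (2 * n) (expEntries k x))
    (hc : first = false → Chosen s (2 * n) (turns x) (2 * n * (2 * n - 1)))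
    (hw : first = false → s 4 = 0) :
    wp B (elimProg first) (fun s' => Frame elimArrays s s' ∧
      (first = true → s' 3 = s 3 ∧ s' 4 = s 4) ∧
      ElimState x k m first (2 * n * (2 * n - 1)) s') s := by
  have hn := h.two_le
  have hnB : ((2 * n : ℕ) : ℤ) < 2 ^ B := by
    have h1 : 2 * n ≤ B := by
      have := h.le
      have := h.prec.three_le
      nlinarith
    exact_mod_cast lt_of_le_of_lt h1 (Nat.lt_two_pow_self (n := B))
  have hb1 : |((2 * n : ℕ) : ℤ) - 1| < 2 ^ B := by
    rw [abs_lt]; push_cast at hnB ⊢; constructor <;> linarith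
  simp only [elimProg, wp_block_cons, wp_set, Arith.eval_sub', Arith.eval_one, Arith.eval_zero,
    eval_var]
  simp only [Store.write_of_ne, ne_eq, Nat.reduceEqDiff, not_false_eq_true, h.size]
  refine ⟨hb1, by simp, hb1, ?_⟩
  have hf0 : ∀ z, Frame [23, 24, 25, 26] s ((((s.write 23 0 (((2 * n : ℕ) : ℤ) - 1)).write 24 0
      0).write 25 0 (((2 * n : ℕ) : ℤ) - 1)).write 26 0 z) := fun z => by simp [Frame.refl]
  refine wp_for (2 * n * (2 * n - 1)) (fun t s' => Frame elimArrays s s' ∧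
      (first = true → s' 3 = s 3 ∧ s' 4 = s 4) ∧ ElimState x k m first t s') h.steps_le ?_ ?_ ?_ ?_
  · rintro t ht s' ⟨h1, -⟩
    rw [eval_var, h1 11 (by decide), h.steps]
  · refine ⟨(hf0 _).mono (by decide), fun _ => ⟨hf0 _ 3 (by decide), hf0 _ 4 (by decide)⟩, ?_, ?_,
      ?_, fun hf => ?_⟩
    · have e : ((2 * n - 1 : ℕ) : ℤ) = ((2 * n : ℕ) : ℤ) - 1 := by omega
      constructor <;> simp only [elimPos, Function.iterate_zero, id, e, Store.write, Nat.reduceEqDiff,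
        false_and, if_false, true_and, if_true, Bool.false_eq_true]
    · exact hmat.of_eq (hf0 _ 5 (by decide))
    · cases hf : first
      · exact (hc hf).of_frame (hf0 _) (by decide) (by decide) (by decide)
      · exact fun t' ht' => absurd ht' (by simp)
    · have h4 := hf0 0 4 (by decide)
      constructor
      · exact fun j hj => absurd hj (by omega)
      · exact fun j hj => absurd hj (by omega)
      · intro j a b _ _ _; rw [h4, hw hf]; simp
      · intro j a b _ _ _; rw [h4, hw hf]; simp
  · rintro t ht s' ⟨h1, h2, h3⟩ h4
    refine wp_mono ?_ (wp_stepProg (h.of_frame h1 (by decide)) h3 ht h4)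
    rintro s'' ⟨h5, h6, h7, h8⟩
    have hf : ∀ z, Frame [26] s'' (s''.write 26 0 z) := fun z => by simp [Frame.refl]
    refine ⟨h5, (h1.trans h6).trans ((hf _).mono (by decide)), fun e => ?_,
      h8.of_frame (hf _) (by decide)⟩
    rw [hf _ 3 (by decide), hf _ 4 (by decide), (h7 e).1, (h7 e).2]
    exact h2 e
  · rintro s' h1
    exact h1

end Elim

end

noncomputable section

/-! ### The whole program -/

/-- One pass: fixed point powers, exponential, right angle, and elimination. -/
def passProg (first : Bool) : Prog := .block
  [.set 16 1, .for 18 (var 15) (.set 16 (2 * var 16)), .set 17 (var 16 * var 16), expProg,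
   .set 27 (var 17), .set 28 0, angleProg, .set 22 (var 29), elimProg first]

/-- The arrays that are changed in a pass. -/
def passArrays : List ℕ := 6 :: 16 :: 17 :: 18 :: 19 :: 20 :: 21 :: 22 :: elimArrays

/-- Powers of two by repeated doubling. -/
theorem wp_pow {B c v : ℕ} {b : Arith} {s : Store} (hv : v ≠ 18) (hc : c ≤ B)
    (hb : ∀ s', Frame [v, 18] s s' → b.eval s' = c) (hlt : (2 : ℤ) ^ c < 2 ^ B) (h1 : s v 0 = 1) :
    wp B (.for 18 b (.set v (2 * var v))) (fun s' => Frame [v, 18] s s' ∧ s' v 0 = 2 ^ c) s := by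
  refine wp_for c (fun j s' => Frame [v, 18] s s' ∧ s' v 0 = 2 ^ j) hc ?_ ?_ ?_ ?_
  · rintro j - s' ⟨h2, -⟩
    exact hb s' h2
  · exact ⟨by simp [Frame.refl], by rw [Store.write_of_ne hv, h1, pow_zero]⟩
  · rintro j hj s' ⟨h2, h3⟩ h4
    rw [wp_set, Arith.eval_mul', eval_var, h3, Arith.eval_ofNat]
    have e : (OfNat.ofNat 2 : ℤ) * 2 ^ j = 2 ^ (j + 1) := by rw [pow_succ]; ring
    rw [e]
    refine ⟨?_, by rw [Store.write_of_ne hv.symm, h4], by simp [h2], ?_⟩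
    · rw [abs_of_pos (by positivity)]
      exact lt_of_le_of_lt (pow_le_pow_right₀ (by norm_num) hj) hlt
    · rw [Store.write_of_ne hv, Store.write_same]
  · rintro s' h2
    exact h2

section Pass

variable {n : ℕ} {x : Matrix (Fin (2 * n)) (Fin (2 * n)) ℝ} {k m : ℕ}

/-- What is required for a pass. -/
structure PassSetting (x : Matrix (Fin (2 * n)) (Fin (2 * n)) ℝ) (k m : ℕ)
    (a : Matrix (Fin (2 * n)) (Fin (2 * n)) ℤ) (d B : ℕ) (first : Bool) (s : Store) : Prop where
  two_le : 2 ≤ n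
  antisymm : x.transpose = -x
  eq : x = a.map fun z => (z : ℝ) / d
  prec_le : basePrec x ≤ k
  prec_eq : first = true → k = basePrec x
  prec : s 15 0 = k
  lines : s 0 0 = n
  denom : s 0 2 = d
  mat : HoldsMat s 1 (2 * n) a.entries
  size : s 10 0 = (2 * n : ℕ)
  steps : s 11 0 = (2 * n * (2 * n - 1) : ℕ)
  digits : s 14 0 = 2 ^ m
  le : 4 * (2 * n) * k ≤ B
  sq_le : 2 * n * (2 * n) ≤ B
  weight_lt : 8 * (2 : ℤ) ^ m < 2 ^ B
  lt : 4 * (2 * n : ℕ) * (4 : ℤ) ^ k * 4 ^ k < 2 ^ B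

theorem wp_passProg {a : Matrix (Fin (2 * n)) (Fin (2 * n)) ℤ} {d B : ℕ} {first : Bool} {s : Store}
    (h : PassSetting x k m a d B first s)
    (hc : first = false → Chosen s (2 * n) (turns x) (2 * n * (2 * n - 1)))
    (hw : first = false → s 4 = 0) :
    wp B (passProg first) (fun s' => Frame passArrays s s' ∧
      (first = true → s' 3 = s 3 ∧ s' 4 = s 4) ∧
      ElimState x k m first (2 * n * (2 * n - 1)) s') s := by
  have hn := h.two_le
  have hN : 0 < 2 * n := by omega
  have h3k : 3 ≤ k := (three_le_basePrec x).trans h.prec_le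
  have h4 : (0 : ℤ) < 4 ^ k := by positivity
  have h44 : (4 : ℤ) ^ k = 2 ^ k * 2 ^ k := by rw [← mul_pow]; norm_num
  have h16 : 16 * (4 : ℤ) ^ k < 2 ^ B := by
    refine lt_of_le_of_lt ?_ h.lt
    have e1 : (4 : ℤ) ≤ (2 * n : ℕ) := by push_cast; omega
    have e2 : (1 : ℤ) ≤ 4 ^ k := one_le_pow₀ (by norm_num)
    calc 16 * (4 : ℤ) ^ k = 4 * 4 * 4 ^ k * 1 := by ring
      _ ≤ 4 * (2 * n : ℕ) * (4 : ℤ) ^ k * 4 ^ k := by gcongr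
  have h2k : (2 : ℤ) ^ k < 2 ^ B := by
    have : (2 : ℤ) ^ k ≤ 4 ^ k := pow_le_pow_left₀ (by norm_num) (by norm_num) _
    linarith
  have hkB : k ≤ B := by have := h.le; nlinarith
  have hTB : 2 * n * (2 * n - 1) ≤ B :=
    (Nat.mul_le_mul_left _ (Nat.sub_le _ _)).trans h.sq_le
  rw [passProg, wp_block_cons, wp_set, Arith.eval_one, wp_block_cons]
  refine ⟨by rw [abs_one]; linarith, ?_⟩
  refine wp_mono ?_ (wp_pow (by decide) hkB (fun s' hs' => ?_) h2k (by simp [Store.write]))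
  swap
  · rw [eval_var, hs' 15 (by decide), Store.write_of_ne (by decide), h.prec]
  rintro s1 ⟨hf1, h16v⟩
  have hf1 : Frame [16, 18] s s1 := by
    refine Frame.trans ?_ hf1
    simp [Frame.refl]
  rw [wp_block_cons, wp_set, Arith.eval_mul', eval_var, h16v, ← h44, wp_block_cons]
  refine ⟨by rw [abs_of_pos h4]; linarith, ?_⟩
  have hf2 : Frame [16, 17, 18] s (s1.write 17 0 (4 ^ k)) := by
    simp [hf1.mono (S' := [16, 17, 18]) (by decide)]
  have hprec2 : HasPrec B k (s1.write 17 0 (4 ^ k)) :=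
    ⟨by rw [hf2 15 (by decide), h.prec], by simp [Store.write, h16v], by simp [Store.write],
      h3k, cisErr_le_one hN h.prec_le, hkB, h16⟩
  refine wp_mono ?_ (wp_expProg h.antisymm h.eq (expErr_le_one hN h.prec_le) hprec2
    (by rw [hf2 10 (by decide), h.size]) h.sq_le (h.mat.of_eq (hf2 1 (by decide)))
    (by rw [hf2 0 (by decide), h.denom]) h.lt)
  rintro s3 ⟨hf3', hm3⟩
  have hprec3 := hprec2.of_frame hf3' (by decide) (by decide) (by decide)
  have hf3 : Frame [5, 6, 16, 17, 18, 19, 20, 21] s s3 :=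
    (hf2.mono (by decide)).trans (hf3'.mono (by decide))
  simp only [wp_block_cons, wp_set, eval_var, Arith.eval_zero]
  refine ⟨by rw [hprec3.scale4, abs_of_pos h4]; linarith, by simp, ?_⟩
  have hf4' : Frame [27, 28] s3 ((s3.write 27 0 (s3 17 0)).write 28 0 0) := by simp [Frame.refl]
  have hprec4 := hprec3.of_frame hf4' (by decide) (by decide) (by decide)
  refine wp_mono ?_ (wp_angleProg (x := 4 ^ k) (y := 0) hprec4
    (by rw [hf4' 10 (by decide), hf3 10 (by decide), h.size]) h.le
    (by simp [Store.write, hprec3.scale4]) (by simp [Store.write])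
    (abs_rightAngle_le (x := x) (by omega) h.prec_le))
  rintro s5 ⟨hf5', ha5⟩
  have ha5 : s5 29 0 = (angIter k (4 ^ k) 0 (4 * (2 * n) * k)).1 := by rw [← ha5]
  refine ⟨?_, ?_⟩
  · rw [eval_var, ha5]
    exact abs_lt_of_abs_div_le (abs_rightAngle_le (x := x) (by omega) h.prec_le _) h16
  have hf6' : Frame [22, 27, 28, 29, 30, 31, 32, 33, 34] s3 (s5.write 22 0 (s5 29 0)) := by
    have : Frame [22, 27, 28, 29, 30, 31, 32, 33, 34] s3 s5 :=
      (hf4'.mono (by decide)).trans (hf5'.mono (by decide))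
    simp [this]
  have hf6 : Frame [5, 6, 16, 17, 18, 19, 20, 21, 22, 27, 28, 29, 30, 31, 32, 33, 34] s
      (s5.write 22 0 (s5 29 0)) := (hf3.mono (by decide)).trans (hf6'.mono (by decide))
  have hset : ElimSetting x k m B first (s5.write 22 0 (s5 29 0)) :=
    { two_le := h.two_le
      antisymm := h.antisymm
      prec_le := h.prec_le
      prec_eq := h.prec_eq
      prec := hprec3.of_frame hf6' (by decide) (by decide) (by decide)
      lines := by rw [hf6 0 (by decide), h.lines]
      size := by rw [hf6 10 (by decide), h.size]
      steps := by rw [hf6 11 (by decide), h.steps]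
      digits := by rw [hf6 14 (by decide), h.digits]
      rightAngle := by rw [Store.write_same, ha5]
      le := h.le
      steps_le := hTB
      weight_lt := h.weight_lt }
  refine wp_mono ?_ (wp_elimProg hset (hm3.of_eq (hf6' 5 (by decide)))
    (fun e => (hc e).of_frame hf6 (by decide) (by decide) (by decide))
    (fun e => (hf6 4 (by decide)).trans (hw e)))
  rintro s7 ⟨hf7, he7, hs7⟩
  refine ⟨(hf6.mono (by decide)).trans (hf7.mono (by decide)), fun e => ?_, hs7⟩
  exact ⟨(he7 e).1.trans (hf6 3 (by decide)), (he7 e).2.trans (hf6 4 (by decide))⟩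

end Pass

/-- Computation of the number of steps, of the power `2 ^ m`, and of the precision of the first
pass. -/
def setupProg : Prog := .block
  [.set 10 (2 * .cell 0 0), .set 11 (var 10 * (var 10 - 1)), .set 12 0,
   .for 18 (var 10 * var 10) (.set 12 (var 12 + .cell 1 (var 18) * .cell 1 (var 18))),
   .set 12 (var 12 / (.cell 0 2 * .cell 0 2)), .set 13 0,
   .loop (var 12) (.block [.set 12 (var 12 / 2), .set 13 (var 13 + 1)]),
   .set 14 1, .for 18 (.cell 0 1) (.set 14 (2 * var 14)),
   .set 15 (3 * ((var 10 + 7) * (var 10 * var 10 + 3) + var 13))]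

theorem sum_range_mul_divMod {N M : ℕ} (f : ℕ → ℕ → ℤ) :
    ∑ i ∈ Finset.range (N * M), f (i / M) (i % M) =
      ∑ r ∈ Finset.range N, ∑ l ∈ Finset.range M, f r l := by
  induction N with
  | zero => simp
  | succ N ih =>
    rw [Nat.succ_mul, Finset.sum_range_add, ih, Finset.sum_range_succ]
    congr 1
    refine Finset.sum_congr rfl fun l hl => ?_
    have hl := Finset.mem_range.1 hl
    rw [Nat.mul_comm N M, Nat.mul_add_div (by omega), Nat.div_eq_of_lt hl, Nat.mul_add_mod,
      Nat.mod_eq_of_lt hl, add_zero]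

/-- The sum of the squares of the entries. -/
def sumSq {N : ℕ} (a : Matrix (Fin N) (Fin N) ℤ) : ℕ := ∑ r, ∑ l, (a r l).natAbs ^ 2

theorem sumSq_eq {N : ℕ} (a : Matrix (Fin N) (Fin N) ℤ) : (sumSq a : ℤ) =
    ∑ i ∈ Finset.range (N * N), a.entries (i / N) (i % N) * a.entries (i / N) (i % N) := by
  rw [sum_range_mul_divMod fun r l => a.entries r l * a.entries r l, sumSq, Finset.sum_range]
  push_cast
  refine Finset.sum_congr rfl fun r _ => ?_
  rw [Finset.sum_range]
  refine Finset.sum_congr rfl fun l _ => ?_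
  rw [a.entries_apply r.2 l.2, sq_abs, sq]

/-- The floor in `normBound` is an integer quotient here, so the program computes exactly the
precision that occurs in the definition of the circuit. -/
theorem normBound_sub_one {N d : ℕ} {a : Matrix (Fin N) (Fin N) ℤ} :
    normBound (a.map fun z => (z : ℝ) / d) - 1 = sumSq a / (d * d) := by
  have h : ∑ r, ∑ l, (a.map fun z => (z : ℝ) / d) r l ^ 2 = (sumSq a : ℝ) / ((d * d : ℕ) : ℝ) := by
    rw [sumSq]
    push_cast
    rw [Finset.sum_div]
    refine Finset.sum_congr rfl fun r _ => ?_
    rw [Finset.sum_div]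
    refine Finset.sum_congr rfl fun l _ => ?_
    rw [Matrix.map_apply, div_pow, Nat.cast_natAbs, Int.cast_abs, sq_abs, sq (d : ℝ)]
  rw [normBound, h, Nat.add_sub_cancel, Nat.floor_div_eq_div]

theorem wp_setupProg {n m d B : ℕ} {a : Matrix (Fin (2 * n)) (Fin (2 * n)) ℤ} {s : Store}
    {x : Matrix (Fin (2 * n)) (Fin (2 * n)) ℝ} (hx : x = a.map fun z => (z : ℝ) / d) (hn : 1 ≤ n)
    (h00 : s 0 0 = n) (h01 : s 0 1 = m) (h02 : s 0 2 = d) (ha : HoldsMat s 1 (2 * n) a.entries)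
    (hB : 2 * n * (2 * n) ≤ B) (hmB : (2 : ℤ) ^ m < 2 ^ B) (hsq : (sumSq a : ℤ) < 2 ^ B)
    (hk : basePrec x ≤ B) :
    wp B setupProg (fun s' => Frame [10, 11, 12, 13, 14, 15, 18] s s' ∧ s' 10 0 = (2 * n : ℕ) ∧
      s' 11 0 = (2 * n * (2 * n - 1) : ℕ) ∧ s' 14 0 = 2 ^ m ∧ s' 15 0 = basePrec x) s := by
  have natlt : ∀ z : ℕ, z ≤ B → |(z : ℤ)| < 2 ^ B := fun z hz => by
    rw [abs_of_nonneg (by positivity)]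
    exact_mod_cast lt_of_le_of_lt hz (Nat.lt_two_pow_self (n := B))
  have hN : ((2 * n : ℕ) : ℤ) = 2 * n := by push_cast; ring
  have hT : ((2 * n * (2 * n - 1) : ℕ) : ℤ) = 2 * n * (2 * n - 1) := by
    have : 1 ≤ 2 * n := by omega
    push_cast [Nat.cast_sub this]
    ring
  have hb1 := natlt (2 * n) (by nlinarith)
  have hb2 := natlt (2 * n * (2 * n - 1)) ((Nat.mul_le_mul_left _ (Nat.sub_le _ _)).trans hB)
  rw [hN] at hb1
  rw [hT] at hb2
  have hmB' : m ≤ B := by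
    by_contra hc
    have : (2 : ℤ) ^ B ≤ 2 ^ m := pow_le_pow_right₀ (by norm_num) (by omega)
    linarith
  simp only [setupProg, wp_block_cons, wp_set, Arith.eval_mul', Arith.eval_cell, Arith.eval_ofNat,
    Arith.eval_sub', eval_var, h00, Store.write_same]
  refine ⟨hb1, hb2, by simp, ?_⟩
  set s0 := ((s.write 10 0 (2 * (n : ℤ))).write 11 0 (2 * n * (2 * n - 1))).write 12 0 0 with hs0
  have hf0 : Frame [10, 11, 12] s s0 := by simp [hs0, Frame.refl]
  have h10 : s0 10 0 = 2 * n := by simp [hs0, Store.write]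
  have h11 : s0 11 0 = 2 * n * (2 * n - 1) := by simp [hs0, Store.write]
  have h12 : s0 12 0 = 0 := by simp [hs0, Store.write]
  refine wp_mono ?_ (wp_for (Q := fun s' => Frame [12, 18] s0 s' ∧ s' 12 0 = sumSq a)
    (2 * n * (2 * n)) (fun j s' => Frame [12, 18] s0 s' ∧ s' 12 0 = ∑ i ∈ Finset.range j,
      a.entries (i / (2 * n)) (i % (2 * n)) * a.entries (i / (2 * n)) (i % (2 * n))) hB ?_ ?_ ?_ ?_)
  rotate_left
  · rintro j - s' ⟨h1, -⟩
    simp [h1 10 (by decide), h10]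
  · exact ⟨by simp [Frame.refl], by simp [Store.write, h12]⟩
  · rintro j hj s' ⟨h1, h2⟩ h3
    have e1 : s' 1 j = a.entries (j / (2 * n)) (j % (2 * n)) := by
      rw [h1 1 (by decide), hf0 1 (by decide)]
      exact holdsMat_iff_flat.1 ha j hj
    have e : (var 12 + .cell 1 (var 18) * .cell 1 (var 18) : Arith).eval s' =
        ∑ i ∈ Finset.range (j + 1),
          a.entries (i / (2 * n)) (i % (2 * n)) * a.entries (i / (2 * n)) (i % (2 * n)) := by
      rw [Arith.eval_add', Arith.eval_mul', Arith.eval_cell, eval_var, eval_var, h3, e1, h2,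
        Finset.sum_range_succ]
    rw [wp_set, e]
    refine ⟨?_, by rw [Store.write_of_ne (by decide), h3], by simp [h1], by simp [Store.write]⟩
    rw [abs_of_nonneg (Finset.sum_nonneg fun i _ => mul_self_nonneg _)]
    refine lt_of_le_of_lt ?_ hsq
    rw [sumSq_eq]
    exact Finset.sum_le_sum_of_subset_of_nonneg (Finset.range_mono hj)
      fun i _ _ => mul_self_nonneg _
  · rintro s' ⟨h1, h2⟩
    exact ⟨h1, by rw [h2, sumSq_eq]⟩
  rintro s1 ⟨hf1, hv1⟩
  have hf1' : Frame [10, 11, 12, 18] s s1 := (hf0.mono (by decide)).trans (hf1.mono (by decide))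
  have eF : ((sumSq a / (d * d) : ℕ) : ℤ) = (sumSq a : ℤ) / (d * d) := by push_cast; rfl
  simp only [wp_block_cons, wp_set, Arith.eval_div', Arith.eval_mul', Arith.eval_cell, eval_var,
    Arith.eval_ofNat, hv1, hf1' 0 (by decide), h02]
  set F := sumSq a / (d * d) with hF
  rw [← eF]
  have hFB : (F : ℤ) < 2 ^ B := lt_of_le_of_lt (by exact_mod_cast Nat.div_le_self _ _) hsq
  have hFB' : ∀ j, |((F / 2 ^ j : ℕ) : ℤ)| < 2 ^ B := fun j => by
    rw [abs_of_nonneg (by positivity)]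
    exact lt_of_le_of_lt (by exact_mod_cast Nat.div_le_self _ _) hFB
  have hsize : F.size ≤ B := by rw [Nat.size_le]; exact_mod_cast hFB
  have hbase : basePrec x = 3 * ((2 * n + 7) * (2 * n * (2 * n) + 3) + F.size) := by
    rw [basePrec, hx, normBound_sub_one]
  refine ⟨by simpa using hFB' 0, by simp, ?_⟩
  set s2 := (s1.write 12 0 (F : ℤ)).write 13 0 0 with hs2
  have hf2 : Frame [12, 13] s1 s2 := by simp [hs2, Frame.refl]
  -- The number of binary digits of `F` is the number of halvings after which `F` has become `0`.
  refine wp_mono ?_ (wp_loop (Q := fun s' => Frame [12, 13] s1 s' ∧ s' 13 0 = F.size) F.size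
    (fun j s' => Frame [12, 13] s1 s' ∧ s' 12 0 = ((F / 2 ^ j : ℕ) : ℤ) ∧ s' 13 0 = j) hsize
    ?_ ?_ ?_)
  rotate_left
  · exact ⟨hf2, by simp [hs2, Store.write], by simp [hs2, Store.write]⟩
  · rintro j hj s' ⟨h1, h2, h3⟩
    have hpos : 0 < F / 2 ^ j := Nat.div_pos (Nat.lt_size.1 hj) (by positivity)
    have e : ((F / 2 ^ j : ℕ) : ℤ) / 2 = ((F / 2 ^ (j + 1) : ℕ) : ℤ) := by
      rw [pow_succ, ← Nat.div_div_eq_div_mul]; push_cast; rfl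
    simp only [wp_block_cons, wp_block_nil, wp_set, Arith.eval_div', Arith.eval_add', eval_var,
      Arith.eval_ofNat, h2, h3, e, Store.write_of_ne, ne_eq, Nat.reduceEqDiff,
      not_false_eq_true]
    refine ⟨by exact_mod_cast hpos, hFB' _, ?_, by simp [h1], by simp [Store.write],
      by simp [Store.write]⟩
    have := natlt (j + 1) (by omega)
    push_cast at this
    exact this
  · rintro s' ⟨h1, h2, h3⟩
    refine ⟨?_, h1, h3⟩
    rw [eval_var, h2, Nat.div_eq_of_lt (Nat.lt_size_self F)]
    simp
  rintro s3 ⟨hf3, hv3⟩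
  have hf3' : Frame [10, 11, 12, 13, 18] s s3 :=
    (hf1'.mono (by decide)).trans (hf3.mono (by decide))
  simp only [wp_block_cons, wp_set, Arith.eval_one]
  refine ⟨by simp only [abs_one]; exact one_lt_pow₀ (by norm_num) (by nlinarith), ?_⟩
  refine wp_mono ?_ (wp_pow (by decide) hmB' (fun s' hs' => ?_) hmB (by simp [Store.write]))
  swap
  · rw [Arith.eval_cell, Arith.eval_one, hs' 0 (by decide), Store.write_of_ne (by decide),
      hf3' 0 (by decide), h01]
  rintro s4 ⟨hf4, hv4⟩
  have hf4 : Frame [14, 18] s3 s4 := by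
    refine Frame.trans ?_ hf4
    simp [Frame.refl]
  have g10 : s4 10 0 = 2 * n := by
    rw [hf4 10 (by decide), hf3 10 (by decide), hf1 10 (by decide), h10]
  have g11 : s4 11 0 = 2 * n * (2 * n - 1) := by
    rw [hf4 11 (by decide), hf3 11 (by decide), hf1 11 (by decide), h11]
  have g13 : s4 13 0 = F.size := by rw [hf4 13 (by decide), hv3]
  have ek : (basePrec x : ℤ) = 3 * ((2 * n + 7) * (2 * n * (2 * n) + 3) + F.size) := by
    rw [hbase]; push_cast; ring
  simp only [wp_block_cons, wp_set, wp_block_nil, Arith.eval_add', Arith.eval_mul', eval_var, g10, g13, Arith.eval_ofNat, ← ek]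
  refine ⟨natlt _ hk, ?_, ?_, ?_, ?_, ?_⟩
  · have : Frame [10, 11, 12, 13, 14, 15, 18] s s4 :=
      (hf3'.mono (by decide)).trans (hf4.mono (by decide))
    simp [this]
  · rw [Store.write_of_ne (by decide), g10, hN]
  · rw [Store.write_of_ne (by decide), g11, hT]
  · rw [Store.write_of_ne (by decide), hv4]
  · rw [Store.write_same]

end

noncomputable section

/-- The program that computes the circuit. -/
def mainProg : Prog := .block
  [setupProg, passProg true, .set 15 (var 15 + 3 * .cell 0 1), passProg false,
   .assign 2 0 (2 * var 11)]

/-- The first pass fixes the turns at `basePrec x`. The second repeats the elimination with these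
turns and a precision higher by `3 m`, and writes the gates down. As the first pass leaves array `4`
untouched, the second still finds zeros there. -/
theorem wp_mainProg {n m d B : ℕ} {a : Matrix (Fin (2 * n)) (Fin (2 * n)) ℤ} {s : Store}
    {x : Matrix (Fin (2 * n)) (Fin (2 * n)) ℝ} (hx : x.transpose = -x)
    (hxa : x = a.map fun z => (z : ℝ) / d) (hn : 2 ≤ n)
    (h00 : s 0 0 = n) (h01 : s 0 1 = m) (h02 : s 0 2 = d) (ha : HoldsMat s 1 (2 * n) a.entries)
    (h4 : s 4 = 0) (hk : 4 * (2 * n) * (basePrec x + 3 * m) ≤ B)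
    (hN : 2 * (2 * n * (2 * n)) ≤ B) (hm : 8 * (2 : ℤ) ^ m < 2 ^ B)
    (hlt : 4 * (2 * n : ℕ) * (4 : ℤ) ^ (basePrec x + 3 * m) * 4 ^ (basePrec x + 3 * m) < 2 ^ B)
    (hsq : (sumSq a : ℤ) < 2 ^ B) :
    wp B mainProg (fun s' => s' 2 0 = (2 * (2 * n * (2 * n - 1)) : ℕ) ∧
      Written s' (2 * n * (2 * n - 1)) (gateLine n) (gateOffset n)
        (gateWeight x (basePrec x + 3 * m) m) (2 * n * (2 * n - 1))) s := by
  have natlt : ∀ z : ℕ, z ≤ B → |(z : ℤ)| < 2 ^ B := fun z hz => by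
    rw [abs_of_nonneg (by positivity)]
    exact_mod_cast lt_of_le_of_lt hz (Nat.lt_two_pow_self (n := B))
  have hk1 : basePrec x + 3 * m ≤ B := by nlinarith
  have hpow : (4 : ℤ) ^ basePrec x ≤ 4 ^ (basePrec x + 3 * m) :=
    pow_le_pow_right₀ (by norm_num) (by omega)
  have hT : 2 * (2 * n * (2 * n - 1)) ≤ B :=
    (Nat.mul_le_mul_left 2 (Nat.mul_le_mul_left _ (Nat.sub_le _ _))).trans hN
  have h2m : (0 : ℤ) < 2 ^ m := by positivity
  rw [mainProg, wp_block_cons]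
  refine wp_mono ?_ (wp_setupProg hxa (by omega) h00 h01 h02 ha (by omega) (by linarith) hsq
    (by omega))
  rintro s1 ⟨hf1, h10, h11, h14, h15⟩
  have hset : PassSetting x (basePrec x) m a d B true s1 :=
    { two_le := hn
      antisymm := hx
      eq := hxa
      prec_le := le_rfl
      prec_eq := fun _ => rfl
      prec := h15
      lines := by rw [hf1 0 (by decide), h00]
      denom := by rw [hf1 0 (by decide), h02]
      mat := ha.of_eq (hf1 1 (by decide))
      size := h10
      steps := h11
      digits := h14
      le := (Nat.mul_le_mul_left _ (Nat.le_add_right _ _)).trans hk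
      sq_le := by omega
      weight_lt := hm
      lt := lt_of_le_of_lt (by gcongr) hlt }
  rw [wp_block_cons]
  refine wp_mono ?_ (wp_passProg hset (fun e => absurd e (by decide))
    (fun e => absurd e (by decide)))
  rintro s2 ⟨hf2, he2, hs2⟩
  have e15 : (var 15 + 3 * .cell 0 1 : Arith).eval s2 = (basePrec x + 3 * m : ℕ) := by
    rw [Arith.eval_add', Arith.eval_mul', eval_var, Arith.eval_cell, Arith.eval_one,
      Arith.eval_ofNat, hf2 15 (by decide), h15, hf2 0 (by decide), hf1 0 (by decide), h01]
    push_cast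
    rfl
  rw [wp_block_cons, wp_set, e15, wp_block_cons]
  refine ⟨natlt _ hk1, ?_⟩
  have hf3 : Frame [15] s2 (s2.write 15 0 (basePrec x + 3 * m : ℕ)) := by simp [Frame.refl]
  have hset3 : PassSetting x (basePrec x + 3 * m) m a d B false
      (s2.write 15 0 (basePrec x + 3 * m : ℕ)) :=
    { two_le := hn
      antisymm := hx
      eq := hxa
      prec_le := Nat.le_add_right _ _
      prec_eq := fun e => absurd e (by decide)
      prec := Store.write_same
      lines := by rw [hf3 0 (by decide), hf2 0 (by decide), hset.lines]
      denom := by rw [hf3 0 (by decide), hf2 0 (by decide), hset.denom]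
      mat := (hset.mat.of_eq (hf2 1 (by decide))).of_eq (hf3 1 (by decide))
      size := by rw [hf3 10 (by decide), hf2 10 (by decide), h10]
      steps := by rw [hf3 11 (by decide), hf2 11 (by decide), h11]
      digits := by rw [hf3 14 (by decide), hf2 14 (by decide), h14]
      le := hk
      sq_le := by omega
      weight_lt := hm
      lt := hlt }
  refine wp_mono ?_ (wp_passProg hset3
    (fun _ => hs2.chosen.of_frame hf3 (by decide) (by decide) (by decide))
    (fun _ => by rw [hf3 4 (by decide), (he2 rfl).2, hf1 4 (by decide), h4]))
  rintro s4 ⟨hf4, -, hs4⟩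
  have e11 : (2 * var 11 : Arith).eval s4 = (2 * (2 * n * (2 * n - 1)) : ℕ) := by
    rw [Arith.eval_mul', eval_var, hf4 11 (by decide), hset3.steps, Arith.eval_ofNat, Nat.cast_mul 2]
    rfl
  rw [wp_block_cons, wp_assign, e11]
  refine ⟨natlt _ hT, by simp [Store.write], ?_⟩
  exact (hs4.written rfl).of_frame (S := [2]) (by simp [Frame.refl]) (by decide) (by decide)

/-! ### The output of the program -/

/-- Adding half the divisor turns the floor into rounding to the nearest integer, with an error of
half a unit `2 ^ (-m)`. A quarter of the error of the angle is added to it. -/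
theorem abs_roundQuarter_sub_le (k m : ℕ) (ψ : ℤ) {θ : ℝ} (h : |(ψ : ℝ) / 4 ^ k - θ| ≤ 1 / 2 ^ m) :
    |θ / 4 - (roundQuarter k m ψ : ℝ) / 2 ^ m| ≤ 1 / 2 ^ m := by
  have h4 : (0 : ℝ) < 4 ^ k := by positivity
  have h2 : (0 : ℝ) < 2 ^ m := by positivity
  have h4' : (0 : ℤ) < 4 * 4 ^ k := by positivity
  have h1 : (4 * 4 ^ k : ℝ) * roundQuarter k m ψ ≤ ψ * 2 ^ m + 2 * 4 ^ k := by
    exact_mod_cast Int.mul_ediv_self_le h4'.ne'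
  have h3 : (ψ * 2 ^ m + 2 * 4 ^ k : ℝ) < 4 * 4 ^ k * roundQuarter k m ψ + 4 * 4 ^ k := by
    exact_mod_cast Int.lt_mul_ediv_self_add h4'
  have h5 : |(ψ : ℝ) / 4 ^ k / 4 - roundQuarter k m ψ / 2 ^ m| ≤ 1 / 2 / 2 ^ m := by
    have e : (ψ : ℝ) / 4 ^ k / 4 - roundQuarter k m ψ / 2 ^ m =
        (ψ * 2 ^ m - 4 * 4 ^ k * roundQuarter k m ψ) / (4 * 4 ^ k) / 2 ^ m := by field_simp
    rw [e, abs_div, abs_of_pos h2]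
    gcongr
    rw [abs_div, abs_of_pos (by positivity : (0 : ℝ) < 4 * 4 ^ k), div_le_iff₀ (by positivity),
      abs_le]
    constructor <;> linarith
  have e1 : (1 : ℝ) / 2 / 2 ^ m = 1 / 2 ^ m / 2 := by ring
  have h0 : (0 : ℝ) < 1 / 2 ^ m := by positivity
  rw [e1] at h5
  rw [abs_le] at h h5 ⊢
  constructor <;> linarith

theorem abs_planeCoeff_sub_intCoeff_le {A m : ℕ} {ψ : ℝ} {w : ℤ}
    (h : |ψ / 4 - (w : ℝ) / 2 ^ m| ≤ 1 / 2 ^ m) (a b : Fin 4) :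
    |planeCoeff A ψ a b - (intCoeff A w a b : ℝ) / 2 ^ m| ≤ 1 / 2 ^ m := by
  simp only [planeCoeff, Matrix.of_apply, intCoeff]
  split_ifs
  · exact h
  · rw [← abs_neg]
    convert h using 2
    push_cast
    ring
  · simp

theorem describes_gaussianCircuit {n m : ℕ} {H : QOp n} {s : Store} (hn : 2 ≤ n)
    (hx : (realCoeff H).transpose = -realCoeff H)
    (h2 : s 2 0 = (2 * (2 * n * (2 * n - 1)) : ℕ))
    (hs : Written s (2 * n * (2 * n - 1)) (gateLine n) (gateOffset n)
      (gateWeight (realCoeff H) (basePrec (realCoeff H) + 3 * m) m) (2 * n * (2 * n - 1))) :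
    Describes s m (gaussianCircuit n H) := by
  set T := 2 * n * (2 * n - 1) with hT
  have hangle := fun t (ht : t < T) => abs_planeCoeff_sub_intCoeff_le (A := gateOffset n t)
    (abs_roundQuarter_sub_le _ m _ (abs_fixAngle_sub_le hx (by omega) m ht))
  rw [gaussianCircuit, dif_pos hn, ← hT]
  refine ⟨by rw [h2]; simp [elimGates, two_mul], fun j hj => ?_⟩
  have hj' : j < T + T := by simpa [elimGates] using hj
  rcases lt_or_ge j T with h | h
  · rw [List.getElem_append_left (by simpa [elimGates] using h)]
    simp only [elimGates, List.getElem_map, List.getElem_range]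
    refine ⟨hs.line_first j h, fun a b => ?_⟩
    have e := hs.coeff_first j a b h a.2 b.2
    rw [if_pos h] at e
    push_cast
    rw [e]
    exact hangle j h a b
  · obtain ⟨i, rfl⟩ := Nat.exists_eq_add_of_le h
    have hi : i < T := by omega
    rw [List.getElem_append_right (by simp [elimGates])]
    simp only [elimGates, List.getElem_map, List.getElem_range, List.length_map, List.length_range,
      Nat.add_sub_cancel_left]
    refine ⟨by push_cast; exact hs.line_second i hi, fun a b => ?_⟩
    have e := hs.coeff_second i a b hi a.2 b.2
    rw [if_pos hi] at e
    push_cast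
    rw [e]
    exact hangle i hi a b

/-! ### The size of the input -/

theorem bits_sum_le {ι : Type*} (S : Finset ι) (f : ι → ℤ) :
    bits (∑ i ∈ S, f i) ≤ ∑ i ∈ S, (bits (f i) + 1) := by
  classical
  induction S using Finset.induction_on with
  | empty => simp [bits]
  | insert i S hi ih =>
    rw [Finset.sum_insert hi, Finset.sum_insert hi]
    exact (bits_add_le _ _).trans (by omega)

theorem bits_sum_sum_le {N : ℕ} (f : Fin N → Fin N → ℤ) :
    bits (∑ r, ∑ l, f r l) ≤ ∑ r, ∑ l, bits (f r l) + (N * N + N) := by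
  refine (bits_sum_le _ _).trans ((Finset.sum_le_sum fun r _ =>
    Nat.add_le_add_right (bits_sum_le _ _) 1).trans ?_)
  simp only [Finset.sum_add_distrib, Finset.sum_const, Finset.card_univ, Fintype.card_fin,
    smul_eq_mul, mul_one]
  omega

theorem bits_natCast_le (z : ℕ) : bits (z : ℤ) ≤ z := by
  rw [bits_le_iff, abs_of_nonneg (by positivity)]
  exact_mod_cast Nat.lt_two_pow_self

theorem size_sumSq_le {N : ℕ} (a : Matrix (Fin N) (Fin N) ℤ) :
    (sumSq a).size ≤ 2 * ∑ r, ∑ l, bits (a r l) + (N * N + N) := by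
  have e : (sumSq a : ℤ) = ∑ r, ∑ l, a r l * a r l := by
    rw [sumSq]
    push_cast
    simp only [sq, abs_mul_abs_self]
  have h := bits_sum_sum_le fun r l => a r l * a r l
  rw [← e] at h
  refine (show (sumSq a).size ≤ _ from h).trans (Nat.add_le_add_right ?_ _)
  simp only [Finset.mul_sum]
  exact Finset.sum_le_sum fun r _ => Finset.sum_le_sum fun l _ =>
    (bits_mul_le _ _).trans (two_mul _).ge

theorem holdsMat_inputStore (n m d : ℕ) (a : Matrix (Fin (2 * n)) (Fin (2 * n)) ℤ) :
    HoldsMat (inputStore n m d a) 1 (2 * n) a.entries := by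
  intro r l hr hl
  rw [a.entries_apply hr hl]
  have e : ∀ μ ν : Fin (2 * n), ((((2 * n : ℕ) : ℤ) * r + l) = ((2 * n * μ.val + ν.val : ℕ) : ℤ)) ↔
      r = μ ∧ l = ν := fun μ ν => by
    rw [← index_inj hl ν.2]
    push_cast
    rfl
  simp only [inputStore, one_ne_zero, if_false, if_true, e]
  rw [Finset.sum_eq_single ⟨r, hr⟩, Finset.sum_eq_single ⟨l, hl⟩]
  · simp
  · exact fun ν _ h => if_neg fun h' => h (Fin.ext h'.2.symm)
  · simp
  · exact fun μ _ h => Finset.sum_eq_zero fun ν _ => if_neg fun h' => h (Fin.ext h'.1.symm)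
  · simp

theorem inputStore_bounded (n m d : ℕ) (a : Matrix (Fin (2 * n)) (Fin (2 * n)) ℤ) :
    (inputStore n m d a).Bounded (inputSize n m d a + (2 * n * (2 * n) + 2 * n)) := by
  intro A i
  have h0 : bits 0 = 0 := by simp [bits]
  have hn := bits_natCast_le n
  have hm := bits_natCast_le m
  unfold inputStore inputSize
  split_ifs
  · omega
  · omega
  · omega
  · omega
  · refine (bits_sum_sum_le _).trans ?_
    have : ∑ μ : Fin (2 * n), ∑ ν : Fin (2 * n),
        bits (if i = ((2 * n * μ.val + ν.val : ℕ) : ℤ) then a μ ν else 0) ≤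
        ∑ μ, ∑ ν, bits (a μ ν) := by
      refine Finset.sum_le_sum fun μ _ => Finset.sum_le_sum fun ν _ => ?_
      split_ifs
      · exact le_rfl
      · rw [h0]; exact Nat.zero_le _
    omega
  · omega

open Polynomial in
/-- A bound for the bit length of the numbers that occur, in terms of the size of the input. -/
def sizeBound : ℕ[X] :=
  (16 * X + 8) * (3 * ((2 * X + 7) * (4 * X ^ 2 + 3) + (4 * X ^ 2 + 4 * X)) + 3 * X) +
    (8 * X ^ 2 + 8 * X + 10)

/-- The left side collects all that has to stay below `B`: the numbers of passes through loops, the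
binary digits of the sums in the matrix products, those of the input, and those of the sum of the
squares. -/
theorem sizeBound_spec {n m d : ℕ} {a : Matrix (Fin (2 * n)) (Fin (2 * n)) ℤ}
    {x : Matrix (Fin (2 * n)) (Fin (2 * n)) ℝ} (hxa : x = a.map fun z => (z : ℝ) / d) :
    (4 * (2 * n) + 4) * (basePrec x + 3 * m) + (2 * (2 * n * (2 * n)) + 10 +
      inputSize n m d a + 2 * n + (sumSq a).size) ≤ sizeBound.eval (inputSize n m d a) := by
  set σ := inputSize n m d a with hσ
  have hnσ : n ≤ σ := by rw [hσ, inputSize]; omega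
  have hmσ : m ≤ σ := by rw [hσ, inputSize]; omega
  have haσ : ∑ r, ∑ l, bits (a r l) ≤ σ := by rw [hσ, inputSize]; omega
  have hnn : n * n ≤ σ * σ := Nat.mul_le_mul hnσ hnσ
  have h1 : (sumSq a).size ≤ 4 * σ ^ 2 + 4 * σ := by
    refine (size_sumSq_le a).trans ?_
    nlinarith
  have h2 : basePrec x + 3 * m ≤
      3 * ((2 * σ + 7) * (4 * σ ^ 2 + 3) + (4 * σ ^ 2 + 4 * σ)) + 3 * σ := by
    rw [basePrec, hxa, normBound_sub_one]
    have h3 : (sumSq a / (d * d)).size ≤ (sumSq a).size := Nat.size_le_size (Nat.div_le_self _ _)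
    have h4 : 2 * n * (2 * n) + 3 ≤ 4 * σ ^ 2 + 3 := by nlinarith
    have h5 : (2 * n + 7) * (2 * n * (2 * n) + 3) ≤ (2 * σ + 7) * (4 * σ ^ 2 + 3) :=
      Nat.mul_le_mul (by omega) h4
    omega
  have h6 : sizeBound.eval σ =
      (16 * σ + 8) * (3 * ((2 * σ + 7) * (4 * σ ^ 2 + 3) + (4 * σ ^ 2 + 4 * σ)) + 3 * σ) +
        (8 * σ ^ 2 + 8 * σ + 10) := by
    simp [sizeBound]
  rw [h6]
  have h7 := Nat.mul_le_mul (by omega : 4 * (2 * n) + 4 ≤ 16 * σ + 8) h2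
  nlinarith

theorem polyTimeComputable_gaussianCircuit : PolyTimeComputable gaussianCircuit := by
  refine ⟨mainProg, mainProg.timeBound.comp sizeBound, fun n m d a hn hd ha => ?_⟩
  set x : Matrix (Fin (2 * n)) (Fin (2 * n)) ℝ := a.map fun z => (z : ℝ) / d with hxa
  have hx : x.transpose = -x := by
    rw [hxa, ← Matrix.transpose_map, ha]
    ext i j
    simp [neg_div]
  -- Here the circuit, which is assigned to the operator, is connected with the numbers in the
  -- memory.
  have hH : realCoeff (rationalOp d a : QOp n) = x := by
    rw [rationalOp, ← realCoeff_quadraticOp hx]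
    congr 2
    ext i j
    simp [hxa]
  have hspec := sizeBound_spec (m := m) hxa
  set σ := inputSize n m d a with hσ
  set B := sizeBound.eval σ with hB
  set k := basePrec x + 3 * m with hk
  have hmk : m ≤ σ := by rw [hσ, inputSize]; omega
  have hpow : ∀ c, c ≤ B → (2 : ℤ) ^ c ≤ 2 ^ B := fun c hc => pow_le_pow_right₀ (by norm_num) hc
  have hkB : (4 * (2 * n) + 4) * k = 4 * (2 * n) * k + 4 * k := by ring
  have hkB' : 4 * (2 * n) * k ≤ B := by omega
  have hm8 : 8 * (2 : ℤ) ^ m < 2 ^ B := by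
    refine lt_of_lt_of_le ?_ (hpow (m + 4) (by omega))
    rw [pow_add]
    have : (0 : ℤ) < 2 ^ m := by positivity
    linarith
  have hlt : 4 * (2 * n : ℕ) * (4 : ℤ) ^ k * 4 ^ k < 2 ^ B := by
    refine lt_of_lt_of_le ?_ (hpow (2 + 2 * n + 2 * k + 2 * k) (by omega))
    have e : (2 : ℤ) ^ (2 + 2 * n + 2 * k + 2 * k) = 4 * 2 ^ (2 * n) * 4 ^ k * 4 ^ k := by
      rw [pow_add _ _ (2 * k), pow_add _ _ (2 * k), pow_add _ 2, pow_mul 2 2 k]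
      norm_num
    have h2n : ((2 * n : ℕ) : ℤ) < 2 ^ (2 * n) := by exact_mod_cast Nat.lt_two_pow_self
    have h4k : (0 : ℤ) < 4 ^ k := by positivity
    rw [e]
    exact mul_lt_mul_of_pos_right (mul_lt_mul_of_pos_right (by linarith) h4k) h4k
  have hsq : (sumSq a : ℤ) < 2 ^ B := by
    have : sumSq a < 2 ^ B := Nat.size_le.1 (by omega)
    exact_mod_cast this
  have hbd : (inputStore n m d a).Bounded B := fun A i =>
    (inputStore_bounded n m d a A i).trans (by omega)
  obtain ⟨t, s, hr, ht, ⟨h1, h2⟩, -⟩ := runs_of_wp hbd (wp_mainProg (m := m) hx hxa hn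
    (by simp [inputStore]) (by simp [inputStore]) (by simp [inputStore])
    (holdsMat_inputStore n m d a) (by funext i; simp [inputStore]) hkB' (by omega) hm8 hlt hsq)
  refine ⟨t, s, hr, ?_, ?_⟩
  · rwa [Polynomial.eval_comp]
  · exact describes_gaussianCircuit hn (by rw [hH, hx]) h1 (by rw [hH]; exact h2)

end

theorem theorem5 :
    ∃ (C : ℕ) (circuit : (n : ℕ) → QOp n → List (NNGate n)),
      (∀ (n : ℕ), 2 ≤ n → ∀ (H : QOp n), IsQuadraticHamiltonian H →
        (circuit n H).length ≤ C * n ^ 3 ∧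
        (∀ g ∈ circuit n H, g.IsG) ∧
        circuitOp (circuit n H) = expI H) ∧
      PolyTimeComputable circuit := by
  exact ⟨8, gaussianCircuit, fun n hn H hH => ⟨gaussianCircuit_length H, gaussianCircuit_isG H,
    circuitOp_gaussianCircuit hn hH⟩, polyTimeComputable_gaussianCircuit⟩
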